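/- Let $\mathbb K$ be an algebraically closed field of characteristic zero and let $m\ge 2$. Let $M$ be the space of skew-symmetric $(2m+2)\times(2m+2)$ matrices $A=[a_{ij}]$ over $\mathbb K$, with homogeneous coordinates $(a_{ij})_{i<j}$ on $\mathbb P(M)=\mathbb P^{2m^2+3m}$ and dual coordinates $(y_{ij})_{i<j}$ on $\mathbb P(M^*)$. Let $A_{2m}=\{[A]\in\mathbb P(M):\operatorname{rk}A\le 2m\}=V(\operatorname{Pf})$, where $\operatorname{Pf}^2=\det(A)$, and let $\mathbb G(1,\mathbb P^{2m+1})\subset\mathbb P(M^*)$ be the Grassmann variety of lines in its Plücker embedding. Let $p\in\mathbb G(1,\mathbb P^{2m+1})\subset \mathbb P(M^*)$, let $p^\perp\subset\mathbb P(M)$ be the hyperplane $\sum_{i<j}p_{ij}a_{ij}=0$, so that $p^\perp=\mathbb P^{2m^2+3m-1}$, and let $$F_m=A_{2m}\cap p^\perp\subset p^\perp=\mathbb P^{2m^2+3m-1}.$$ Let $G_m\subset(\mathbb P^{2m^2+3m-1})^*=(p^\perp)^*$ be the (closure of the) projection of $\mathbb G(1,\mathbb P^{2m+1})$ from the point $p$.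 For a reduced hypersurface $X=V(f)\subset\mathbb P^N$ the polar image $Z_X\subseteq(\mathbb P^N)^*$ is the closure of the image of the rational map $x\mapsto\left(\frac{\partial f}{\partial x_0}(x):\cdots:\frac{\partial f}{\partial x_N}(x)\right)$, the hessian of $X$ is $\det\left[\frac{\partial^2 f}{\partial x_i\partial x_j}\right]$, and for an irreducible projective variety $X$ the dual variety $X^*$ is the closure of the set of hyperplanes tangent to $X$ at some non-singular point. Then: (i) $F_m\subset\mathbb P^{2m^2+3m-1}$ is an irreducible hypersurface of degree $m+1$, whose equation is the restriction of $\operatorname{Pf}$ to $p^\perp$ and is an irreducible polynomial; it has vanishing hessian, and $F_m^*=G_m$. (ii) $Z_{F_m}\subset(\mathbb P^{2m^2+3m-1})^*$ is an irreducible hypersurface of degree $m$; it is a cone, whose vertex is a linear space $\mathbb P^{4m-1}$, over a variety projectively equivalent to the dual of the Grassmann variety $\mathbb G(1,\mathbb P^{2m-1})\subset\mathbb P^{2m^2-m-1}$ (in its Plücker embedding). (iii) $F_m^*\subseteq Z_{F_m}$ and $\operatorname{codim}(F_m^*,Z_{F_m})=\dim Z_{F_m}-\dim F_m^*=2m^2-m-2$.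 -/

import Mathlib

open scoped LinearAlgebra.Projectivization

namespace HessianScorza

noncomputable section

section ProjectiveVarieties

variable {K : Type*} [Field K] {ι κ : Type*}

/-- The zero locus in projective space of a homogeneous polynomial. For a homogeneous `f` the
choice of the representative of a point does not matter; the definition is only used for
such `f`. -/
def zeroLocus (f : MvPolynomial ι K) : Set (ℙ K (ι → K)) :=
  {x | MvPolynomial.eval x.rep f = 0}

/-- The Zariski topology on projective space: the topology generated by the complements of the
zero loci of homogeneous polynomials. -/
instance zariskiTopology : TopologicalSpace (ℙ K (ι → K)) :=
  TopologicalSpace.generateFrom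
    {U | ∃ (d : ℕ) (f : MvPolynomial ι K), f.IsHomogeneous d ∧ U = (zeroLocus f)ᶜ}

/-- The value of the gradient of `f` at the vector `v`. -/
def gradient (f : MvPolynomial ι K) (v : ι → K) : ι → K :=
  fun i => MvPolynomial.eval v (MvPolynomial.pderiv i f)

/-- The hessian determinant of a polynomial. -/
def hessian [Fintype ι] [DecidableEq ι] (f : MvPolynomial ι K) : MvPolynomial ι K :=
  (Matrix.of fun i j => MvPolynomial.pderiv i (MvPolynomial.pderiv j f)).det

/-- The polar image of the hypersurface `V(f)`: the closure of the image of the polar map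
`x ↦ (∂f/∂x_0(x) : ⋯ : ∂f/∂x_N(x))`, which is defined where the gradient is not zero.
The target is the dual projective space, in the dual coordinates. -/
def polarImage (f : MvPolynomial ι K) : Set (ℙ K (ι → K)) :=
  closure {y | ∃ (x : ℙ K (ι → K)) (h : gradient f x.rep ≠ 0),
    y = Projectivization.mk K (gradient f x.rep) h}

/-- The embedded tangent space of `X` at `x`, as a linear subspace of the vector space: the
common kernel of the differentials at `x` of all homogeneous polynomials vanishing on `X`. -/
def tangentSubspace [Fintype ι] (X : Set (ℙ K (ι → K))) (x : ℙ K (ι → K)) :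
    Submodule K (ι → K) where
  carrier := {v | ∀ (d : ℕ) (g : MvPolynomial ι K), g.IsHomogeneous d → X ⊆ zeroLocus g →
    gradient g x.rep ⬝ᵥ v = 0}
  add_mem' := by
    intro a b ha hb d g hg hX
    rw [dotProduct_add, ha d g hg hX, hb d g hg hX, add_zero]
  zero_mem' := by
    intro d g hg hX
    exact dotProduct_zero _
  smul_mem' := by
    intro c a ha d g hg hX
    rw [dotProduct_smul, ha d g hg hX, smul_zero]

/-- The non-singular points of an irreducible variety `X`: those where the tangent space has the
least dimension (which is the dimension of `X`). -/
def regularPoints [Fintype ι] (X : Set (ℙ K (ι → K))) : Set (ℙ K (ι → K)) :=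
  {x | x ∈ X ∧ ∀ y ∈ X,
    Module.finrank K (tangentSubspace X x) ≤ Module.finrank K (tangentSubspace X y)}

/-- The dual variety of an irreducible variety `X`: the closure, in the dual projective space (in
the dual coordinates), of the set of hyperplanes tangent to `X` at some non-singular point. For
a hypersurface it is the closure of the image of the Gauss map. -/
def dualVariety [Fintype ι] (X : Set (ℙ K (ι → K))) : Set (ℙ K (ι → K)) :=
  closure {h | ∃ x ∈ regularPoints X, ∀ v ∈ tangentSubspace X x, h.rep ⬝ᵥ v = 0}

/-- The projection of `X`, from the linear centre `P(ker T)`: the closure of the image of the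
points of `X` outside the centre under the rational map induced by `T`. -/
def linearProjection (T : (κ → K) →ₗ[K] (ι → K)) (X : Set (ℙ K (κ → K))) :
    Set (ℙ K (ι → K)) :=
  closure {w | ∃ y ∈ X, ∃ h : T y.rep ≠ 0, w = Projectivization.mk K (T y.rep) h}

/-- The linear subspace `P(L)` of projective space. -/
def linearSubspace (L : Submodule K (ι → K)) : Set (ℙ K (ι → K)) :=
  {x | x.rep ∈ L}

/-- The vertex of `X`: the points `x` of `X` such that for every point `y` of `X` the span
of `x` and `y` is contained in `X`. -/
def vertexLocus (X : Set (ℙ K (ι → K))) : Set (ℙ K (ι → K)) :=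
  {x | x ∈ X ∧ ∀ y ∈ X, ∀ (a b : K) (h : a • x.rep + b • y.rep ≠ 0),
    Projectivization.mk K (a • x.rep + b • y.rep) h ∈ X}

/-- `X` is a cone with vertex exactly `P(L)` over a variety which is projectively equivalent
to `B`: for some linear embedding `j` of the ambient space of `B` as a complement of `L`, the
set `X` is the union of the spans of `P(L)` and the points of `j(B)`, and the vertex of `X`
is `P(L)`. -/
def IsConeOver (X : Set (ℙ K (ι → K))) (L : Submodule K (ι → K)) (B : Set (ℙ K (κ → K))) :
    Prop :=
  vertexLocus X = linearSubspace L ∧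
  ∃ j : (κ → K) →ₗ[K] (ι → K), Function.Injective j ∧ IsCompl L (LinearMap.range j) ∧
    X = {x | ∃ y ∈ B, x.rep ∈ L ⊔ Submodule.span K {j y.rep}}

end ProjectiveVarieties

section SkewMatrices

/-- The positions above the diagonal of an `n × n` matrix. -/
abbrev Pairs (n : ℕ) : Type := {q : Fin n × Fin n // q.1 < q.2}

/-- The skew-symmetric matrix with given entries above the diagonal. -/
def skewMatrix {R : Type*} [CommRing R] {n : ℕ} (a : Pairs n → R) :
    Matrix (Fin n) (Fin n) R :=
  Matrix.of fun i j =>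
    if h : i < j then a ⟨(i, j), h⟩ else if h : j < i then -a ⟨(j, i), h⟩ else 0

variable (K : Type*) [Field K]

/-- In the projective space of skew-symmetric `n × n` matrices, the locus of the matrices of
rank at most `s`. -/
def skewRankLocus (n s : ℕ) : Set (ℙ K (Pairs n → K)) :=
  {x | (skewMatrix x.rep).rank ≤ s}

/-- The Grassmann variety of lines in `P^{n-1}` in its Plücker embedding: the points whose
coordinates are the `2 × 2` minors of a `2 × n` matrix with rows `u` and `v`. -/
def grassmannianLines (n : ℕ) : Set (ℙ K (Pairs n → K)) :=
  {x | ∃ u v : Fin n → K, x.rep = fun q => u q.1.1 * v q.1.2 - u q.1.2 * v q.1.1}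

variable {K}

/-- The hyperplane `p^⊥`, as a linear subspace, given by a point `p` of the dual projective
space in the dual coordinates. -/
def perp {n : ℕ} (p : ℙ K (Pairs n → K)) : Submodule K (Pairs n → K) where
  carrier := {a | a ⬝ᵥ p.rep = 0}
  add_mem' := by
    intro a b ha hb
    have ha' : a ⬝ᵥ p.rep = 0 := ha
    have hb' : b ⬝ᵥ p.rep = 0 := hb
    change (a + b) ⬝ᵥ p.rep = 0
    rw [add_dotProduct, ha', hb', add_zero]
  zero_mem' := zero_dotProduct _
  smul_mem' := by
    intro c a ha
    have ha' : a ⬝ᵥ p.rep = 0 := ha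
    change (c • a) ⬝ᵥ p.rep = 0
    rw [smul_dotProduct, ha', smul_zero]

variable {n : ℕ} {p : ℙ K (Pairs n → K)} {ι : Type*} [Fintype ι]

/-- The parametrization `x ↦ ∑ i, x i • b i` of `p^⊥` by the coordinates of a basis `b`. -/
def coordMap (b : Module.Basis ι K (perp p)) : (ι → K) →ₗ[K] (Pairs n → K) :=
  (perp p).subtype ∘ₗ b.equivFun.symm.toLinearMap

theorem coordMap_injective (b : Module.Basis ι K (perp p)) :
    Function.Injective (coordMap b) :=
  (perp p).injective_subtype.comp b.equivFun.symm.injective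

/-- The linear section of `X` by the hyperplane `p^⊥`, as a subset of `P(p^⊥)`, written in the
coordinates of the basis `b`. -/
def hyperplaneSection (b : Module.Basis ι K (perp p)) (X : Set (ℙ K (Pairs n → K))) :
    Set (ℙ K (ι → K)) :=
  Projectivization.map (coordMap b) (coordMap_injective b) ⁻¹' X

/-- The restriction to `p^⊥` of linear forms on the space of skew-symmetric matrices, in the
coordinates dual to the basis `b`. Its kernel is the line spanned by `p`, so that it induces
the projection from the point `p`, with target the dual projective space of `P(p^⊥)`. -/
def restrictForms (b : Module.Basis ι K (perp p)) : (Pairs n → K) →ₗ[K] (ι → K) :=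
  LinearMap.pi fun i => dotProductBilin K K (b i : Pairs n → K)

/-- The generic skew-symmetric matrix in `p^⊥`, whose entries are linear forms in the
coordinates of the basis `b`. -/
def genericSkew (b : Module.Basis ι K (perp p)) :
    Matrix (Fin n) (Fin n) (MvPolynomial ι K) :=
  skewMatrix fun q =>
    ∑ i, MvPolynomial.C ((b i : Pairs n → K) q) * MvPolynomial.X i

end SkewMatrices

end

end HessianScorza

/-! Put V = K^(2m+2), p = u ∧ v, and let f be the restriction of Pf to p^⊥. Everything rests on the
identity A · ∇Pf(A) = -Pf(A) · 1 (`IsPfaffian.skewMatrix_mul_gradient`), where ∇Pf(A) is read as a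
skew-symmetric matrix. At an invertible A the gradient is thus proportional to A⁻¹; differentiating
the identity once more shows that at a singular A the gradient, if nonzero, is the wedge of two
kernel vectors (`IsPfaffian.exists_gradient_eq_wedge`). Restricting forms to p^⊥ is projecting from
p, so ∇f is ∇Pf modulo p (`gradient_pullback_coordMap`).

Polar image. Forms modulo p still map to Λ²(V/⟨u,v⟩); call this map ρ, and let Pf' be the Pfaffian
of size 2m. If A ∈ p^⊥ is invertible, then Au is annihilated by u because A is alternating and by v
because A ∈ p^⊥, so it is a covector on V/⟨u,v⟩, and it lies in the kernel of the compression of A⁻¹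
to that quotient. Hence g = Pf' ∘ ρ vanishes on the polar image (`eval_congruence_gradient`). The
argument can be reversed: if an invertible Y has singular compression, then Y⁻¹ ∈ p^⊥
(`exists_gradient_eq_smul`), and such Y are dense in the irreducible hypersurface of matrices with
singular compression. So the polar image is V(g), a cone with vertex P(ker ρ) over V(Pf'). The
latter is dual to the Grassmannian of lines in P^(2m-1), since a hyperplane is tangent at a line
exactly when the corresponding alternating form has that line in its kernel
(`dualVariety_grassmannianLines`).

Hessian. From g(∇f) = 0 the chain rule gives Hess(f) · ∇g(∇f) = 0. If the hessian were not zero, all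
partial derivatives of g would vanish on V(g), which is impossible for an irreducible g of degree m
≥ 2.

Dual variety. The Gauss map sends a point of rank 2m whose kernel line L differs from p to the
projection of L from p. Every such L occurs, because in a space of dimension 2m ≥ 4 any two vectors
are orthogonal for some nondegenerate alternating form. The Gauss map is the polar map restricted to
the hypersurface, whence the inclusion in (iii).

Irreducibility is tested on a three-parameter family of matrices, on which the Pfaffian is a
constant times x^(k+1) ± y z^k (`irreducible_pullback_cornerFamily`). Dimensions are bounded below
by slicing a chart with coordinate subspaces, and above by chains of primes in the ring of the
affine cone. -/

namespace HessianScorza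

open MvPolynomial

/-! ### Polynomials: chain rule, restriction to linear spaces, homogeneous factors, polynomial
functions -/

section Polynomials

variable {K : Type*} [Field K] {ι κ : Type*}

/-- The chain rule, for an arbitrary derivation so that it serves both `pderiv` and the derivative
of polynomials in one variable. -/
theorem Derivation.map_mvPolynomial_aeval {A : Type*} [CommRing A] [Algebra K A] [Fintype ι]
    (D : Derivation K A A) (g : ι → A) (f : MvPolynomial ι K) :
    D (aeval g f) = ∑ i, aeval g (pderiv i f) * D (g i) := by
  classical
  induction f using MvPolynomial.induction_on with
  | C a => simp
  | add p q hp hq => simp [hp, hq, add_mul, Finset.sum_add_distrib]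
  | mul_X p j hp =>
    simp only [map_mul, Derivation.leibniz, hp, aeval_X, smul_eq_mul, map_add, pderiv_X,
      add_mul, Finset.sum_add_distrib, Finset.mul_sum]
    congr 1
    · rw [Finset.sum_eq_single j]
      · simp
      · intro i _ hi
        simp [hi.symm]
      · simp
    · exact Finset.sum_congr rfl fun i _ => by ring

theorem eval_aeval (g : ι → MvPolynomial κ K) (f : MvPolynomial ι K) (v : κ → K) :
    eval v (aeval g f) = eval (fun i => eval v (g i)) f := by
  induction f using MvPolynomial.induction_on with
  | C a => simp
  | add p q hp hq => rw [map_add, map_add, map_add, hp, hq]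
  | mul_X p j hp => rw [map_mul, map_mul, map_mul, hp, eval_X, aeval_X]

/-- The composition of a polynomial with a linear map. -/
noncomputable def pullback [Fintype κ] (f : MvPolynomial ι K) (L : (κ → K) →ₗ[K] (ι → K)) :
    MvPolynomial κ K := by
  classical
  exact aeval (fun i => ∑ k, C (L (Pi.single k 1) i) * X k) f

theorem sum_single_apply [Fintype κ] [DecidableEq κ] (L : (κ → K) →ₗ[K] (ι → K)) (v : κ → K)
    (i : ι) : ∑ k, L (Pi.single k 1) i * v k = L v i := by
  conv_rhs => rw [pi_eq_sum_univ' v]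
  simp [mul_comm, Finset.sum_apply, Pi.single]

@[simp] theorem eval_pullback [Fintype κ] (f : MvPolynomial ι K) (L : (κ → K) →ₗ[K] (ι → K))
    (v : κ → K) : eval v (pullback f L) = eval (L v) f := by
  classical
  have : ∀ i, eval v (∑ k, C (L (Pi.single k 1) i) * X k) = L v i := by
    intro i
    rw [← sum_single_apply L v i]
    simp
  rw [pullback, eval_aeval]
  congr 2
  exact funext this

theorem IsHomogeneous.pullback [Fintype κ] {f : MvPolynomial ι K} {d : ℕ}
    (hf : f.IsHomogeneous d) (L : (κ → K) →ₗ[K] (ι → K)) : (pullback f L).IsHomogeneous d := by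
  classical
  have := MvPolynomial.IsHomogeneous.aeval hf
    (fun i => ∑ k, C (L (Pi.single k 1) i) * X k : ι → MvPolynomial κ K) (n := 1)
    (fun i => MvPolynomial.IsHomogeneous.sum _ _ _ fun k _ => isHomogeneous_C_mul_X _ _)
  simpa [HessianScorza.pullback] using this

theorem pullback_mul [Fintype κ] (f g : MvPolynomial ι K) (L : (κ → K) →ₗ[K] (ι → K)) :
    pullback (f * g) L = pullback f L * pullback g L := by
  simp [pullback]

theorem gradient_pullback [Fintype κ] [Fintype ι] [DecidableEq κ] (f : MvPolynomial ι K)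
    (L : (κ → K) →ₗ[K] (ι → K)) (v : κ → K) (k : κ) :
    gradient (pullback f L) v k = gradient f (L v) ⬝ᵥ L (Pi.single k 1) := by
  have h : ∀ g : MvPolynomial ι K, aeval (fun i => ∑ k, C (L (Pi.single k 1) i) * X k) g =
      pullback g L := by
    intro g
    rw [pullback]
    congr!
  simp only [gradient, dotProduct]
  rw [← h f, Derivation.map_mvPolynomial_aeval (pderiv k), map_sum]
  refine Finset.sum_congr rfl fun i _ => ?_
  rw [map_mul, h, eval_pullback]
  congr 1
  simp [pderiv_X, Pi.single_apply]

/-- The restriction of a polynomial to an affine line. -/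
noncomputable def lineRestrict (f : MvPolynomial ι K) (a c : ι → K) : Polynomial K :=
  aeval (fun i => Polynomial.C (a i) + Polynomial.C (c i) * Polynomial.X) f

@[simp] theorem eval_lineRestrict (f : MvPolynomial ι K) (a c : ι → K) (t : K) :
    (lineRestrict f a c).eval t = eval (a + t • c) f := by
  induction f using MvPolynomial.induction_on with
  | C a => simp [lineRestrict]
  | add p q hp hq =>
    rw [lineRestrict] at hp hq ⊢
    rw [map_add, map_add, Polynomial.eval_add, hp, hq]
  | mul_X p j hp =>
    rw [lineRestrict] at hp ⊢
    rw [map_mul, map_mul, Polynomial.eval_mul, hp, aeval_X, eval_X, Polynomial.eval_add,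
      Polynomial.eval_mul, Polynomial.eval_C, Polynomial.eval_C, Polynomial.eval_X, Pi.add_apply,
      Pi.smul_apply, smul_eq_mul, mul_comm t]

theorem eval_derivative_lineRestrict [Fintype ι] (f : MvPolynomial ι K) (a c : ι → K) (t : K) :
    (lineRestrict f a c).derivative.eval t = gradient f (a + t • c) ⬝ᵥ c := by
  have := Derivation.map_mvPolynomial_aeval (K := K) (Polynomial.derivative' (R := K))
    (fun i => Polynomial.C (a i) + Polynomial.C (c i) * Polynomial.X) f
  rw [Polynomial.derivative'_apply] at this
  rw [lineRestrict, this, Polynomial.eval_finsetSum]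
  refine Finset.sum_congr rfl fun i _ => ?_
  change _ = eval (a + t • c) (pderiv i f) * c i
  rw [← eval_lineRestrict, lineRestrict]
  simp

theorem derivative_lineRestrict [Fintype ι] [DecidableEq ι] (f : MvPolynomial ι K) (a : ι → K)
    (i : ι) : (lineRestrict f a (Pi.single i 1)).derivative =
      lineRestrict (pderiv i f) a (Pi.single i 1) := by
  have := Derivation.map_mvPolynomial_aeval (K := K) (Polynomial.derivative' (R := K))
    (fun j => Polynomial.C (a j) + Polynomial.C ((Pi.single i 1 : ι → K) j) * Polynomial.X) f
  rw [Polynomial.derivative'_apply] at this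
  rw [lineRestrict, this, lineRestrict, Finset.sum_eq_single i]
  · simp
  · intro j _ hj
    simp [hj]
  · simp

theorem IsHomogeneous.eval_smul {f : MvPolynomial ι K} {d : ℕ} (hf : f.IsHomogeneous d) (t : K)
    (v : ι → K) : eval (t • v) f = t ^ d * eval v f := by
  rw [eval_eq, eval_eq, Finset.mul_sum]
  refine Finset.sum_congr rfl fun s hs => ?_
  have := hf.degree_eq_sum_deg_support hs
  rw [this]
  simp only [Pi.smul_apply, smul_eq_mul, mul_pow, Finset.prod_mul_distrib]
  rw [Finset.prod_pow_eq_pow_sum]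
  ring

theorem eval_smul_eq_sum (f : MvPolynomial ι K) (t : K) (v : ι → K) :
    eval (t • v) f = ∑ i ∈ Finset.range (f.totalDegree + 1),
      t ^ i * eval v (homogeneousComponent i f) := by
  conv_lhs => rw [← sum_homogeneousComponent f]
  rw [map_sum]
  exact Finset.sum_congr rfl fun i _ =>
    HessianScorza.IsHomogeneous.eval_smul (homogeneousComponent_isHomogeneous i f) t v

/-- If `f` vanishes on a whole line through the origin, so do its homogeneous components. -/
theorem eval_homogeneousComponent_eq_zero [Infinite K] (f : MvPolynomial ι K) (v : ι → K)
    (h : ∀ t : K, eval (t • v) f = 0) (i : ℕ) : eval v (homogeneousComponent i f) = 0 := by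
  by_cases hi : i < f.totalDegree + 1
  · have hp : (∑ j ∈ Finset.range (f.totalDegree + 1),
        Polynomial.C (eval v (homogeneousComponent j f)) * Polynomial.X ^ j) = 0 := by
      apply Polynomial.funext
      intro t
      rw [Polynomial.eval_zero, ← h t, eval_smul_eq_sum, Polynomial.eval_finsetSum]
      refine Finset.sum_congr rfl fun j _ => ?_
      rw [Polynomial.eval_mul, Polynomial.eval_C, Polynomial.eval_pow, Polynomial.eval_X,
        mul_comm]
    have := congrArg (fun p => Polynomial.coeff p i) hp
    simpa [Polynomial.finsetSum_coeff, Polynomial.coeff_C_mul_X_pow, hi] using this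
  · rw [homogeneousComponent_eq_zero _ _ (by omega), map_zero]

/-- Substitution of `t X i` for `X i`. -/
noncomputable def dilate : MvPolynomial ι K →ₐ[K] Polynomial (MvPolynomial ι K) :=
  aeval fun i => Polynomial.C (X i) * Polynomial.X

theorem dilate_of_isHomogeneous {f : MvPolynomial ι K} {d : ℕ} (hf : f.IsHomogeneous d) :
    dilate f = Polynomial.C f * Polynomial.X ^ d := by
  have key : ∀ s : ι →₀ ℕ, ∀ c : K, dilate (monomial s c) =
      Polynomial.C (monomial s c) * Polynomial.X ^ s.degree := by
    intro s c
    rw [dilate, aeval_monomial]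
    have h1 : (s.prod fun i e => (Polynomial.C (X i) * Polynomial.X :
        Polynomial (MvPolynomial ι K)) ^ e) = (s.prod fun i e => Polynomial.C (X i) ^ e) *
        s.prod fun _ e => Polynomial.X ^ e := by
      simp only [mul_pow]
      exact Finsupp.prod_mul
    have h2 : (s.prod fun _ e => (Polynomial.X : Polynomial (MvPolynomial ι K)) ^ e) =
        Polynomial.X ^ s.degree := by
      rw [Finsupp.prod, Finset.prod_pow_eq_pow_sum, Finsupp.degree_apply]
    rw [h1, h2, monomial_eq, map_mul, ← mul_assoc]
    congr 2
    rw [Finsupp.prod, Finsupp.prod, map_prod]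
    simp
  rw [← support_sum_monomial_coeff f]
  simp only [map_sum, Finset.sum_mul]
  refine Finset.sum_congr rfl fun s hs => ?_
  rw [key]
  have := hf (mem_support_iff.1 hs)
  rw [show s.degree = d by rw [← this, Finsupp.degree_eq_weight_one]; rfl]

theorem dilate_eq_sum (f : MvPolynomial ι K) :
    dilate f = ∑ i ∈ Finset.range (f.totalDegree + 1),
      Polynomial.C (homogeneousComponent i f) * Polynomial.X ^ i := by
  conv_lhs => rw [← sum_homogeneousComponent f]
  rw [map_sum]
  exact Finset.sum_congr rfl fun i _ =>
    dilate_of_isHomogeneous (homogeneousComponent_isHomogeneous i f)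

theorem coeff_dilate (f : MvPolynomial ι K) (i : ℕ) :
    (dilate f).coeff i = homogeneousComponent i f := by
  rw [dilate_eq_sum, Polynomial.finsetSum_coeff]
  simp only [Polynomial.coeff_C_mul_X_pow]
  by_cases hi : i < f.totalDegree + 1
  · simp [hi]
  · rw [homogeneousComponent_eq_zero _ _ (by omega)]
    refine Finset.sum_eq_zero fun j hj => ?_
    rw [if_neg]
    rintro rfl
    exact hi (Finset.mem_range.1 hj)

theorem eval_one_dilate (f : MvPolynomial ι K) : (dilate f).eval 1 = f := by
  rw [dilate_eq_sum, Polynomial.eval_finsetSum]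
  simp [sum_homogeneousComponent]

theorem dilate_ne_zero {f : MvPolynomial ι K} (hf : f ≠ 0) : dilate f ≠ 0 := by
  intro h
  apply hf
  rw [← eval_one_dilate f, h, Polynomial.eval_zero]

/-- The factors of a nonzero homogeneous polynomial are homogeneous. -/
theorem exists_isHomogeneous_of_mul {f g : MvPolynomial ι K} {d : ℕ}
    (h : (f * g).IsHomogeneous d) (h0 : f * g ≠ 0) :
    ∃ e, f.IsHomogeneous e := by
  have hf : f ≠ 0 := left_ne_zero_of_mul h0
  have hg : g ≠ 0 := right_ne_zero_of_mul h0
  have hd := dilate_of_isHomogeneous h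
  rw [map_mul] at hd
  have hdf := dilate_ne_zero hf
  have hdg := dilate_ne_zero hg
  have h1 := Polynomial.natDegree_mul hdf hdg
  have h2 := Polynomial.natTrailingDegree_mul hdf hdg
  rw [hd, Polynomial.natDegree_C_mul_X_pow _ _ h0] at h1
  rw [hd, Polynomial.C_mul_X_pow_eq_monomial, Polynomial.natTrailingDegree_monomial h0] at h2
  have h3 := Polynomial.natTrailingDegree_le_natDegree (dilate f)
  have h4 := Polynomial.natTrailingDegree_le_natDegree (dilate g)
  refine ⟨(dilate f).natDegree, ?_⟩
  clear hd
  -- Degree and trailing degree both add up over the product, and they agree for the product, which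
  -- is a monomial in the dilation variable.
  have h5 : (dilate f).natTrailingDegree = (dilate f).natDegree := by omega
  have h6 : f = homogeneousComponent (dilate f).natDegree f := by
    rw [← coeff_dilate]
    conv_lhs => rw [← eval_one_dilate f, Polynomial.eval_eq_sum_range]
    rw [Finset.sum_range_succ, Finset.sum_eq_zero]
    · simp
    · intro i hi
      rw [Polynomial.coeff_eq_zero_of_lt_natTrailingDegree, zero_mul]
      rw [h5]
      exact Finset.mem_range.1 hi
  have h7 := homogeneousComponent_isHomogeneous (dilate f).natDegree f
  rwa [← h6] at h7

/-- Restriction preserves the degree of a homogeneous polynomial unless it gives zero, so a nonzero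
constant can only come from degree zero. Homogeneity is essential: 1 + x restricts to the unit 1 on
x = 0. -/
theorem isUnit_of_isUnit_pullback [Fintype κ] {f : MvPolynomial ι K} {d : ℕ}
    (hf : f.IsHomogeneous d) {L : (κ → K) →ₗ[K] (ι → K)} (hu : IsUnit (pullback f L)) :
    IsUnit f := by
  obtain ⟨c, hc, h⟩ := MvPolynomial.isUnit_iff_eq_C_of_isReduced.1 hu
  have h0 : pullback f L ≠ 0 := hu.ne_zero
  have hd : d = 0 := by
    have h1 := IsHomogeneous.pullback hf L
    have h2 : (pullback f L).IsHomogeneous 0 := by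
      rw [h]
      exact isHomogeneous_C _ _
    exact h1.inj_right h2 h0
  subst hd
  have h3 : f = C (coeff 0 f) := by
    rw [← totalDegree_eq_zero_iff_eq_C]
    exact (totalDegree_zero_iff_isHomogeneous _).2 hf
  rw [h3, MvPolynomial.isUnit_iff_eq_C_of_isReduced]
  refine ⟨_, ?_, rfl⟩
  rw [isUnit_iff_ne_zero]
  intro h4
  apply h0
  rw [h3, h4]
  simp [pullback]

/-- A homogeneous polynomial is irreducible if its restriction to some linear space is. -/
theorem irreducible_of_irreducible_pullback [Fintype κ] {f : MvPolynomial ι K} {d : ℕ}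
    (hf : f.IsHomogeneous d) {L : (κ → K) →ₗ[K] (ι → K)} (h : Irreducible (pullback f L)) :
    Irreducible f := by
  have hf0 : f ≠ 0 := by
    rintro rfl
    apply h.ne_zero
    simp [pullback]
  refine ⟨fun hu => h.not_isUnit ?_, fun a b hab => ?_⟩
  · rw [pullback]
    exact hu.map _
  · rw [hab, pullback_mul] at h
    rw [hab] at hf hf0
    obtain ⟨_, ha⟩ := exists_isHomogeneous_of_mul hf hf0
    obtain ⟨_, hb⟩ := exists_isHomogeneous_of_mul (mul_comm a b ▸ hf) (mul_comm a b ▸ hf0)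
    rcases h.isUnit_or_isUnit rfl with h | h
    · exact Or.inl (isUnit_of_isUnit_pullback ha h)
    · exact Or.inr (isUnit_of_isUnit_pullback hb h)

/-- The Nullstellensatz for an irreducible hypersurface. -/
theorem dvd_of_eval_eq_zero [IsAlgClosed K] [Finite ι] {f h : MvPolynomial ι K}
    (hf : Irreducible f) (hv : ∀ v, eval v f = 0 → eval v h = 0) : f ∣ h := by
  have hp : Prime f := UniqueFactorizationMonoid.irreducible_iff_prime.1 hf
  have : (Ideal.span {f}).IsPrime := (Ideal.span_singleton_prime hp.ne_zero).2 hp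
  rw [← Ideal.mem_span_singleton, ← IsPrime.vanishingIdeal_zeroLocus (K := K) (Ideal.span {f})]
  intro v hvm
  rw [zeroLocus_span] at hvm
  exact hv v (hvm f rfl)

/-- A function on `K ^ κ` given by a polynomial. -/
def IsPolyFun (φ : (κ → K) → K) : Prop := ∃ p : MvPolynomial κ K, ∀ t, eval t p = φ t

namespace IsPolyFun

theorem const (c : K) : IsPolyFun fun _ : κ → K => c := ⟨C c, by simp⟩

theorem coord (k : κ) : IsPolyFun fun t : κ → K => t k := ⟨X k, by simp⟩

theorem add {φ ψ : (κ → K) → K} (h : IsPolyFun φ) (h' : IsPolyFun ψ) :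
    IsPolyFun fun t => φ t + ψ t := by
  obtain ⟨p, hp⟩ := h
  obtain ⟨q, hq⟩ := h'
  exact ⟨p + q, by simp [hp, hq]⟩

theorem mul {φ ψ : (κ → K) → K} (h : IsPolyFun φ) (h' : IsPolyFun ψ) :
    IsPolyFun fun t => φ t * ψ t := by
  obtain ⟨p, hp⟩ := h
  obtain ⟨q, hq⟩ := h'
  exact ⟨p * q, by simp [hp, hq]⟩

theorem neg {φ : (κ → K) → K} (h : IsPolyFun φ) : IsPolyFun fun t => -φ t := by
  obtain ⟨p, hp⟩ := h
  exact ⟨-p, by simp [hp]⟩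

theorem sub {φ ψ : (κ → K) → K} (h : IsPolyFun φ) (h' : IsPolyFun ψ) :
    IsPolyFun fun t => φ t - ψ t := by
  simpa only [sub_eq_add_neg] using h.add h'.neg

theorem sum {α : Type*} (s : Finset α) {φ : α → (κ → K) → K} (h : ∀ a, IsPolyFun (φ a)) :
    IsPolyFun fun t => ∑ a ∈ s, φ a t := by
  choose p hp using h
  exact ⟨∑ a ∈ s, p a, by simp [hp]⟩

/-- Composition of polynomial maps. -/
theorem comp {φ : (ι → K) → K} (h : IsPolyFun φ) {ψ : (κ → K) → ι → K}
    (h' : ∀ i, IsPolyFun fun t => ψ t i) : IsPolyFun fun t => φ (ψ t) := by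
  obtain ⟨p, hp⟩ := h
  choose q hq using h'
  refine ⟨aeval q p, fun t => ?_⟩
  change _ = φ (ψ t)
  rw [← hp, eval_aeval]
  congr 2
  exact funext fun i => hq i t

theorem eval (f : MvPolynomial ι K) : IsPolyFun fun v => MvPolynomial.eval v f := ⟨f, fun _ => rfl⟩

theorem linear [Finite κ] (L : (κ → K) →ₗ[K] K) : IsPolyFun fun t => L t := by
  classical
  have := Fintype.ofFinite κ
  have h : ∀ t : κ → K, L t = ∑ k, t k * L (Pi.single k 1) := by
    intro t
    conv_lhs => rw [pi_eq_sum_univ' t]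
    simp
  rw [show (fun t => L t) = fun t : κ → K => ∑ k, t k * L (Pi.single k 1) from funext h]
  exact sum _ fun k => (coord k).mul (const _)

/-- The density argument: a polynomial identity need only be checked where some nonzero polynomial
does not vanish, because the polynomial ring is a domain and `K` is infinite. -/
theorem eq_zero_or_eq_zero [Infinite K] {φ ψ : (κ → K) → K} (h : IsPolyFun φ) (h' : IsPolyFun ψ)
    (h0 : ∀ t, φ t * ψ t = 0) : (∀ t, φ t = 0) ∨ ∀ t, ψ t = 0 := by
  obtain ⟨p, hp⟩ := h
  obtain ⟨q, hq⟩ := h'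
  have : p * q = 0 := MvPolynomial.funext fun t => by simp [hp, hq, h0]
  rcases mul_eq_zero.1 this with rfl | rfl
  · exact Or.inl fun t => by simp [← hp]
  · exact Or.inr fun t => by simp [← hq]

end IsPolyFun

end Polynomials

/-! ### The Zariski topology of projective space: closures, irreducibility and Krull dimension -/

section Zariski

variable {K : Type*} [Field K] {ι κ : Type*}

theorem isClosed_zeroLocus {f : MvPolynomial ι K} {d : ℕ} (hf : f.IsHomogeneous d) :
    IsClosed (zeroLocus f) :=
  ⟨TopologicalSpace.GenerateOpen.basic _ ⟨d, f, hf, rfl⟩⟩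

theorem mk_mem_zeroLocus {f : MvPolynomial ι K} {d : ℕ} (hf : f.IsHomogeneous d) {v : ι → K}
    (hv : v ≠ 0) : Projectivization.mk K v hv ∈ zeroLocus f ↔ eval v f = 0 := by
  obtain ⟨a, ha⟩ := Projectivization.exists_smul_eq_mk_rep K v hv
  change eval (Projectivization.mk K v hv).rep f = 0 ↔ _
  rw [← ha, show a • v = (a : K) • v from rfl, IsHomogeneous.eval_smul hf]
  simp

theorem exists_isHomogeneous_of_isOpen {U : Set (ℙ K (ι → K))} (hU : IsOpen U)
    {x : ℙ K (ι → K)} (hx : x ∈ U) :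
    ∃ (d : ℕ) (h : MvPolynomial ι K), h.IsHomogeneous d ∧ x ∉ zeroLocus h ∧ (zeroLocus h)ᶜ ⊆ U := by
  induction hU with
  | basic s hs =>
    obtain ⟨d, f, hf, rfl⟩ := hs
    exact ⟨d, f, hf, hx, subset_rfl⟩
  | univ =>
    exact ⟨0, 1, isHomogeneous_one _ _, by simp [zeroLocus], Set.subset_univ _⟩
  | inter s t _ _ hs ht =>
    obtain ⟨d, f, hf, hxf, hsf⟩ := hs hx.1
    obtain ⟨e, g, hg, hxg, htg⟩ := ht hx.2
    refine ⟨d + e, f * g, hf.mul hg, ?_, ?_⟩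
    · simp only [zeroLocus, Set.mem_ofPred_eq, map_mul, mul_eq_zero, not_or] at *
      exact ⟨hxf, hxg⟩
    · intro y hy
      simp only [zeroLocus, Set.mem_compl_iff, Set.mem_ofPred_eq, map_mul, mul_eq_zero,
        not_or] at hy
      exact ⟨hsf hy.1, htg hy.2⟩
  | sUnion S _ ih =>
    obtain ⟨s, hs, hxs⟩ := hx
    obtain ⟨d, f, hf, hxf, hsf⟩ := ih s hs hxs
    exact ⟨d, f, hf, hxf, hsf.trans (Set.subset_sUnion_of_mem hs)⟩

/-- Products of homogeneous polynomials are homogeneous, so the complements of zero loci are a basis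
and not only a subbasis; closures can therefore be tested on one polynomial at a time. -/
theorem mem_closure_iff_zeroLocus {S : Set (ℙ K (ι → K))} {x : ℙ K (ι → K)} :
    x ∈ closure S ↔ ∀ (d : ℕ) (h : MvPolynomial ι K), h.IsHomogeneous d → S ⊆ zeroLocus h →
      x ∈ zeroLocus h := by
  constructor
  · intro hx d h hh hS
    exact closure_minimal hS (isClosed_zeroLocus hh) hx
  · intro H
    rw [mem_closure_iff]
    intro U hU hxU
    obtain ⟨d, h, hh, hxh, hsub⟩ := exists_isHomogeneous_of_isOpen hU hxU
    by_contra hemp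
    refine hxh (H d h hh fun y hy => ?_)
    by_contra hy'
    exact hemp ⟨y, hsub hy', hy⟩

/-- The set of points of projective space parametrized by `φ`, where `q` does not vanish. -/
def paramSet (φ : (κ → K) → ι → K) (q : (κ → K) → K) : Set (ℙ K (ι → K)) :=
  {x | ∃ t, q t ≠ 0 ∧ ∃ h : φ t ≠ 0, x = Projectivization.mk K (φ t) h}

/-- Open conditions on the image become nonvanishing conditions for polynomials on affine space, and
two nonzero polynomials have a common point of nonvanishing. -/
theorem isIrreducible_paramSet [Infinite K] {φ : (κ → K) → ι → K} {q : (κ → K) → K}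
    (hφ : ∀ i, IsPolyFun fun t => φ t i) (hq : IsPolyFun q) (hqφ : ∀ t, q t ≠ 0 → φ t ≠ 0)
    (hq0 : ∃ t, q t ≠ 0) : IsIrreducible (paramSet φ q) := by
  refine ⟨?_, ?_⟩
  · obtain ⟨t, ht⟩ := hq0
    exact ⟨_, t, ht, hqφ t ht, rfl⟩
  · rintro U V hU hV ⟨_, ⟨t, ht, hφt, rfl⟩, hxU⟩ ⟨_, ⟨s, hs, hφs, rfl⟩, hxV⟩
    obtain ⟨d, f, hf, hxf, hUf⟩ := exists_isHomogeneous_of_isOpen hU hxU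
    obtain ⟨e, g, hg, hxg, hVg⟩ := exists_isHomogeneous_of_isOpen hV hxV
    rw [mk_mem_zeroLocus hf] at hxf
    rw [mk_mem_zeroLocus hg] at hxg
    have hf' : IsPolyFun fun t => eval (φ t) f * q t := ((IsPolyFun.eval f).comp hφ).mul hq
    have hg' : IsPolyFun fun t => eval (φ t) g := (IsPolyFun.eval g).comp hφ
    by_contra hemp
    have key : ∀ t, eval (φ t) f * q t * eval (φ t) g = 0 := by
      intro r
      by_contra hr
      rw [mul_assoc, mul_eq_zero, mul_eq_zero, not_or, not_or] at hr
      have hφr := hqφ r hr.2.1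
      refine hemp ⟨_, ⟨r, hr.2.1, hφr, rfl⟩, hUf ?_, hVg ?_⟩
      · rw [Set.mem_compl_iff, mk_mem_zeroLocus hf]
        exact hr.1
      · rw [Set.mem_compl_iff, mk_mem_zeroLocus hg]
        exact hr.2.2
    rcases hf'.eq_zero_or_eq_zero hg' key with h | h
    · exact mul_ne_zero hxf ht (h t)
    · exact hxg (h s)

theorem isIrreducible_of_isInducing {X Y : Type*} [TopologicalSpace X] [TopologicalSpace Y]
    {f : X → Y} (hf : Topology.IsInducing f) {s : Set X} (hs : IsIrreducible (f '' s)) :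
    IsIrreducible s := by
  refine ⟨Set.image_nonempty.1 hs.1, ?_⟩
  rintro U V hU hV ⟨x, hxs, hxU⟩ ⟨y, hys, hyV⟩
  obtain ⟨U', hU', rfl⟩ := hf.isOpen_iff.1 hU
  obtain ⟨V', hV', rfl⟩ := hf.isOpen_iff.1 hV
  obtain ⟨_, ⟨z, hz, rfl⟩, hzU, hzV⟩ :=
    hs.2 U' V' hU' hV' ⟨f x, ⟨x, hxs, rfl⟩, hxU⟩ ⟨f y, ⟨y, hys, rfl⟩, hyV⟩
  exact ⟨z, hz, hzU, hzV⟩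

/-- A linear form as a homogeneous polynomial. -/
theorem exists_polynomial_of_linearForm [Finite ι] (ℓ : (ι → K) →ₗ[K] K) :
    ∃ h : MvPolynomial ι K, h.IsHomogeneous 1 ∧ ∀ v, eval v h = ℓ v := by
  classical
  have := Fintype.ofFinite ι
  refine ⟨∑ i, C (ℓ (Pi.single i 1)) * X i,
    MvPolynomial.IsHomogeneous.sum _ _ _ fun k _ => isHomogeneous_C_mul_X _ _, fun v => ?_⟩
  conv_rhs => rw [pi_eq_sum_univ' v]
  simp [mul_comm]

/-- A lower bound for the dimension, from a chart of dimension `d` with affine coordinates given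
by quotients of linear forms. -/
theorem le_topologicalKrullDim [Infinite K] [Finite ι] {X : Set (ℙ K (ι → K))} {d : ℕ}
    {φ : (Fin d → K) → ι → K} {q : (Fin d → K) → K}
    (hφ : ∀ i, IsPolyFun fun t => φ t i) (hq : IsPolyFun q) (ℓ₀ : (ι → K) →ₗ[K] K)
    (ℓ : Fin d → (ι → K) →ₗ[K] K) (hℓ₀ : ∀ t, ℓ₀ (φ t) = q t)
    (hℓ : ∀ t k, ℓ k (φ t) = q t * t k) (hq0 : q 0 ≠ 0)
    (hX : ∀ t (h : φ t ≠ 0), Projectivization.mk K (φ t) h ∈ X) :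
    (d : WithBot ℕ∞) ≤ topologicalKrullDim X := by
  -- `tr k` keeps the first `k` coordinates and kills the others. The closures of the images of
  -- these coordinate slices form the chain.
  let tr : ℕ → (Fin d → K) → Fin d → K := fun k t j => if (j : ℕ) < k then t j else 0
  have htr : ∀ k j, IsPolyFun fun t => tr k t j := by
    intro k j
    by_cases h : (j : ℕ) < k
    · simpa [tr, h] using IsPolyFun.coord (K := K) j
    · simpa [tr, h] using IsPolyFun.const (K := K) (κ := Fin d) 0
  have hqφ : ∀ t, q t ≠ 0 → φ t ≠ 0 := by
    intro t ht h
    rw [← hℓ₀, h, map_zero] at ht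
    exact ht rfl
  let S : ℕ → Set X := fun k => Subtype.val ⁻¹' paramSet (fun t => φ (tr k t)) (fun t => q (tr k t))
  have himg : ∀ k, Subtype.val '' S k =
      paramSet (fun t => φ (tr k t)) (fun t => q (tr k t)) := by
    intro k
    rw [Subtype.image_preimage_coe, Set.inter_eq_right]
    rintro _ ⟨t, ht, h, rfl⟩
    exact hX _ h
  have hirr : ∀ k, IsIrreducible (S k) := by
    intro k
    refine isIrreducible_of_isInducing Topology.IsInducing.subtypeVal ?_
    rw [himg]
    refine isIrreducible_paramSet (fun i => (hφ i).comp (htr k)) (hq.comp (htr k))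
      (fun t => hqφ _) ⟨0, ?_⟩
    have : tr k 0 = 0 := by
      funext j
      simp [tr]
    rwa [this]
  let D : ℕ → TopologicalSpace.IrreducibleCloseds X := fun k =>
    ⟨closure (S k), (hirr k).closure, isClosed_closure⟩
  have hlt : ∀ k : Fin d, D k < D (k + 1) := by
    intro k
    refine lt_of_le_of_ne ?_ ?_
    · refine closure_mono ?_
      rintro x ⟨t, ht, h, hx⟩
      have : tr (k + 1) (tr k t) = tr k t := by
        funext j
        simp only [tr]
        split_ifs <;> first | rfl | omega
      exact ⟨tr k t, by simpa only [this] using ht, by simpa only [this] using h,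
        by simpa only [this] using hx⟩
    · intro heq
      have heq' : closure (S k) = closure (S (k + 1)) :=
        congrArg (fun c : TopologicalSpace.IrreducibleCloseds X => (c : Set X)) heq
      -- A point of slice `k + 1` with nonzero coordinate `t k`: the linear form `ℓ k` vanishes on
      -- slice `k` but not at this point, so the inclusion is strict.
      obtain ⟨t, ht⟩ : ∃ t : Fin d → K, q (tr (k + 1) t) * t k ≠ 0 := by
        by_contra! hcon
        rcases (hq.comp (htr (k + 1))).eq_zero_or_eq_zero (IsPolyFun.coord k) hcon with h | h
        · apply hq0
          have := h 0
          have h0 : tr (k + 1) 0 = 0 := by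
            funext j
            simp [tr]
          rwa [h0] at this
        · simpa using h 1
      have hq' := left_ne_zero_of_mul ht
      have hφ' := hqφ _ hq'
      let y : X := ⟨_, hX _ hφ'⟩
      have hy : y ∈ closure (S k) := by
        rw [heq']
        exact subset_closure ⟨t, hq', hφ', rfl⟩
      obtain ⟨h, hh, hhv⟩ := exists_polynomial_of_linearForm (ℓ k)
      have hcl : IsClosed (Subtype.val ⁻¹' zeroLocus h : Set X) :=
        (isClosed_zeroLocus hh).preimage continuous_subtype_val
      have hsub : S k ⊆ Subtype.val ⁻¹' zeroLocus h := by
        rintro x ⟨s, hs, hφs, hx⟩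
        change x.1 ∈ zeroLocus h
        rw [hx, mk_mem_zeroLocus hh, hhv, hℓ]
        simp [tr]
      have hy' : y.1 ∈ zeroLocus h := closure_minimal hsub hcl hy
      rw [mk_mem_zeroLocus hh, hhv, hℓ] at hy'
      apply ht
      simpa [tr] using hy'
  let p : LTSeries (TopologicalSpace.IrreducibleCloseds X) :=
    { length := d
      toFun := fun k => D k
      step := fun k => by simpa using hlt k }
  exact Order.LTSeries.length_le_krullDim p

/-- The ideal of the affine cone over a set of points of projective space. -/
def coneIdeal (S : Set (ℙ K (ι → K))) : Ideal (MvPolynomial ι K) where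
  carrier := {h | ∀ x ∈ S, ∀ c : K, eval (c • x.rep) h = 0}
  add_mem' := by
    intro a b ha hb x hx c
    rw [map_add, ha x hx c, hb x hx c, add_zero]
  zero_mem' := by
    intro x _ c
    exact map_zero _
  smul_mem' := by
    intro c a ha x hx t
    rw [smul_eq_mul, map_mul, ha x hx t, mul_zero]

theorem mem_coneIdeal_of_isHomogeneous {S : Set (ℙ K (ι → K))} {f : MvPolynomial ι K} {d : ℕ}
    (hf : f.IsHomogeneous d) : f ∈ coneIdeal S ↔ S ⊆ zeroLocus f := by
  constructor
  · intro h x hx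
    simpa [zeroLocus] using h x hx 1
  · intro h x hx c
    rw [IsHomogeneous.eval_smul hf, show eval x.rep f = 0 from h hx, mul_zero]

theorem coneIdeal_anti {S T : Set (ℙ K (ι → K))} (h : S ⊆ T) : coneIdeal T ≤ coneIdeal S :=
  fun _ hf x hx c => hf x (h hx) c

theorem subset_closure_of_coneIdeal_le {S T : Set (ℙ K (ι → K))}
    (h : coneIdeal S ≤ coneIdeal T) : T ⊆ closure S := by
  intro x hx
  rw [mem_closure_iff_zeroLocus]
  intro d f hf hS
  exact (mem_coneIdeal_of_isHomogeneous hf).1 (h ((mem_coneIdeal_of_isHomogeneous hf).2 hS)) hx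

-- The cone ideal is homogeneous, as over an infinite field vanishing on a line through the origin
-- passes to the homogeneous components. Primality then has to be tested on homogeneous elements
-- only, where it is the irreducibility of `S`.
attribute [local instance] MvPolynomial.gradedAlgebra in
theorem isPrime_coneIdeal [Infinite K] {S : Set (ℙ K (ι → K))} (hS : IsIrreducible S) :
    (coneIdeal S).IsPrime := by
  have hhom : (coneIdeal S).IsHomogeneous (homogeneousSubmodule ι K) := by
    intro i f hf
    have h := decomposition.decompose'_apply (R := K) f i
    change (decomposition.decompose' f i : MvPolynomial ι K) ∈ _
    rw [h]
    intro x hx c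
    rw [IsHomogeneous.eval_smul (homogeneousComponent_isHomogeneous i f),
      eval_homogeneousComponent_eq_zero f _ (hf x hx), mul_zero]
  refine hhom.isPrime_of_homogeneous_mem_or_mem ?_ ?_
  · obtain ⟨x, hx⟩ := hS.1
    intro h
    have : (1 : MvPolynomial ι K) ∈ coneIdeal S := h ▸ Submodule.mem_top
    simpa using this x hx 1
  · rintro f g ⟨d, hf⟩ ⟨e, hg⟩ hfg
    rw [mem_coneIdeal_of_isHomogeneous hf, mem_coneIdeal_of_isHomogeneous hg]
    rw [mem_coneIdeal_of_isHomogeneous (hf.mul hg)] at hfg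
    refine isPreirreducible_iff_isClosed_union_isClosed.1 hS.2 _ _ (isClosed_zeroLocus hf)
      (isClosed_zeroLocus hg) fun x hx => ?_
    have := hfg hx
    simpa [zeroLocus] using this

theorem coneIdeal_lt_ker {S : Set (ℙ K (ι → K))} (hS : S.Nonempty) :
    coneIdeal S < RingHom.ker (eval (0 : ι → K)) := by
  obtain ⟨x, hx⟩ := hS
  refine lt_of_le_of_ne (fun f hf => ?_) fun heq => ?_
  · simpa using hf x hx 0
  · obtain ⟨i, hi⟩ : ∃ i, x.rep i ≠ 0 := Function.ne_iff.1 x.rep_nonzero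
    have : (X i : MvPolynomial ι K) ∈ coneIdeal S := by
      rw [heq]
      simp [RingHom.mem_ker]
    apply hi
    simpa using this x hx 1

/-- The prime ideal of the cone over an irreducible closed subset of `X`. -/
noncomputable def primeOfIrreducibleClosed [Infinite K] {X : Set (ℙ K (ι → K))}
    (C : TopologicalSpace.IrreducibleCloseds X) : PrimeSpectrum (MvPolynomial ι K) :=
  ⟨coneIdeal (Subtype.val '' (C : Set X)),
    isPrime_coneIdeal (C.isIrreducible.image _ continuous_subtype_val.continuousOn)⟩

/-- The inclusion is strict because a closed set is recovered from the homogeneous polynomials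
vanishing on it. -/
theorem primeOfIrreducibleClosed_lt [Infinite K] {X : Set (ℙ K (ι → K))}
    {C D : TopologicalSpace.IrreducibleCloseds X} (h : C < D) :
    primeOfIrreducibleClosed D < primeOfIrreducibleClosed C := by
  refine lt_of_le_not_ge (coneIdeal_anti (Set.image_mono h.le)) fun hle => ?_
  refine h.not_ge fun x hx => ?_
  have := subset_closure_of_coneIdeal_le hle ⟨x, hx, rfl⟩
  have h2 := Topology.IsInducing.subtypeVal.closure_eq_preimage_closure_image (C : Set X)
  rw [C.isClosed.closure_eq] at h2
  change x ∈ (C : Set X)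
  rw [h2]
  exact this

/-- The ideals of a chain of irreducible closed subsets of `X`, completed by the irrelevant
ideal, form a chain of primes containing the ideal of the cone over `X`. -/
theorem exists_ltSeries_primeSpectrum [Infinite K] {X : Set (ℙ K (ι → K))}
    (p : LTSeries (TopologicalSpace.IrreducibleCloseds X)) :
    ∃ q : LTSeries (PrimeSpectrum (MvPolynomial ι K)), q.length = p.length + 1 ∧
      coneIdeal X ≤ q.head.asIdeal := by
  let r : LTSeries (PrimeSpectrum (MvPolynomial ι K)) :=
    { length := p.length
      toFun := fun i => primeOfIrreducibleClosed (p (Fin.rev i))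
      step := fun i => primeOfIrreducibleClosed_lt (p.strictMono (by simp [Fin.lt_def]; omega)) }
  have hm : r.last < ⟨RingHom.ker (eval (0 : ι → K)), RingHom.ker_isPrime _⟩ :=
    coneIdeal_lt_ker ((p _).isIrreducible.nonempty.image _)
  refine ⟨r.snoc _ hm, by simp [r], ?_⟩
  rw [RelSeries.head_snoc]
  exact coneIdeal_anti (Subtype.coe_image_subset X _)

/-- The affine cone has one dimension more than the projective set: the irrelevant ideal is the
additional member of a chain of primes. -/
theorem topologicalKrullDim_add_one_le [Infinite K] {X : Set (ℙ K (ι → K))}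
    {J : Ideal (MvPolynomial ι K)} (hJ : J ≤ coneIdeal X) {n : ℕ}
    (hn : ringKrullDim (MvPolynomial ι K ⧸ J) ≤ (n + 1 : ℕ)) : topologicalKrullDim X ≤ n := by
  refine iSup_le fun p => ?_
  obtain ⟨q, hq, hle⟩ := exists_ltSeries_primeSpectrum p
  rw [ringKrullDim_quotient] at hn
  let r : LTSeries (PrimeSpectrum.zeroLocus (J : Set (MvPolynomial ι K))) :=
    { length := q.length
      toFun := fun i => ⟨q i, fun f hf => (LTSeries.head_le q i) (hle (hJ hf))⟩
      step := fun i => q.step i }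
  have h1 := (Order.LTSeries.length_le_krullDim r).trans hn
  have h2 : r.length = p.length + 1 := hq
  rw [h2] at h1
  have h3 : p.length + 1 ≤ n + 1 := by exact_mod_cast h1
  exact_mod_cast Nat.le_of_succ_le_succ h3

/-- A chain of closed subsets gains two primes: the irrelevant ideal above, and the zero ideal
below, which is smaller than the others because these contain `g`. This leaves at most (n + 2) - 2.
-/
theorem topologicalKrullDim_hypersurface_le [Infinite K] [Fintype ι] {X : Set (ℙ K (ι → K))}
    {g : MvPolynomial ι K} {d : ℕ} (hg : g.IsHomogeneous d) (hg0 : g ≠ 0) (hX : X ⊆ zeroLocus g)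
    {n : ℕ} (hn : Fintype.card ι = n + 2) : topologicalKrullDim X ≤ n := by
  refine iSup_le fun p => ?_
  obtain ⟨q, hq, hle⟩ := exists_ltSeries_primeSpectrum p
  have hlt : (⊥ : PrimeSpectrum (MvPolynomial ι K)) < q.head := by
    refine lt_of_le_of_ne bot_le fun h => hg0 ?_
    have := hle ((mem_coneIdeal_of_isHomogeneous hg).2 hX)
    rw [← h] at this
    exact this
  have h1 := Order.LTSeries.length_le_krullDim (q.cons _ hlt)
  have h2 : Order.krullDim (PrimeSpectrum (MvPolynomial ι K)) = (n + 2 : ℕ) := by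
    change ringKrullDim _ = _
    rw [MvPolynomial.ringKrullDim_of_isNoetherianRing, ringKrullDim_eq_zero_of_field,
      Nat.card_eq_fintype_card, hn, zero_add]
  rw [h2, RelSeries.cons_length, hq] at h1
  have h3 : p.length + 1 + 1 ≤ n + 2 := by exact_mod_cast h1
  have h4 : p.length ≤ n := by omega
  exact_mod_cast h4

/-- Noether normalization reduces the dimension to a number of algebraically independent elements,
and their images stay independent in the polynomial ring, where the transcendence degree bounds
them. -/
theorem ringKrullDim_le_of_injective_mvPolynomial {A : Type*} [CommRing A] [Algebra K A]
    [Algebra.FiniteType K A] [Fintype κ] (f : A →ₐ[K] MvPolynomial κ K)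
    (hf : Function.Injective f) : ringKrullDim A ≤ Fintype.card κ := by
  have : Nontrivial A := f.domain_nontrivial
  obtain ⟨s, g, hg, hint⟩ := exists_integral_inj_algHom_of_fg K A
  have h1 : ringKrullDim A ≤ ringKrullDim (MvPolynomial (Fin s) K) := by
    let _ := g.toRingHom.toAlgebra
    have : Algebra.IsIntegral (MvPolynomial (Fin s) K) A := ⟨hint⟩
    refine Order.krullDim_le_of_strictMono (PrimeSpectrum.comap (algebraMap _ A)) ?_
    intro I J h
    exact Ideal.IsIntegral.comap_lt_comap h
  refine h1.trans ?_
  rw [MvPolynomial.ringKrullDim_of_isNoetherianRing, ringKrullDim_eq_zero_of_field, zero_add,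
    Nat.card_eq_fintype_card, Fintype.card_fin]
  have h2 := lift_trdeg_le_of_injective (f.comp g) (hf.comp hg)
  rw [MvPolynomial.trdeg_of_isDomain, MvPolynomial.trdeg_of_isDomain] at h2
  simp at h2
  exact_mod_cast h2

/-- An upper bound for the dimension of the closure of a set with a polynomial
parametrization. -/
theorem topologicalKrullDim_closure_le [Infinite K] [Finite ι] {d : ℕ}
    {φ : (Fin d → K) → ι → K} (hφ : ∀ i, IsPolyFun fun t => φ t i) {X : Set (ℙ K (ι → K))}
    (hX : X ⊆ closure {x | ∃ t, ∃ h : φ t ≠ 0, x = Projectivization.mk K (φ t) h}) :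
    topologicalKrullDim X ≤ d := by
  choose p hp using hφ
  -- The extra variable `none` is the scalar along the cone. The ring modulo the kernel of `F`
  -- embeds in a polynomial ring in `d + 1` variables, which bounds the dimension of the affine
  -- cone.
  let F : MvPolynomial ι K →ₐ[K] MvPolynomial (Option (Fin d)) K :=
    aeval fun i => MvPolynomial.X none * rename some (p i)
  have hJ : RingHom.ker F ≤ coneIdeal X := by
    intro f hf x hx c
    have hF : ∀ (s : K) (t : Fin d → K), eval (s • φ t) f = 0 := by
      intro s t
      have h1 : eval (fun o : Option (Fin d) => o.elim s t) (F f) = 0 := by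
        rw [(RingHom.mem_ker).1 hf, map_zero]
      rw [eval_aeval] at h1
      convert! h1 using 3
      funext i
      have : (fun o : Option (Fin d) => o.elim s t) ∘ some = t := rfl
      simp [eval_rename, this, hp]
    rw [eval_smul_eq_sum]
    refine Finset.sum_eq_zero fun i _ => ?_
    rw [mul_eq_zero]
    right
    refine mem_closure_iff_zeroLocus.1 (hX hx) i _ (homogeneousComponent_isHomogeneous i f) ?_
    rintro _ ⟨t, ht, rfl⟩
    rw [mk_mem_zeroLocus (homogeneousComponent_isHomogeneous i f)]
    exact eval_homogeneousComponent_eq_zero f _ (fun s => hF s t) i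
  refine topologicalKrullDim_add_one_le hJ ?_
  have := ringKrullDim_le_of_injective_mvPolynomial (Ideal.kerLiftAlg F)
    (Ideal.kerLiftAlg_injective F)
  simpa using this

end Zariski

/-! ### Linear algebra of alternating matrices: congruence, decomposable matrices, Darboux bases -/

section SkewLinearAlgebra

variable {K : Type*} [Field K] {n n' : ℕ}

theorem skewMatrix_apply_of_lt {R : Type*} [CommRing R] (a : Pairs n → R) {i j : Fin n}
    (h : i < j) : skewMatrix a i j = a ⟨(i, j), h⟩ := by
  simp [skewMatrix, h]

@[simp] theorem skewMatrix_apply_self {R : Type*} [CommRing R] (a : Pairs n → R) (i : Fin n) :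
    skewMatrix a i i = 0 := by
  simp [skewMatrix]

theorem skewMatrix_apply_swap {R : Type*} [CommRing R] (a : Pairs n → R) (i j : Fin n) :
    skewMatrix a j i = -skewMatrix a i j := by
  rcases lt_trichotomy i j with h | h | h
  · simp [skewMatrix, h, h.not_gt]
  · simp [h]
  · simp [skewMatrix, h, h.not_gt]

theorem transpose_skewMatrix {R : Type*} [CommRing R] (a : Pairs n → R) :
    (skewMatrix a).transpose = -skewMatrix a := by
  ext i j
  exact skewMatrix_apply_swap a i j

theorem map_skewMatrix {R S : Type*} [CommRing R] [CommRing S] (f : R →+* S) (a : Pairs n → R) :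
    (skewMatrix a).map f = skewMatrix fun q => f (a q) := by
  ext i j
  simp only [skewMatrix, Matrix.map_apply, Matrix.of_apply]
  split_ifs <;> simp

theorem skewMatrix_add (a c : Pairs n → K) :
    skewMatrix (a + c) = skewMatrix a + skewMatrix c := by
  ext i j
  simp only [skewMatrix, Matrix.add_apply, Matrix.of_apply]
  split_ifs <;> simp [add_comm]

theorem skewMatrix_smul (t : K) (a : Pairs n → K) :
    skewMatrix (t • a) = t • skewMatrix a := by
  ext i j
  simp only [skewMatrix, Matrix.smul_apply, Matrix.of_apply]
  split_ifs <;> simp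

/-- The entries of a matrix above the diagonal. -/
def upper (A : Matrix (Fin n) (Fin n) K) : Pairs n → K := fun q => A q.1.1 q.1.2

theorem upper_skewMatrix (a : Pairs n → K) : upper (skewMatrix a) = a := by
  funext q
  exact skewMatrix_apply_of_lt a q.2

theorem skewMatrix_injective : Function.Injective (skewMatrix : (Pairs n → K) → _) :=
  Function.LeftInverse.injective upper_skewMatrix

theorem skewMatrix_upper [CharZero K] {A : Matrix (Fin n) (Fin n) K} (hA : A.transpose = -A) :
    skewMatrix (upper A) = A := by
  have h : ∀ i j, A j i = -A i j := fun i j => congrFun (congrFun hA i) j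
  ext i j
  rcases lt_trichotomy i j with hij | hij | hij
  · rw [skewMatrix_apply_of_lt _ hij]
    rfl
  · subst hij
    rw [skewMatrix_apply_self]
    exact (self_eq_neg.1 (h i i)).symm
  · rw [skewMatrix_apply_swap _ j i, skewMatrix_apply_of_lt _ hij, h j i]
    rfl

/-- The action `A ↦ Q A Qᵀ` of a matrix on skew-symmetric matrices. -/
def congruence (Q : Matrix (Fin n') (Fin n) K) : (Pairs n → K) →ₗ[K] (Pairs n' → K) where
  toFun a := upper (Q * skewMatrix a * Q.transpose)
  map_add' a c := by
    rw [skewMatrix_add, Matrix.mul_add, Matrix.add_mul]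
    rfl
  map_smul' t a := by
    rw [skewMatrix_smul, Matrix.mul_smul, Matrix.smul_mul]
    rfl

theorem skewMatrix_congruence [CharZero K] (Q : Matrix (Fin n') (Fin n) K) (a : Pairs n → K) :
    skewMatrix (congruence Q a) = Q * skewMatrix a * Q.transpose := by
  refine skewMatrix_upper (A := Q * skewMatrix a * Q.transpose) ?_
  rw [Matrix.transpose_mul, Matrix.transpose_mul, transpose_skewMatrix, Matrix.transpose_transpose,
    Matrix.neg_mul, Matrix.mul_neg, Matrix.mul_assoc]

theorem congruence_mul [CharZero K] {n'' : ℕ} (Q : Matrix (Fin n') (Fin n) K)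
    (R : Matrix (Fin n) (Fin n'') K) (a : Pairs n'' → K) :
    congruence (Q * R) a = congruence Q (congruence R a) := by
  apply skewMatrix_injective
  simp only [skewMatrix_congruence, Matrix.transpose_mul, Matrix.mul_assoc]

theorem congruence_one [CharZero K] (a : Pairs n → K) :
    congruence (1 : Matrix (Fin n) (Fin n) K) a = a := by
  apply skewMatrix_injective
  simp [skewMatrix_congruence]

/-- The Plücker coordinates of the line spanned by two vectors. -/
def wedge (u v : Fin n → K) : Pairs n → K := fun q => u q.1.1 * v q.1.2 - u q.1.2 * v q.1.1

theorem skewMatrix_wedge (u v : Fin n → K) :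
    skewMatrix (wedge u v) = Matrix.vecMulVec u v - Matrix.vecMulVec v u := by
  ext i j
  simp only [Matrix.sub_apply, Matrix.vecMulVec_apply]
  rcases lt_trichotomy i j with h | h | h
  · rw [skewMatrix_apply_of_lt _ h]
    simp only [wedge]
    ring
  · subst h
    rw [skewMatrix_apply_self]
    ring
  · rw [skewMatrix_apply_swap _ j i, skewMatrix_apply_of_lt _ h]
    simp only [wedge]
    ring

theorem congruence_wedge [CharZero K] (Q : Matrix (Fin n') (Fin n) K) (u v : Fin n → K) :
    congruence Q (wedge u v) = wedge (Q.mulVec u) (Q.mulVec v) := by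
  apply skewMatrix_injective
  rw [skewMatrix_congruence, skewMatrix_wedge, skewMatrix_wedge, Matrix.mul_sub, Matrix.sub_mul,
    Matrix.mul_vecMulVec, Matrix.mul_vecMulVec, Matrix.vecMulVec_mul, Matrix.vecMulVec_mul,
    Matrix.vecMul_transpose, Matrix.vecMul_transpose]

theorem sum_pairs {M : Type*} [AddCommGroup M] (F : Fin n → Fin n → M) (hF : ∀ i, F i i = 0) :
    ∑ i, ∑ j, F i j = ∑ q : Pairs n, (F q.1.1 q.1.2 + F q.1.2 q.1.1) := by
  have h1 : ∀ G : Fin n → Fin n → M, ∑ q : Pairs n, G q.1.1 q.1.2 =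
      ∑ i, ∑ j, if i < j then G i j else 0 := by
    intro G
    rw [← Fintype.sum_prod_type' (f := fun i j => if i < j then G i j else 0)]
    rw [← Finset.sum_filter]
    exact (Finset.sum_subtype _ (by simp) (fun q : Fin n × Fin n => G q.1 q.2)).symm
  rw [Finset.sum_add_distrib, h1 F, h1 fun i j => F j i,
    Finset.sum_comm (f := fun i j => if i < j then F j i else 0), ← Finset.sum_add_distrib]
  refine Finset.sum_congr rfl fun i _ => ?_
  rw [← Finset.sum_add_distrib]
  refine Finset.sum_congr rfl fun j _ => ?_
  rcases lt_trichotomy i j with h | h | h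
  · simp [h, h.not_gt]
  · simp [h, hF]
  · simp [h, h.not_gt]

/-- The pairing of a skew-symmetric matrix with a decomposable one is the value of the
alternating form. -/
theorem dotProduct_wedge (a : Pairs n → K) (u v : Fin n → K) :
    a ⬝ᵥ wedge u v = u ⬝ᵥ (skewMatrix a).mulVec v := by
  have h : u ⬝ᵥ (skewMatrix a).mulVec v = ∑ i, ∑ j, u i * (skewMatrix a i j * v j) := by
    simp only [dotProduct, Matrix.mulVec, Finset.mul_sum]
  rw [h, sum_pairs _ (by simp)]
  refine Finset.sum_congr rfl fun q _ => ?_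
  rw [skewMatrix_apply_swap a q.1.1 q.1.2, skewMatrix_apply_of_lt a q.2]
  simp only [wedge]
  ring

theorem card_pairs (n : ℕ) : Fintype.card (Pairs n) * 2 = n * (n - 1) := by
  have h := sum_pairs (n := n) (M := ℤ) (fun i j => if i = j then 0 else 1) (by simp)
  have h1 : ∀ q : Pairs n, ((if q.1.1 = q.1.2 then (0 : ℤ) else 1) +
      if q.1.2 = q.1.1 then 0 else 1) = 2 := by
    intro q
    rw [if_neg q.2.ne, if_neg q.2.ne']
    rfl
  have h2 : ∀ i : Fin n, (∑ j, if i = j then (0 : ℤ) else 1) = n - 1 := by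
    intro i
    have : ∀ j : Fin n, (if i = j then (0 : ℤ) else 1) = 1 - if i = j then 1 else 0 := by
      intro j
      split_ifs <;> simp
    simp [this]
  simp only [h1, h2] at h
  simp only [Finset.sum_const, Finset.card_univ, Fintype.card_fin, nsmul_eq_mul] at h
  rcases n with _ | n
  · simp
  · have : ((n + 1 : ℕ) : ℤ) - 1 = n := by push_cast; ring
    rw [this] at h
    simp only [Nat.add_sub_cancel]
    exact_mod_cast h.symm

/-- Symplectic Gram–Schmidt: a hyperbolic pair splits off and the orthogonal complement has
dimension smaller by two. The parameters `d` may vanish, so degenerate forms are covered and the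
zeros of `d` record the kernel. -/
theorem exists_darboux_basis {L : Type*} [Field L] (k : ℕ) :
    ∀ {V : Type*} [AddCommGroup V] [Module L V] [FiniteDimensional L V]
      (_ : Module.finrank L V = 2 * k) (B : LinearMap.BilinForm L V) (_ : B.IsAlt),
      ∃ (e : Module.Basis (Fin k ⊕ Fin k) L V) (d : Fin k → L),
        LinearMap.BilinForm.toMatrix e B =
          Matrix.fromBlocks 0 (Matrix.diagonal d) (-Matrix.diagonal d) 0 := by
  induction k with
  | zero =>
    intro V _ _ _ hV B hB
    refine ⟨(Module.finBasis L V).reindex ?_, 0, ?_⟩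
    · exact Fintype.equivOfCardEq (by simp [hV])
    · ext i j
      rcases i with i | i <;> exact i.elim0
  | succ k ih =>
    intro V _ _ _ hV B hB
    by_cases h0 : ∀ x y, B x y = 0
    · refine ⟨(Module.finBasis L V).reindex (Fintype.equivOfCardEq (by simp [hV]; ring)), 0, ?_⟩
      ext i j
      rw [LinearMap.BilinForm.toMatrix_apply, h0]
      rcases i with i | i <;> rcases j with j | j <;> simp
    · push Not at h0
      obtain ⟨x, y, hxy⟩ := h0
      have hyx : B y x = -B x y := (hB.neg_eq x y).symm
      have hxx : B x x = 0 := hB x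
      have hyy : B y y = 0 := hB y
      -- The kernel of `π` is the orthogonal complement of the plane spanned by `x` and `y`;
      -- surjectivity of `π` gives its dimension.
      let π : V →ₗ[L] L × L := (B x).prod (B y)
      have hπ : Function.Surjective π := by
        rintro ⟨s, t⟩
        refine ⟨(s / B x y) • y - (t / B x y) • x, ?_⟩
        simp only [π, LinearMap.prod_apply, Function.prod, map_sub, map_smul, hxx, hyy, hyx]
        simp [hxy]
      have hW : Module.finrank L (LinearMap.ker π) = 2 * k := by
        have h1 := π.finrank_range_add_finrank_ker
        rw [LinearMap.range_eq_top.2 hπ, finrank_top, Module.finrank_prod, Module.finrank_self,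
          hV] at h1
        omega
      obtain ⟨e, d, he⟩ := ih hW (B.restrict (LinearMap.ker π)) (fun w => hB w)
      have hex : ∀ i, B x (e i) = 0 := fun i => congrArg Prod.fst (LinearMap.mem_ker.1 (e i).2)
      have hey : ∀ i, B y (e i) = 0 := fun i => congrArg Prod.snd (LinearMap.mem_ker.1 (e i).2)
      have hex' : ∀ i, B (e i) x = 0 := fun i => by rw [← hB.neg_eq, hex, neg_zero]
      have hey' : ∀ i, B (e i) y = 0 := fun i => by rw [← hB.neg_eq, hey, neg_zero]
      let w : Fin (k + 1) ⊕ Fin (k + 1) → V :=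
        Sum.elim (Fin.cons x fun i => (e (Sum.inl i) : V)) (Fin.cons y fun i => (e (Sum.inr i) : V))
      have hspan : ⊤ ≤ Submodule.span L (Set.range w) := by
        have hx : x ∈ Submodule.span L (Set.range w) := Submodule.subset_span ⟨Sum.inl 0, rfl⟩
        have hy : y ∈ Submodule.span L (Set.range w) := Submodule.subset_span ⟨Sum.inr 0, rfl⟩
        have hker : LinearMap.ker π ≤ Submodule.span L (Set.range w) := by
          intro z hz
          have h1 := e.sum_repr ⟨z, hz⟩
          have h2 : z = ∑ i, e.repr ⟨z, hz⟩ i • (e i : V) := by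
            have h3 := congrArg (Submodule.subtype (LinearMap.ker π)) h1
            rw [map_sum] at h3
            exact h3.symm
          rw [h2]
          refine Submodule.sum_mem _ fun i _ => Submodule.smul_mem _ _ (Submodule.subset_span ?_)
          rcases i with i | i
          · exact ⟨Sum.inl i.succ, by simp [w]⟩
          · exact ⟨Sum.inr i.succ, by simp [w]⟩
        intro v _
        have hv : v - ((B x v / B x y) • y - (B y v / B x y) • x) ∈ LinearMap.ker π := by
          simp only [LinearMap.mem_ker, π, LinearMap.prod_apply, Function.prod, map_sub, map_smul,
            hxx, hyy, hyx]
          simp [hxy]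
        rw [← sub_add_cancel v ((B x v / B x y) • y - (B y v / B x y) • x)]
        exact add_mem (hker hv) (sub_mem (Submodule.smul_mem _ _ hy) (Submodule.smul_mem _ _ hx))
      let b := basisOfTopLeSpanOfCardEqFinrank w hspan (by simp [hV]; ring)
      have hb : ∀ i, b i = w i := fun i => by simp [b]
      refine ⟨b, Fin.cons (B x y) d, ?_⟩
      have he' : ∀ i j, B (e i) (e j) =
          Matrix.fromBlocks 0 (Matrix.diagonal d) (-Matrix.diagonal d) 0 i j := fun i j => by
        rw [← he, LinearMap.BilinForm.toMatrix_apply]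
        rfl
      ext i j
      rw [LinearMap.BilinForm.toMatrix_apply, hb, hb]
      rcases i with i | i <;> rcases j with j | j <;> cases i using Fin.cases <;>
        cases j using Fin.cases <;>
        simp [w, hex, hey, hex', hey', he', hyx, hxx, hyy, Matrix.diagonal_apply,
          Fin.succ_ne_zero, (Fin.succ_ne_zero _).symm]

/-- The standard alternating matrix with parameters `d`. -/
def darbouxMatrix {L : Type*} [Field L] {k : ℕ} {κ : Type*} (σ : Fin k ⊕ Fin k ≃ κ)
    (d : Fin k → L) : Matrix κ κ L :=
  (Matrix.fromBlocks 0 (Matrix.diagonal d) (-Matrix.diagonal d) 0).submatrix σ.symm σ.symm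

theorem exists_eq_transpose_mul_darbouxMatrix {L : Type*} [Field L] [CharZero L] {k : ℕ} {κ : Type*}
    [Fintype κ] [DecidableEq κ] (σ : Fin k ⊕ Fin k ≃ κ) (A : Matrix κ κ L) (hA : A.transpose = -A) :
    ∃ (Q : Matrix κ κ L) (d : Fin k → L), IsUnit Q.det ∧
      A = Q.transpose * darbouxMatrix σ d * Q := by
  have hV : Module.finrank L (κ → L) = 2 * k := by
    rw [Module.finrank_fintype_fun_eq_card, ← Fintype.card_congr σ]
    simp
    ring
  have hBA : (Matrix.toBilin' A).IsAlt := by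
    intro v
    rw [Matrix.toBilin'_apply']
    refine self_eq_neg.1 ?_
    conv_lhs => rw [Matrix.dotProduct_mulVec, ← Matrix.mulVec_transpose, hA, Matrix.neg_mulVec,
      neg_dotProduct, dotProduct_comm]
  obtain ⟨e, d, he⟩ := exists_darboux_basis k hV (Matrix.toBilin' A) hBA
  let b := e.reindex σ
  have hb : LinearMap.BilinForm.toMatrix b (Matrix.toBilin' A) = darbouxMatrix σ d := by
    ext i j
    rw [darbouxMatrix, ← he, LinearMap.BilinForm.toMatrix_apply, Matrix.submatrix_apply,
      LinearMap.BilinForm.toMatrix_apply]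
    simp [b]
  refine ⟨b.toMatrix (Pi.basisFun L κ), d, ?_, ?_⟩
  · have := b.invertibleToMatrix (Pi.basisFun L κ)
    exact Matrix.isUnit_det_of_invertible _
  · rw [← hb, LinearMap.BilinForm.toMatrix_mul_basis_toMatrix, LinearMap.BilinForm.toMatrix_basisFun,
      LinearMap.BilinForm.toMatrix'_toBilin']

end SkewLinearAlgebra

/-! ### The Pfaffian and its derivatives -/

section Pfaffian

/-- The alternating matrix with blocks `0, M, -Mᵀ, 0`. -/
def blockSkew {R : Type*} [CommRing R] {k : ℕ} {κ : Type*} (σ : Fin k ⊕ Fin k ≃ κ)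
    (M : Matrix (Fin k) (Fin k) R) : Matrix κ κ R :=
  (Matrix.fromBlocks 0 M (-M.transpose) 0).submatrix σ.symm σ.symm

theorem darbouxMatrix_eq_blockSkew {L : Type*} [Field L] {k : ℕ} {κ : Type*}
    (σ : Fin k ⊕ Fin k ≃ κ) (d : Fin k → L) :
    darbouxMatrix σ d = blockSkew σ (Matrix.diagonal d) := by
  rw [darbouxMatrix, blockSkew, Matrix.diagonal_transpose]

theorem transpose_blockSkew {R : Type*} [CommRing R] {k : ℕ} {κ : Type*} (σ : Fin k ⊕ Fin k ≃ κ)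
    (M : Matrix (Fin k) (Fin k) R) : (blockSkew σ M).transpose = -blockSkew σ M := by
  rw [blockSkew, Matrix.transpose_submatrix, Matrix.fromBlocks_transpose]
  ext i j
  rw [Matrix.neg_apply, Matrix.submatrix_apply, Matrix.submatrix_apply]
  rcases σ.symm i with i | i <;> rcases σ.symm j with j | j <;> simp

/-- The block matrix factors as the one with blocks 0, 1, -1, 0 times a block diagonal matrix. The
value of the sign `ε` never matters, only that its square is one. -/
theorem exists_det_blockSkew (k : ℕ) (R : Type*) [CommRing R] {κ : Type*} [Fintype κ]
    [DecidableEq κ] (σ : Fin k ⊕ Fin k ≃ κ) :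
    ∃ ε : R, ε * ε = 1 ∧ ∀ M : Matrix (Fin k) (Fin k) R, (blockSkew σ M).det = ε * M.det ^ 2 := by
  refine ⟨(Matrix.fromBlocks 0 1 (-1) 0 : Matrix (Fin k ⊕ Fin k) (Fin k ⊕ Fin k) R).det, ?_, ?_⟩
  · rw [← Matrix.det_mul, Matrix.fromBlocks_multiply]
    simp only [mul_neg, mul_one, zero_add, mul_zero, add_zero, neg_zero]
    rw [show Matrix.fromBlocks (-1) 0 0 (-1) = (-1 : Matrix (Fin k ⊕ Fin k) (Fin k ⊕ Fin k) R) by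
      rw [← Matrix.fromBlocks_one, Matrix.fromBlocks_neg]; simp, Matrix.det_neg]
    simp [← two_mul]
  · intro M
    rw [blockSkew, Matrix.det_submatrix_equiv_self]
    have : Matrix.fromBlocks 0 M (-M.transpose) 0 =
        Matrix.fromBlocks 0 1 (-1) 0 * Matrix.fromBlocks M.transpose 0 0 M := by
      rw [Matrix.fromBlocks_multiply]
      simp
    rw [this, Matrix.det_mul, Matrix.det_fromBlocks_zero₂₁, Matrix.det_transpose]
    ring

variable {K : Type*} [Field K] {n k : ℕ}

/-- `P` is a square root of the determinant of the generic skew-symmetric matrix. -/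
def IsPfaffian (P : MvPolynomial (Pairs n) K) : Prop :=
  P ^ 2 = (skewMatrix fun q => (X q : MvPolynomial (Pairs n) K)).det

/-- Over the fraction field a Darboux basis shows that the generic determinant is a square, up to a
sign which is itself a square in `K`. The polynomial ring is integrally closed, so the square root
is a polynomial. -/
theorem exists_isPfaffian [IsAlgClosed K] [CharZero K] (σ : Fin k ⊕ Fin k ≃ Fin n) :
    ∃ P : MvPolynomial (Pairs n) K, IsPfaffian P := by
  let R := MvPolynomial (Pairs n) K
  let L := FractionRing R
  have : CharZero L := (algebraMap R L).charZero_iff (IsFractionRing.injective R L) |>.1 inferInstance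
  let S : Matrix (Fin n) (Fin n) R := skewMatrix fun q => X q
  obtain ⟨Q, d, -, hQ⟩ := exists_eq_transpose_mul_darbouxMatrix σ (S.map (algebraMap R L)) (by
    rw [← Matrix.transpose_map, transpose_skewMatrix]
    ext i j
    simp [S])
  obtain ⟨ε, hε, hdet⟩ := exists_det_blockSkew k L σ
  obtain ⟨i, hi⟩ : ∃ i : L, i * i = ε := by
    rcases mul_self_eq_one_iff.1 hε with rfl | rfl
    · exact ⟨1, by simp⟩
    · obtain ⟨z, hz⟩ := IsAlgClosed.exists_pow_nat_eq (-1 : K) (n := 2) (by norm_num)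
      refine ⟨algebraMap R L (C z), ?_⟩
      rw [← map_mul, ← map_mul, ← sq, hz]
      simp
  have hsq : algebraMap R L S.det = (i * (Q.det * (Matrix.diagonal d).det)) ^ 2 := by
    rw [RingHom.map_det, RingHom.mapMatrix_apply, hQ, Matrix.det_mul, Matrix.det_mul,
      darbouxMatrix_eq_blockSkew, hdet, Matrix.det_transpose, ← hi]
    ring
  obtain ⟨P, hP⟩ := IsIntegrallyClosed.exists_algebraMap_eq_of_isIntegral_pow (R := R)
    (x := i * (Q.det * (Matrix.diagonal d).det)) (n := 2) (by norm_num)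
    (hsq ▸ isIntegral_algebraMap)
  refine ⟨P, IsFractionRing.injective R L ?_⟩
  rw [map_pow, hP, ← hsq]

theorem isHomogeneous_det_skewMatrix :
    ((skewMatrix fun q => (X q : MvPolynomial (Pairs n) K)).det).IsHomogeneous n := by
  rw [Matrix.det_apply]
  refine MvPolynomial.IsHomogeneous.sum _ _ _ fun τ _ => ?_
  have h : (∏ i, skewMatrix (fun q => (X q : MvPolynomial (Pairs n) K)) (τ i) i).IsHomogeneous
      (∑ _i : Fin n, 1) := by
    refine MvPolynomial.IsHomogeneous.prod _ _ _ fun i _ => ?_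
    simp only [skewMatrix, Matrix.of_apply]
    split_ifs
    · exact isHomogeneous_X _ _
    · exact (isHomogeneous_X _ _).neg
    · exact isHomogeneous_zero _ _ _
  simp only [Finset.sum_const, Finset.card_univ, Fintype.card_fin, smul_eq_mul, mul_one] at h
  rcases Int.units_eq_one_or (Equiv.Perm.sign τ) with h1 | h1
  · rw [h1, one_smul]
    exact h
  · rw [h1, Units.neg_smul, one_smul]
    exact h.neg

variable {P : MvPolynomial (Pairs n) K}

theorem IsPfaffian.eval_sq (hP : IsPfaffian P) (a : Pairs n → K) :
    eval a P ^ 2 = (skewMatrix a).det := by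
  rw [← map_pow, show P ^ 2 = _ from hP, RingHom.map_det, RingHom.mapMatrix_apply, map_skewMatrix]
  simp

theorem IsPfaffian.eval_eq_zero_iff (hP : IsPfaffian P) {a : Pairs n → K} :
    eval a P = 0 ↔ (skewMatrix a).det = 0 := by
  rw [← hP.eval_sq, sq_eq_zero_iff]

theorem exists_det_skewMatrix_ne_zero [CharZero K] (σ : Fin k ⊕ Fin k ≃ Fin n) :
    ∃ a : Pairs n → K, (skewMatrix a).det ≠ 0 := by
  obtain ⟨ε, hε, hdet⟩ := exists_det_blockSkew k K σ
  refine ⟨upper (blockSkew σ 1), ?_⟩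
  rw [skewMatrix_upper (transpose_blockSkew _ _), hdet, Matrix.det_one]
  rintro h
  rw [one_pow, mul_one] at h
  simp [h] at hε

theorem IsPfaffian.ne_zero [CharZero K] (hP : IsPfaffian P) (σ : Fin k ⊕ Fin k ≃ Fin n) :
    P ≠ 0 := by
  obtain ⟨a, ha⟩ := exists_det_skewMatrix_ne_zero (K := K) σ
  rintro rfl
  rw [← hP.eval_sq, map_zero] at ha
  simp at ha

theorem IsPfaffian.isHomogeneous [CharZero K] (hP : IsPfaffian P) (σ : Fin k ⊕ Fin k ≃ Fin n) :
    P.IsHomogeneous k := by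
  have h0 := hP.ne_zero σ
  have h1 : (P * P).IsHomogeneous n := by
    rw [← sq, show P ^ 2 = _ from hP]
    exact isHomogeneous_det_skewMatrix
  obtain ⟨e, he⟩ := exists_isHomogeneous_of_mul h1 (mul_ne_zero h0 h0)
  have h2 : e + e = n := (he.mul he).inj_right h1 (mul_ne_zero h0 h0)
  have h3 : k + k = n := by simpa using Fintype.card_congr σ
  rwa [show k = e by omega]

theorem IsPolyFun.skewMatrix {κ : Type*} {ψ : (κ → K) → Pairs n → K}
    (h : ∀ q, IsPolyFun fun t => ψ t q) (i j : Fin n) :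
    IsPolyFun fun t => HessianScorza.skewMatrix (ψ t) i j := by
  simp only [HessianScorza.skewMatrix, Matrix.of_apply]
  split_ifs
  · exact h _
  · exact (h _).neg
  · exact IsPolyFun.const 0

/-- Each pair of positions contributes twice, as M_ij C_ji = -M_ij C_ij; hence the factor -2. -/
theorem trace_mul_skewMatrix (M : Matrix (Fin n) (Fin n) K) (hM : M.transpose = -M)
    (c : Pairs n → K) : (M * skewMatrix c).trace = -2 * (upper M ⬝ᵥ c) := by
  have h : ∀ i j, M j i = -M i j := fun i j => congrFun (congrFun hM i) j
  have h1 : (M * skewMatrix c).trace = ∑ i, ∑ j, M i j * skewMatrix c j i := by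
    simp only [Matrix.trace, Matrix.diag_apply, Matrix.mul_apply]
  rw [h1, sum_pairs _ (by simp), dotProduct, Finset.mul_sum]
  refine Finset.sum_congr rfl fun q _ => ?_
  rw [skewMatrix_apply_swap c q.1.1 q.1.2, skewMatrix_apply_of_lt c q.2, h q.1.1 q.1.2]
  simp only [upper]
  ring

theorem transpose_inv_skewMatrix (a : Pairs n → K) :
    ((skewMatrix a)⁻¹).transpose = -(skewMatrix a)⁻¹ := by
  rw [Matrix.transpose_nonsing_inv, transpose_skewMatrix]
  by_cases h : IsUnit (skewMatrix a).det
  · refine Matrix.inv_eq_left_inv ?_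
    rw [Matrix.neg_mul, Matrix.mul_neg, neg_neg, Matrix.nonsing_inv_mul _ h]
  · rw [Matrix.nonsing_inv_apply_not_isUnit _ h, Matrix.nonsing_inv_apply_not_isUnit, neg_zero]
    rw [Matrix.det_neg]
    intro h'
    exact h (isUnit_of_mul_isUnit_right h')

/-- Compare Pf(A + tC)² = Pf(A)² det(1 + t A⁻¹C) to first order in t. The determinant contributes
the trace of A⁻¹C, which is -2 times the pairing of A⁻¹ with C, and 2 Pf(A) cancels. -/
theorem IsPfaffian.gradient_of_det_ne_zero [CharZero K] (hP : IsPfaffian P) {a : Pairs n → K}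
    (ha : (skewMatrix a).det ≠ 0) :
    gradient P a = -(eval a P) • upper (skewMatrix a)⁻¹ := by
  have hu : IsUnit (skewMatrix a).det := isUnit_iff_ne_zero.2 ha
  have hPa : eval a P ≠ 0 := fun h => ha (hP.eval_eq_zero_iff.1 h)
  refine dotProduct_eq _ _ fun c => ?_
  have hsq : lineRestrict P a c ^ 2 = Polynomial.C (eval a P ^ 2) *
      (1 + (Polynomial.X : Polynomial K) • ((skewMatrix a)⁻¹ * skewMatrix c).map
        Polynomial.C).det := by
    refine Polynomial.funext fun t => ?_
    have h1 : ((1 + (Polynomial.X : Polynomial K) • ((skewMatrix a)⁻¹ * skewMatrix c).map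
        Polynomial.C).det).eval t = (1 + t • ((skewMatrix a)⁻¹ * skewMatrix c)).det := by
      rw [← Polynomial.coe_evalRingHom, RingHom.map_det]
      congr 1
      generalize (skewMatrix a)⁻¹ * skewMatrix c = M
      ext i j
      simp [Matrix.one_apply, apply_ite (Polynomial.eval t)]
      exact mul_comm _ _
    rw [Polynomial.eval_pow, eval_lineRestrict, hP.eval_sq, Polynomial.eval_mul, Polynomial.eval_C,
      hP.eval_sq, h1, ← Matrix.det_mul, Matrix.mul_add, Matrix.mul_one, Matrix.mul_smul,
      Matrix.mul_nonsing_inv_cancel_left _ _ hu, skewMatrix_add, skewMatrix_smul]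
  have h2 := congrArg (fun p => Polynomial.eval 0 (Polynomial.derivative p)) hsq
  simp only [Polynomial.derivative_pow, Polynomial.derivative_C_mul, Polynomial.eval_mul,
    Polynomial.eval_C, Matrix.derivative_det_one_add_X_smul, eval_derivative_lineRestrict,
    trace_mul_skewMatrix _ (transpose_inv_skewMatrix a)] at h2
  simp only [Nat.cast_ofNat, Nat.add_one_sub_one, pow_one, eval_lineRestrict, zero_smul,
    add_zero] at h2
  rw [smul_dotProduct, smul_eq_mul]
  have h3 : (2 * eval a P) * (gradient P a ⬝ᵥ c) =
      (2 * eval a P) * (-(eval a P) * (upper (skewMatrix a)⁻¹ ⬝ᵥ c)) := by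
    linear_combination h2
  exact mul_left_cancel₀ (mul_ne_zero two_ne_zero hPa) h3

/-- For invertible matrices this is the formula ∇Pf(A) = -Pf(A) A⁻¹. Both sides are polynomial, so
it persists at singular A, where it says that the columns of the gradient lie in the kernel. -/
theorem IsPfaffian.skewMatrix_mul_gradient [CharZero K] (hP : IsPfaffian P)
    (σ : Fin k ⊕ Fin k ≃ Fin n) (a : Pairs n → K) :
    skewMatrix a * skewMatrix (gradient P a) = -(eval a P) • 1 := by
  have h1 : ∀ a : Pairs n → K, eval a P ≠ 0 →
      skewMatrix a * skewMatrix (gradient P a) = -(eval a P) • 1 := by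
    intro a ha
    have hd : (skewMatrix a).det ≠ 0 := fun h => ha (hP.eval_eq_zero_iff.2 h)
    rw [hP.gradient_of_det_ne_zero hd, skewMatrix_smul,
      skewMatrix_upper (transpose_inv_skewMatrix a), Matrix.mul_smul,
      Matrix.mul_nonsing_inv _ (isUnit_iff_ne_zero.2 hd)]
  ext i j
  have h2 : IsPolyFun fun a : Pairs n → K => (skewMatrix a * skewMatrix (gradient P a)) i j -
      (-(eval a P) • (1 : Matrix (Fin n) (Fin n) K)) i j := by
    simp only [Matrix.mul_apply, Matrix.smul_apply, smul_eq_mul]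
    refine (IsPolyFun.sum _ fun l => ?_).sub ((IsPolyFun.eval P).neg.mul (IsPolyFun.const _))
    exact (IsPolyFun.skewMatrix (fun q => IsPolyFun.coord q) _ _).mul
      (IsPolyFun.skewMatrix (fun q => IsPolyFun.eval _) _ _)
  rcases h2.eq_zero_or_eq_zero (IsPolyFun.eval P) (fun a => by
    by_cases ha : eval a P = 0
    · rw [ha, mul_zero]
    · rw [h1 a ha, sub_self, zero_mul]) with h | h
  · exact sub_eq_zero.1 (h a)
  · exact absurd (MvPolynomial.funext fun a => by rw [h a, map_zero]) (hP.ne_zero σ)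

theorem IsPfaffian.gradient_mul_skewMatrix [CharZero K] (hP : IsPfaffian P)
    (σ : Fin k ⊕ Fin k ≃ Fin n) (a : Pairs n → K) :
    skewMatrix (gradient P a) * skewMatrix a = -(eval a P) • 1 := by
  have := congrArg Matrix.transpose (hP.skewMatrix_mul_gradient σ a)
  simpa [Matrix.transpose_mul, transpose_skewMatrix] using this

theorem map_pderiv_skewMatrix (q : Pairs n) (ψ : Pairs n → MvPolynomial (Pairs n) K)
    (i j : Fin n) : pderiv q (skewMatrix ψ i j) = skewMatrix (fun r => pderiv q (ψ r)) i j := by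
  simp only [skewMatrix, Matrix.of_apply]
  split_ifs <;> simp

theorem eval_skewMatrix (a : Pairs n → K) (ψ : Pairs n → MvPolynomial (Pairs n) K)
    (i j : Fin n) : eval a (skewMatrix ψ i j) = skewMatrix (fun r => eval a (ψ r)) i j := by
  rw [← map_skewMatrix]
  rfl

/-- The derivative of A · ∇Pf(A) = -Pf(A) · 1 along the entry `q`, by the product rule. -/
theorem IsPfaffian.single_mul_gradient [CharZero K] (hP : IsPfaffian P)
    (σ : Fin k ⊕ Fin k ≃ Fin n) (a : Pairs n → K) (q : Pairs n) :
    skewMatrix (Pi.single q 1) * skewMatrix (gradient P a) +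
      skewMatrix a * skewMatrix (fun r => eval a (pderiv q (pderiv r P))) =
      -(gradient P a q) • 1 := by
  ext i j
  have h1 : ∑ l, skewMatrix (fun q => (X q : MvPolynomial (Pairs n) K)) i l *
      skewMatrix (fun r => pderiv r P) l j = -P * C ((1 : Matrix (Fin n) (Fin n) K) i j) := by
    refine MvPolynomial.funext fun a => ?_
    have := congrFun (congrFun (hP.skewMatrix_mul_gradient σ a) i) j
    rw [Matrix.mul_apply] at this
    simp only [map_sum, map_mul, eval_skewMatrix, eval_X, map_neg, eval_C]
    exact this
  have h2 := congrArg (fun p => eval a (pderiv q p)) h1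
  simp only [map_sum, Derivation.leibniz, map_pderiv_skewMatrix, smul_eq_mul, map_add, map_mul,
    eval_skewMatrix, eval_X, eval_C, pderiv_C, pderiv_X, map_neg, mul_zero,
    zero_add] at h2
  rw [Matrix.add_apply, Matrix.mul_apply, Matrix.mul_apply, ← Finset.sum_add_distrib,
    Matrix.smul_apply, smul_eq_mul]
  have h3 : (fun r => eval a ((Pi.single q 1 : Pairs n → MvPolynomial (Pairs n) K) r)) =
      Pi.single q 1 := by
    funext r
    by_cases h : r = q
    · subst h
      simp
    · simp [h]
  simp only [h3] at h2
  rw [show (gradient P a q) = eval a (pderiv q P) from rfl, mul_comm, ← h2]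
  refine Finset.sum_congr rfl fun l _ => ?_
  rw [add_comm, mul_comm (skewMatrix (Pi.single q 1) i l)]
  rfl

theorem single_eq_wedge (q : Pairs n) :
    (Pi.single q 1 : Pairs n → K) = wedge (Pi.single q.1.1 1) (Pi.single q.1.2 1) := by
  funext r
  obtain ⟨⟨i, j⟩, hij⟩ := q
  obtain ⟨⟨i', j'⟩, hij'⟩ := r
  simp only at hij hij'
  simp only [wedge, Pi.single_apply, Subtype.mk.injEq, Prod.mk.injEq]
  have h : ¬(j' = i ∧ i' = j) := by
    rintro ⟨rfl, rfl⟩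
    exact absurd hij hij'.not_gt
  grind

/-- Multiply `IsPfaffian.single_mul_gradient` on the left by B = ∇Pf(A): the product BA becomes
-Pf(A), and B E_q Bᵀ is the wedge of two columns of B. On Pf = 0 this makes a multiple of B
decomposable. -/
theorem IsPfaffian.wedge_eq [CharZero K] (hP : IsPfaffian P)
    (σ : Fin k ⊕ Fin k ≃ Fin n) (a : Pairs n → K) (q : Pairs n) :
    wedge ((skewMatrix (gradient P a)).mulVec (Pi.single q.1.1 1))
      ((skewMatrix (gradient P a)).mulVec (Pi.single q.1.2 1)) =
      gradient P a q • gradient P a - eval a P • fun r => eval a (pderiv q (pderiv r P)) := by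
  apply skewMatrix_injective
  rw [← congruence_wedge, ← single_eq_wedge, skewMatrix_congruence, transpose_skewMatrix,
    sub_eq_add_neg, ← neg_smul, skewMatrix_add, skewMatrix_smul, skewMatrix_smul]
  have h := congrArg (skewMatrix (gradient P a) * ·) (hP.single_mul_gradient σ a q)
  simp only [Matrix.mul_add, ← Matrix.mul_assoc, hP.gradient_mul_skewMatrix σ a, Matrix.smul_mul,
    Matrix.one_mul, Matrix.mul_smul, Matrix.mul_one] at h
  rw [Matrix.mul_neg, eq_comm, ← sub_eq_zero]
  rw [← sub_eq_zero] at h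
  rw [← h, neg_smul (gradient P a q)]
  abel

/-- The gradient of the Pfaffian at a singular matrix is decomposable, and is spanned by the
kernel of the matrix. -/
theorem IsPfaffian.exists_gradient_eq_wedge [CharZero K] (hP : IsPfaffian P)
    (σ : Fin k ⊕ Fin k ≃ Fin n) {a : Pairs n → K} (ha : eval a P = 0) (h0 : gradient P a ≠ 0) :
    ∃ w₁ w₂ : Fin n → K, (skewMatrix a).mulVec w₁ = 0 ∧ (skewMatrix a).mulVec w₂ = 0 ∧
      gradient P a = wedge w₁ w₂ := by
  obtain ⟨q, hq⟩ := Function.ne_iff.1 h0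
  have h1 := hP.wedge_eq σ a q
  rw [ha, zero_smul, sub_zero] at h1
  -- The columns of the gradient are the kernel vectors looked for, since A · ∇Pf(A) = 0 here.
  have h2 : ∀ v, (skewMatrix a).mulVec ((skewMatrix (gradient P a)).mulVec v) = 0 := by
    intro v
    rw [Matrix.mulVec_mulVec, hP.skewMatrix_mul_gradient σ a, ha]
    simp
  refine ⟨(gradient P a q)⁻¹ • (skewMatrix (gradient P a)).mulVec (Pi.single q.1.1 1),
    (skewMatrix (gradient P a)).mulVec (Pi.single q.1.2 1), ?_, h2 _, ?_⟩
  · rw [Matrix.mulVec_smul, h2, smul_zero]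
  · have h3 : ∀ (c : K) (u v : Fin n → K), wedge (c • u) v = c • wedge u v := by
      intro c u v
      funext r
      simp only [wedge, Pi.smul_apply, smul_eq_mul]
      ring
    rw [h3, h1, inv_smul_smul₀ hq]

/-- Entry `q` of `IsPfaffian.wedge_eq` reads B_q² = B_q² - Pf · ∂_q²Pf. -/
theorem IsPfaffian.pderiv_pderiv_self [CharZero K] (hP : IsPfaffian P)
    (σ : Fin k ⊕ Fin k ≃ Fin n) (q : Pairs n) : pderiv q (pderiv q P) = 0 := by
  have h : P * pderiv q (pderiv q P) = 0 := by
    refine MvPolynomial.funext fun a => ?_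
    have h1 := congrFun (hP.wedge_eq σ a q) q
    simp only [wedge, Matrix.mulVec_single_one, Matrix.col_apply, skewMatrix_apply_self,
      Pi.sub_apply, Pi.smul_apply, smul_eq_mul] at h1
    rw [skewMatrix_apply_swap _ q.1.1 q.1.2, skewMatrix_apply_of_lt _ q.2] at h1
    rw [map_mul, map_zero]
    linear_combination h1
  exact (mul_eq_zero.1 h).resolve_left (hP.ne_zero σ)

/-- The Pfaffian is linear in each entry. -/
theorem IsPfaffian.eval_add_smul_single [CharZero K] (hP : IsPfaffian P)
    (σ : Fin k ⊕ Fin k ≃ Fin n) (a : Pairs n → K) (q : Pairs n) (s : K) :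
    eval (a + s • Pi.single q 1) P = eval a P + s * gradient P a q := by
  have h1 : (lineRestrict P a (Pi.single q 1)).derivative.derivative = 0 := by
    rw [derivative_lineRestrict, derivative_lineRestrict, hP.pderiv_pderiv_self σ]
    simp [lineRestrict]
  obtain ⟨c, hc⟩ := Polynomial.natDegree_eq_zero.1 (Polynomial.derivative_eq_zero.1 h1)
  have h2 : (lineRestrict P a (Pi.single q 1) - Polynomial.C c * Polynomial.X).derivative = 0 := by
    simp [← hc]
  obtain ⟨e, he⟩ := Polynomial.natDegree_eq_zero.1 (Polynomial.derivative_eq_zero.1 h2)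
  have h3 := congrArg (Polynomial.eval s) he
  have h4 := congrArg (Polynomial.eval 0) he
  have h5 := congrArg (Polynomial.eval 0) hc
  rw [eval_derivative_lineRestrict] at h5
  simp at h3 h4 h5
  rw [h5] at h3
  linear_combination h4 - h3

end Pfaffian

/-! ### Geometry of the Pfaffian hypersurface: kernels, smooth points, vertex -/

section PfaffianGeometry

variable {K : Type*} [Field K] {n k : ℕ} {P : MvPolynomial (Pairs n) K}

/-- Here Pf(A + tC)² = γt², so Pf(A + tC) has a simple zero at t = 0 and its derivative in the
direction C is not zero. -/
theorem gradient_ne_zero_of_det_eq (hP : IsPfaffian P) {a c : Pairs n → K} {γ : K} (hγ : γ ≠ 0)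
    [Infinite K] (h : ∀ t : K, (skewMatrix (a + t • c)).det = γ * t ^ 2) : gradient P a ≠ 0 := by
  intro h0
  have hsq : lineRestrict P a c ^ 2 = Polynomial.C γ * Polynomial.X ^ 2 := by
    refine Polynomial.funext fun t => ?_
    rw [Polynomial.eval_pow, eval_lineRestrict, hP.eval_sq, h]
    simp
  have h1 : (lineRestrict P a c).eval 0 = 0 := by
    have := congrArg (Polynomial.eval 0) hsq
    simpa using this
  obtain ⟨r, hr⟩ := Polynomial.dvd_iff_isRoot.2 h1
  rw [Polynomial.C_0, sub_zero] at hr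
  have h2 : (lineRestrict P a c).derivative.eval 0 = 0 := by
    rw [eval_derivative_lineRestrict, zero_smul, add_zero, h0, zero_dotProduct]
  rw [hr] at h2 hsq
  have h3 : r ^ 2 = Polynomial.C γ := by
    have : Polynomial.X ^ 2 * r ^ 2 = Polynomial.X ^ 2 * Polynomial.C γ := by
      rw [← mul_pow, hsq, mul_comm]
    exact mul_left_cancel₀ (pow_ne_zero 2 Polynomial.X_ne_zero) this
  have h4 := congrArg (Polynomial.eval 0) h3
  simp at h2 h4
  rw [h2] at h4
  exact hγ (by simpa using h4.symm)

theorem eval_eq_zero_of_mulVec_eq_zero (hP : IsPfaffian P) {a : Pairs n → K} {u : Fin n → K}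
    (hu : u ≠ 0) (h : (skewMatrix a).mulVec u = 0) : eval a P = 0 := by
  rw [hP.eval_eq_zero_iff]
  exact Matrix.exists_mulVec_eq_zero_iff.1 ⟨u, hu, h⟩

theorem linearIndependent_of_wedge_ne_zero {u v : Fin n → K} (h : wedge u v ≠ 0) :
    LinearIndependent K ![u, v] := by
  rw [LinearIndependent.pair_iff]
  intro s t hst
  have h1 : ∀ i, s * u i + t * v i = 0 := fun i => congrFun hst i
  obtain ⟨q, hq⟩ := Function.ne_iff.1 h
  simp only [wedge, Pi.zero_apply] at hq
  constructor
  · refine (mul_eq_zero.1 (?_ : s * (u q.1.1 * v q.1.2 - u q.1.2 * v q.1.1) = 0)).resolve_right hq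
    linear_combination v q.1.2 * h1 q.1.1 - v q.1.1 * h1 q.1.2
  · refine (mul_eq_zero.1 (?_ : t * (u q.1.1 * v q.1.2 - u q.1.2 * v q.1.1) = 0)).resolve_right hq
    linear_combination u q.1.1 * h1 q.1.2 - u q.1.2 * h1 q.1.1

theorem exists_linearEquiv_apply_eq {V κ : Type*} [AddCommGroup V] [Module K V]
    [FiniteDimensional K V] {x y : κ → V} (h : LinearIndependent K x)
    (h' : LinearIndependent K y) : ∃ g : V ≃ₗ[K] V, ∀ i, g (x i) = y i := by
  let b := Module.Basis.span h
  let b' := Module.Basis.span h'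
  obtain ⟨g, hg⟩ := Submodule.exists_linearEquiv_restrict_eq (b.equiv b' (Equiv.refl _))
  refine ⟨g, fun i => ?_⟩
  have h1 := hg (b i)
  rw [Module.Basis.equiv_apply, Equiv.refl_apply] at h1
  have h2 : ((b i : Submodule.span K (Set.range x)) : V) = x i :=
    congrArg Subtype.val (Module.Basis.span_apply h i)
  have h3 : ((b' i : Submodule.span K (Set.range y)) : V) = y i :=
    congrArg Subtype.val (Module.Basis.span_apply h' i)
  rw [← h2, ← h1, h3]

theorem exists_matrix_mulVec_eq {u v u' v' : Fin n → K} (h : LinearIndependent K ![u, v])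
    (h' : LinearIndependent K ![u', v']) :
    ∃ Q R : Matrix (Fin n) (Fin n) K, Q * R = 1 ∧ R * Q = 1 ∧ Q.mulVec u = u' ∧
      Q.mulVec v = v' := by
  obtain ⟨g, hgi⟩ := exists_linearEquiv_apply_eq h h'
  refine ⟨LinearMap.toMatrix' g.toLinearMap, LinearMap.toMatrix' g.symm.toLinearMap, ?_, ?_, ?_, ?_⟩
  · rw [← LinearMap.toMatrix'_comp, LinearEquiv.comp_coe, LinearEquiv.symm_trans_self]
    simp
  · rw [← LinearMap.toMatrix'_comp, LinearEquiv.comp_coe, LinearEquiv.self_trans_symm]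
    simp
  · rw [LinearMap.toMatrix'_mulVec]
    exact hgi 0
  · rw [LinearMap.toMatrix'_mulVec]
    exact hgi 1

/-- Coordinates adapted to two independent vectors: an invertible matrix which maps them to
standard basis vectors. -/
structure Splitting (n' : ℕ) (u v : Fin n → K) where
  /-- The positions of the remaining coordinates and of the two vectors. -/
  τ : Fin n' ⊕ Fin 2 ≃ Fin n
  /-- The change of coordinates. -/
  Q : Matrix (Fin n) (Fin n) K
  /-- The inverse change of coordinates. -/
  R : Matrix (Fin n) (Fin n) K
  mul_eq : Q * R = 1
  mul_eq' : R * Q = 1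
  left_eq : Q.mulVec u = Pi.single (τ (Sum.inr 0)) 1
  right_eq : Q.mulVec v = Pi.single (τ (Sum.inr 1)) 1

theorem linearIndependent_single {i j : Fin n} (h : i ≠ j) :
    LinearIndependent K ![(Pi.single i 1 : Fin n → K), Pi.single j 1] := by
  rw [LinearIndependent.pair_iff]
  intro s t hst
  have h1 := congrFun hst i
  have h2 := congrFun hst j
  simp [h, h.symm] at h1 h2
  exact ⟨h1, h2⟩

theorem exists_splitting {n' : ℕ} (hn : n = n' + 2) {u v : Fin n → K}
    (h : LinearIndependent K ![u, v]) : Nonempty (Splitting n' u v) := by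
  let τ : Fin n' ⊕ Fin 2 ≃ Fin n := Fintype.equivOfCardEq (by simp [hn])
  obtain ⟨Q, R, h1, h2, h3, h4⟩ := exists_matrix_mulVec_eq h
    (linearIndependent_single (K := K) (i := τ (Sum.inr 0)) (j := τ (Sum.inr 1)) (by simp))
  exact ⟨⟨τ, Q, R, h1, h2, h3, h4⟩⟩

namespace Splitting

variable {n' : ℕ} {u v : Fin n → K} (s : Splitting n' u v)

/-- The quotient map by the two vectors. -/
def proj : Matrix (Fin n') (Fin n) K := s.Q.submatrix (fun i => s.τ (Sum.inl i)) id

/-- A section of the quotient map by the two vectors. -/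
def sect : Matrix (Fin n) (Fin n') K := s.R.submatrix id fun i => s.τ (Sum.inl i)

theorem proj_mul_sect : s.proj * s.sect = 1 := by
  ext i j
  change (s.Q * s.R) (s.τ (Sum.inl i)) (s.τ (Sum.inl j)) = _
  rw [s.mul_eq]
  simp [Matrix.one_apply]

theorem proj_mulVec_apply (x : Fin n → K) (i : Fin n') :
    s.proj.mulVec x i = s.Q.mulVec x (s.τ (Sum.inl i)) := rfl

theorem proj_mulVec_left : s.proj.mulVec u = 0 := by
  funext i
  rw [proj_mulVec_apply, s.left_eq]
  simp

theorem proj_mulVec_right : s.proj.mulVec v = 0 := by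
  funext i
  rw [proj_mulVec_apply, s.right_eq]
  simp

theorem mulVec_left_eq : s.R.mulVec (Pi.single (s.τ (Sum.inr 0)) 1) = u := by
  rw [← s.left_eq, Matrix.mulVec_mulVec, s.mul_eq', Matrix.one_mulVec]

theorem mulVec_right_eq : s.R.mulVec (Pi.single (s.τ (Sum.inr 1)) 1) = v := by
  rw [← s.right_eq, Matrix.mulVec_mulVec, s.mul_eq', Matrix.one_mulVec]

theorem exists_eq_of_proj_mulVec {x : Fin n → K} (h : s.proj.mulVec x = 0) :
    ∃ α β : K, x = α • u + β • v := by
  refine ⟨s.Q.mulVec x (s.τ (Sum.inr 0)), s.Q.mulVec x (s.τ (Sum.inr 1)), ?_⟩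
  have h1 : s.Q.mulVec x = s.Q.mulVec x (s.τ (Sum.inr 0)) • Pi.single (s.τ (Sum.inr 0)) 1 +
      s.Q.mulVec x (s.τ (Sum.inr 1)) • Pi.single (s.τ (Sum.inr 1)) 1 := by
    funext i
    obtain ⟨j, rfl⟩ := s.τ.surjective i
    rcases j with j | j
    · have := congrFun h j
      rw [proj_mulVec_apply] at this
      rw [this]
      simp
    · fin_cases j <;> simp
  calc x = s.R.mulVec (s.Q.mulVec x) := by
        rw [Matrix.mulVec_mulVec, s.mul_eq', Matrix.one_mulVec]
    _ = _ := by
        conv_lhs => rw [h1]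
        rw [Matrix.mulVec_add, Matrix.mulVec_smul, Matrix.mulVec_smul, s.mulVec_left_eq,
          s.mulVec_right_eq]

/-- A covector annihilating `u` and `v` comes from the quotient by them: in the dual coordinates its
entries at the two positions of `u` and `v` vanish. -/
theorem exists_eq_transpose_proj_mulVec {x : Fin n → K} (hu : u ⬝ᵥ x = 0) (hv : v ⬝ᵥ x = 0) :
    ∃ c, x = s.proj.transpose.mulVec c := by
  refine ⟨fun i => s.R.transpose.mulVec x (s.τ (Sum.inl i)), ?_⟩
  have h0 : s.R.transpose.mulVec x (s.τ (Sum.inr 0)) = 0 := by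
    refine (single_one_dotProduct _ (s.R.transpose.mulVec x)).symm.trans ?_
    rw [Matrix.dotProduct_mulVec, Matrix.vecMul_transpose,
      s.mulVec_left_eq, hu]
  have h1 : s.R.transpose.mulVec x (s.τ (Sum.inr 1)) = 0 := by
    refine (single_one_dotProduct _ (s.R.transpose.mulVec x)).symm.trans ?_
    rw [Matrix.dotProduct_mulVec, Matrix.vecMul_transpose,
      s.mulVec_right_eq, hv]
  have h2 : x = s.Q.transpose.mulVec (s.R.transpose.mulVec x) := by
    rw [Matrix.mulVec_mulVec, ← Matrix.transpose_mul, s.mul_eq', Matrix.transpose_one,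
      Matrix.one_mulVec]
  conv_lhs => rw [h2]
  funext i
  simp only [Matrix.mulVec, dotProduct]
  rw [← s.τ.sum_comp, Fintype.sum_sum_type, Fin.sum_univ_two]
  simp only [Matrix.mulVec, dotProduct] at h0 h1
  rw [h0, h1]
  simp [proj]

theorem left_ne_zero (s : Splitting n' u v) : u ≠ 0 := by
  intro h
  have h1 := s.left_eq.symm.trans (congrArg s.Q.mulVec h)
  rw [Matrix.mulVec_zero] at h1
  have h2 := congrFun h1 (s.τ (Sum.inr 0))
  simp at h2

/-- The gradient of the Pfaffian at a matrix of corank two is the line spanned by the kernel. -/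
theorem gradient_congruence [CharZero K] (hP : IsPfaffian P) (σ : Fin k ⊕ Fin k ≃ Fin n)
    {a : Pairs n' → K} (ha : (skewMatrix a).det ≠ 0) :
    ∃ c : K, c ≠ 0 ∧ gradient P (congruence s.proj.transpose a) = c • wedge u v := by
  have hA := skewMatrix_congruence s.proj.transpose a
  rw [Matrix.transpose_transpose] at hA
  have hker : ∀ x, (skewMatrix (congruence s.proj.transpose a)).mulVec x = 0 →
      s.proj.mulVec x = 0 := by
    intro x hx
    rw [hA] at hx
    have h1 := congrArg (s.sect.transpose.mulVec) hx
    rw [Matrix.mulVec_mulVec, Matrix.mul_assoc, ← Matrix.mul_assoc, ← Matrix.transpose_mul,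
      s.proj_mul_sect, Matrix.transpose_one, Matrix.one_mul, Matrix.mulVec_zero,
      ← Matrix.mulVec_mulVec] at h1
    exact Matrix.eq_zero_of_mulVec_eq_zero ha h1
  have hPa : eval (congruence s.proj.transpose a) P = 0 := by
    refine eval_eq_zero_of_mulVec_eq_zero hP s.left_ne_zero ?_
    rw [hA, ← Matrix.mulVec_mulVec, s.proj_mulVec_left, Matrix.mulVec_zero]
  have hgrad : gradient P (congruence s.proj.transpose a) ≠ 0 := by
    have hQ : s.Q.det ≠ 0 := by
      intro h
      have := congrArg Matrix.det s.mul_eq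
      rw [Matrix.det_mul, h, zero_mul, Matrix.det_one] at this
      exact zero_ne_one this
    -- These rows of `Q` are the coordinate forms dual to `u` and `v`. Adding t times their wedge
    -- fills the missing 2 × 2 block, so the determinant becomes a nonzero multiple of t².
    refine gradient_ne_zero_of_det_eq hP (c := wedge (s.Q (s.τ (Sum.inr 0))) (s.Q (s.τ (Sum.inr 1))))
      (γ := s.Q.det * (skewMatrix a).det * s.Q.det) (mul_ne_zero (mul_ne_zero hQ ha) hQ) fun t => ?_
    have h1 : skewMatrix (congruence s.proj.transpose a +
        t • wedge (s.Q (s.τ (Sum.inr 0))) (s.Q (s.τ (Sum.inr 1)))) = s.Q.transpose *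
        (Matrix.fromBlocks (skewMatrix a) 0 0 !![0, t; -t, 0]).submatrix s.τ.symm s.τ.symm *
        s.Q := by
      rw [skewMatrix_add, skewMatrix_smul, hA, skewMatrix_wedge]
      ext i j
      have key : ∀ B : Matrix (Fin n' ⊕ Fin 2) (Fin n' ⊕ Fin 2) K,
          (s.Q.transpose * B.submatrix s.τ.symm s.τ.symm * s.Q) i j =
            ∑ y, (∑ x, s.Q (s.τ x) i * B x y) * s.Q (s.τ y) j := by
        intro B
        rw [Matrix.mul_apply, ← s.τ.sum_comp]
        refine Finset.sum_congr rfl fun y _ => ?_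
        rw [Matrix.mul_apply, ← s.τ.sum_comp]
        simp
      rw [key]
      simp only [Matrix.add_apply, Matrix.smul_apply, Matrix.sub_apply, Matrix.vecMulVec_apply,
        Fintype.sum_sum_type, Fin.sum_univ_two, smul_eq_mul]
      have h2 : (s.proj.transpose * skewMatrix a * s.proj) i j =
          ∑ y, (∑ x, s.Q (s.τ (Sum.inl x)) i * skewMatrix a x y) * s.Q (s.τ (Sum.inl y)) j := by
        simp only [Matrix.mul_apply]
        rfl
      rw [h2]
      simp
      ring
    rw [h1, Matrix.det_mul, Matrix.det_mul, Matrix.det_submatrix_equiv_self,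
      Matrix.det_fromBlocks_zero₂₁, Matrix.det_fin_two_of, Matrix.det_transpose]
    ring
  obtain ⟨w₁, w₂, h1, h2, h3⟩ := hP.exists_gradient_eq_wedge σ hPa hgrad
  obtain ⟨α, β, rfl⟩ := s.exists_eq_of_proj_mulVec (hker _ h1)
  obtain ⟨γ, δ, rfl⟩ := s.exists_eq_of_proj_mulVec (hker _ h2)
  have h4 : wedge (α • u + β • v) (γ • u + δ • v) = (α * δ - β * γ) • wedge u v := by
    funext q
    simp only [wedge, Pi.add_apply, Pi.smul_apply, smul_eq_mul]
    ring
  refine ⟨α * δ - β * γ, ?_, h3.trans h4⟩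
  intro h5
  apply hgrad
  rw [h3, h4, h5, zero_smul]

end Splitting

/-- In Darboux coordinates the determinant is a nonzero multiple of (∏ d i)², so some `d i`
vanishes, and then both basis vectors of the `i`-th pair lie in the kernel. -/
theorem exists_kernel_pair [CharZero K] (hP : IsPfaffian P) (σ : Fin k ⊕ Fin k ≃ Fin n)
    {a : Pairs n → K} (ha : eval a P = 0) :
    ∃ u v : Fin n → K, LinearIndependent K ![u, v] ∧ (skewMatrix a).mulVec u = 0 ∧
      (skewMatrix a).mulVec v = 0 := by
  obtain ⟨Q, d, hQ, hA⟩ := exists_eq_transpose_mul_darbouxMatrix σ (skewMatrix a)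
    (transpose_skewMatrix a)
  obtain ⟨ε, hε, hdet⟩ := exists_det_blockSkew k K σ
  have h1 := hP.eval_eq_zero_iff.1 ha
  rw [hA, Matrix.det_mul, Matrix.det_mul, darbouxMatrix_eq_blockSkew, hdet, Matrix.det_transpose,
    Matrix.det_diagonal] at h1
  have hQ0 := hQ.ne_zero
  have hε0 : ε ≠ 0 := left_ne_zero_of_mul_eq_one hε
  have h2 : ∏ i, d i = 0 := by
    by_contra h
    exact mul_ne_zero (mul_ne_zero hQ0 (mul_ne_zero hε0 (pow_ne_zero 2 h))) hQ0 h1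
  obtain ⟨i, -, hi⟩ := Finset.prod_eq_zero_iff.1 h2
  have hJ : ∀ x : Fin n → K, (∀ j, j ≠ σ (Sum.inl i) → j ≠ σ (Sum.inr i) → x j = 0) →
      (skewMatrix a).mulVec (Q⁻¹.mulVec x) = 0 := by
    intro x hx
    rw [hA, Matrix.mulVec_mulVec, Matrix.mul_assoc, Matrix.mul_nonsing_inv _ hQ, Matrix.mul_one,
      ← Matrix.mulVec_mulVec]
    rw [show (darbouxMatrix σ d).mulVec x = 0 from ?_, Matrix.mulVec_zero]
    funext j
    obtain ⟨j, rfl⟩ := σ.surjective j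
    simp only [Matrix.mulVec, dotProduct]
    rw [← σ.sum_comp, Fintype.sum_sum_type]
    have hx' : ∀ l, d l * x (σ (Sum.inl l)) = 0 ∧ d l * x (σ (Sum.inr l)) = 0 := by
      intro l
      by_cases hl : l = i
      · rw [hl, hi]
        simp
      · rw [hx _ (by simp [hl]) (by simp), hx (σ (Sum.inr l)) (by simp) (by simp [hl])]
        simp
    rcases j with j | j <;>
      simp [darbouxMatrix, Matrix.diagonal_apply, hx']
  refine ⟨Q⁻¹.mulVec (Pi.single (σ (Sum.inl i)) 1), Q⁻¹.mulVec (Pi.single (σ (Sum.inr i)) 1), ?_,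
    hJ _ ?_, hJ _ ?_⟩
  · rw [LinearIndependent.pair_iff]
    intro s t hst
    have h3 := congrArg Q.mulVec hst
    rw [Matrix.mulVec_add, Matrix.mulVec_smul, Matrix.mulVec_smul, Matrix.mulVec_mulVec,
      Matrix.mulVec_mulVec, Matrix.mul_nonsing_inv _ hQ, Matrix.one_mulVec, Matrix.one_mulVec,
      Matrix.mulVec_zero] at h3
    have hli := linearIndependent_single (K := K) (i := σ (Sum.inl i)) (j := σ (Sum.inr i))
      (by simp)
    exact LinearIndependent.pair_iff.1 hli s t h3
  · intro j hj _
    simp [hj]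
  · intro j _ hj
    simp [hj]

/-- Corank one does not occur for alternating matrices of even size: a singular one has two
independent kernel vectors. -/
theorem rank_skewMatrix_le_iff [CharZero K] (hP : IsPfaffian P) (σ : Fin k ⊕ Fin k ≃ Fin n)
    {r : ℕ} (hr : n = r + 2) (a : Pairs n → K) : (skewMatrix a).rank ≤ r ↔ eval a P = 0 := by
  constructor
  · intro h
    by_contra h0
    have h1 : (skewMatrix a).det ≠ 0 := fun h' => h0 (hP.eval_eq_zero_iff.2 h')
    have h2 := Matrix.rank_of_isUnit (skewMatrix a)
      ((Matrix.isUnit_iff_isUnit_det _).2 (isUnit_iff_ne_zero.2 h1))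
    rw [h2, Fintype.card_fin] at h
    omega
  · intro h
    obtain ⟨u, v, huv, hu, hv⟩ := exists_kernel_pair hP σ h
    have h1 := (skewMatrix a).mulVecLin.finrank_range_add_finrank_ker
    have h2 : 2 ≤ Module.finrank K (LinearMap.ker (skewMatrix a).mulVecLin) := by
      have h3 : Submodule.span K (Set.range ![u, v]) ≤ LinearMap.ker (skewMatrix a).mulVecLin := by
        rw [Submodule.span_le]
        rintro _ ⟨i, rfl⟩
        fin_cases i
        · exact hu
        · exact hv
      have h4 := Submodule.finrank_mono h3
      rw [finrank_span_eq_card huv] at h4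
      simpa using h4
    rw [Module.finrank_fintype_fun_eq_card, Fintype.card_fin] at h1
    change Module.finrank K (LinearMap.range (skewMatrix a).mulVecLin) ≤ r
    omega

/-- No nonzero matrix is a vertex of the Pfaffian hypersurface. -/
theorem exists_eval_add_ne_zero [CharZero K] (hP : IsPfaffian P) (σ : Fin k ⊕ Fin k ≃ Fin n)
    {a : Pairs n → K} (ha0 : a ≠ 0) :
    ∃ c, eval c P = 0 ∧ eval (a + c) P ≠ 0 := by
  classical
  obtain ⟨Q, d, hQ, hA⟩ := exists_eq_transpose_mul_darbouxMatrix σ (skewMatrix a)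
    (transpose_skewMatrix a)
  obtain ⟨ε, hε, hdet⟩ := exists_det_blockSkew k K σ
  have hQ0 := hQ.ne_zero
  have hε0 : ε ≠ 0 := left_ne_zero_of_mul_eq_one hε
  have hdet' : ∀ e : Fin k → K, (Q.transpose * darbouxMatrix σ e * Q).det =
      Q.det * Q.det * ε * (∏ i, e i) ^ 2 := by
    intro e
    rw [Matrix.det_mul, Matrix.det_mul, darbouxMatrix_eq_blockSkew, hdet, Matrix.det_transpose,
      Matrix.det_diagonal]
    ring
  -- The support of `e` is the complement of that of `d`: no entry of `d + e` is zero, while `e` has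
  -- a zero entry because `a` is not zero.
  let e : Fin k → K := fun i => if d i = 0 then 1 else 0
  have hd : ∃ i, d i ≠ 0 := by
    by_contra! h
    apply ha0
    apply skewMatrix_injective
    have h0 : d = 0 := funext h
    have h1 : darbouxMatrix σ (0 : Fin k → K) = 0 := by
      rw [darbouxMatrix_eq_blockSkew, blockSkew]
      simp
    have h2 : skewMatrix (0 : Pairs n → K) = 0 := by
      ext i j
      simp [skewMatrix]
    rw [hA, h0, h1, h2]
    simp
  have hC : skewMatrix (upper (Q.transpose * darbouxMatrix σ e * Q)) =
      Q.transpose * darbouxMatrix σ e * Q := by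
    refine skewMatrix_upper ?_
    rw [Matrix.transpose_mul, Matrix.transpose_mul, darbouxMatrix_eq_blockSkew,
      transpose_blockSkew, Matrix.transpose_transpose, Matrix.neg_mul, Matrix.mul_neg,
      Matrix.mul_assoc]
  refine ⟨upper (Q.transpose * darbouxMatrix σ e * Q), ?_, ?_⟩
  · rw [hP.eval_eq_zero_iff, hC, hdet']
    obtain ⟨i, hi⟩ := hd
    rw [Finset.prod_eq_zero (Finset.mem_univ i) (by simp [e, hi])]
    simp
  · rw [Ne, hP.eval_eq_zero_iff, skewMatrix_add, hC, hA, ← Matrix.add_mul, ← Matrix.mul_add]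
    have h1 : darbouxMatrix σ d + darbouxMatrix σ e = darbouxMatrix σ (d + e) := by
      ext i j
      obtain ⟨i, rfl⟩ := σ.surjective i
      obtain ⟨j, rfl⟩ := σ.surjective j
      rcases i with i | i <;> rcases j with j | j <;>
        simp [darbouxMatrix, Matrix.diagonal_apply] <;> split_ifs <;> simp [add_comm]
    rw [h1, hdet']
    refine mul_ne_zero (mul_ne_zero (mul_ne_zero hQ0 hQ0) hε0)
      (pow_ne_zero 2 (Finset.prod_ne_zero_iff.2 fun i _ => ?_))
    simp only [Pi.add_apply, e]
    split_ifs with h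
    · rw [h]
      simp
    · simpa using h

end PfaffianGeometry

/-! ### Irreducibility of the Pfaffian -/

section Irreducibility

variable {K : Type*} [Field K] {n k : ℕ} {P : MvPolynomial (Pairs n) K}

/-- The matrix with `t 0` on the diagonal, `t 2` below the diagonal and `t 1` in the upper right
corner. -/
def cornerMatrix {R : Type*} [CommRing R] (k : ℕ) (t : Fin 3 → R) :
    Matrix (Fin (k + 1)) (Fin (k + 1)) R :=
  Matrix.of fun i j => if i = j then t 0 else if (i : ℕ) = j + 1 then t 2 else
    if i = 0 ∧ j = Fin.last k then t 1 else 0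

theorem det_cornerMatrix {R : Type*} [CommRing R] {k : ℕ} (hk : 1 ≤ k) (t : Fin 3 → R) :
    (cornerMatrix k t).det = t 0 ^ (k + 1) + (-1) ^ k * t 1 * t 2 ^ k := by
  have hlast : Fin.last k ≠ 0 := by
    simp [Fin.ext_iff]
    omega
  rw [Matrix.det_succ_row_zero, Fintype.sum_eq_add 0 (Fin.last k) hlast.symm]
  · have h1 : ((cornerMatrix k t).submatrix Fin.succ (Fin.succAbove 0)).det = t 0 ^ k := by
      rw [Matrix.det_of_isLowerTriangular]
      · simp [cornerMatrix]
      · intro i j hij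
        have hij' : (i : ℕ) < j := hij
        simp only [cornerMatrix, Matrix.submatrix_apply, Matrix.of_apply, Fin.succAbove_zero,
          Fin.ext_iff, Fin.val_succ, Fin.val_zero]
        rw [if_neg (by omega), if_neg (by omega), if_neg (by omega)]
    have h2 : ((cornerMatrix k t).submatrix Fin.succ (Fin.succAbove (Fin.last k))).det =
        t 2 ^ k := by
      rw [Matrix.det_of_isUpperTriangular]
      · have h3 : ∀ i : Fin k, ¬ i.succ = i.castSucc := fun i h => by
          have := congrArg Fin.val h
          simp at this
        simp [cornerMatrix, h3]
      · intro i j hij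
        have hij' : (j : ℕ) < i := hij
        simp only [cornerMatrix, Matrix.submatrix_apply, Matrix.of_apply, Fin.succAbove_last,
          Fin.ext_iff, Fin.val_succ, Fin.val_zero, Fin.val_castSucc]
        rw [if_neg (by omega), if_neg (by omega), if_neg (by omega)]
    rw [h1, h2]
    simp [cornerMatrix, hlast.symm]
    ring
  · rintro j ⟨h0, h1⟩
    simp [cornerMatrix, h0.symm, h1]

/-- The polynomial has degree one in `X 1`, and its coefficients ± `X 2 ^ k` and `X 0 ^ (k + 1)` are
coprime. -/
theorem irreducible_cornerPolynomial {k : ℕ} {c : K} (hc : c ≠ 0) :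
    Irreducible (C c * (X 0 ^ (k + 1) + (-1) ^ k * X 1 * X 2 ^ k) : MvPolynomial (Fin 3) K) := by
  have hu : IsUnit (C c : MvPolynomial (Fin 3) K) := (isUnit_iff_ne_zero.2 hc).map _
  rw [irreducible_isUnit_mul hu]
  have h1 : (X 0 ^ (k + 1) + (-1) ^ k * X 1 * X 2 ^ k : MvPolynomial (Fin 3) K) =
      C ((-1) ^ k) * X 2 ^ k * X 1 + X 0 ^ (k + 1) := by
    simp
    ring
  rw [h1]
  have hs : ((-1 : K) ^ k) ≠ 0 := pow_ne_zero _ (by simp)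
  have hu' : IsUnit (C ((-1) ^ k) : MvPolynomial (Fin 3) K) := (isUnit_iff_ne_zero.2 hs).map _
  refine irreducible_mul_X_add _ _ 1 ?_ ?_ ?_ ?_
  · exact mul_ne_zero hu'.ne_zero (pow_ne_zero _ (X_ne_zero _))
  · intro h
    have h2 := vars_mul _ _ h
    rw [Finset.mem_union] at h2
    rcases h2 with h2 | h2
    · rw [vars_C] at h2
      simp at h2
    · have := vars_pow _ _ h2
      rw [vars_X] at this
      simp at this
  · intro h
    have := vars_pow _ _ h
    rw [vars_X] at this
    simp at this
  · have h3 : IsRelPrime (X 2 : MvPolynomial (Fin 3) K) (X 0) := by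
      rw [(X_prime (i := 2)).irreducible.isRelPrime_iff_not_dvd, X_dvd_X]
      simp
    rw [isRelPrime_mul_unit_left_left hu']
    exact h3.pow

/-- The linear family of alternating matrices `Qᵀ [0, M; -Mᵀ, 0] Q`, for the matrices `M`
in the family `cornerMatrix`. -/
def cornerFamily (σ : Fin (k + 1) ⊕ Fin (k + 1) ≃ Fin n) (Q : Matrix (Fin n) (Fin n) K) :
    (Fin 3 → K) →ₗ[K] (Pairs n → K) where
  toFun t := upper (Q.transpose * blockSkew σ (cornerMatrix k t) * Q)
  map_add' s t := by
    have : blockSkew σ (cornerMatrix k (s + t)) =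
        blockSkew σ (cornerMatrix k s) + blockSkew σ (cornerMatrix k t) := by
      ext i j
      simp only [blockSkew, Matrix.add_apply, Matrix.submatrix_apply]
      rcases σ.symm i with i | i <;> rcases σ.symm j with j | j <;> simp [cornerMatrix] <;>
        split_ifs <;> simp [add_comm]
    rw [this, Matrix.mul_add, Matrix.add_mul]
    rfl
  map_smul' c t := by
    have : blockSkew σ (cornerMatrix k (c • t)) = c • blockSkew σ (cornerMatrix k t) := by
      ext i j
      simp only [blockSkew, Matrix.smul_apply, Matrix.submatrix_apply]
      rcases σ.symm i with i | i <;> rcases σ.symm j with j | j <;> simp [cornerMatrix]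
    rw [this, Matrix.mul_smul, Matrix.smul_mul]
    rfl

theorem skewMatrix_cornerFamily [CharZero K] (σ : Fin (k + 1) ⊕ Fin (k + 1) ≃ Fin n)
    (Q : Matrix (Fin n) (Fin n) K) (t : Fin 3 → K) :
    skewMatrix (cornerFamily σ Q t) = Q.transpose * blockSkew σ (cornerMatrix k t) * Q := by
  refine skewMatrix_upper (A := Q.transpose * blockSkew σ (cornerMatrix k t) * Q) ?_
  rw [Matrix.transpose_mul, Matrix.transpose_mul, transpose_blockSkew,
    Matrix.transpose_transpose, Matrix.neg_mul, Matrix.mul_neg, Matrix.mul_assoc]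

/-- On the family Pf² = ε det(Q)² det(M)², so Pf is a constant times det(M), because `ε` has a
square root in `K`. The matrix `Q` is left free so that the family can be moved into p^⊥. -/
theorem irreducible_pullback_cornerFamily [IsAlgClosed K] [CharZero K] (hP : IsPfaffian P)
    (hk : 1 ≤ k) (σ : Fin (k + 1) ⊕ Fin (k + 1) ≃ Fin n) {Q : Matrix (Fin n) (Fin n) K}
    (hQ : Q.det ≠ 0) : Irreducible (pullback P (cornerFamily σ Q)) := by
  obtain ⟨ε, hε, hdet⟩ := exists_det_blockSkew (k + 1) K σ
  have hε0 : ε ≠ 0 := left_ne_zero_of_mul_eq_one hε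
  obtain ⟨z, hz⟩ := IsAlgClosed.exists_pow_nat_eq ε (n := 2) (by norm_num)
  have hz0 : z ≠ 0 := by
    rintro rfl
    apply hε0
    rw [← hz]
    simp
  let D : MvPolynomial (Fin 3) K := X 0 ^ (k + 1) + (-1) ^ k * X 1 * X 2 ^ k
  have hsq : pullback P (cornerFamily σ Q) ^ 2 = (C (z * Q.det) * D) ^ 2 := by
    refine MvPolynomial.funext fun t => ?_
    rw [map_pow, eval_pullback, hP.eval_sq, skewMatrix_cornerFamily, Matrix.det_mul,
      Matrix.det_mul, hdet, Matrix.det_transpose, det_cornerMatrix hk, ← hz]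
    simp [D]
    ring
  rcases sq_eq_sq_iff_eq_or_eq_neg.1 hsq with h | h
  · rw [h]
    exact irreducible_cornerPolynomial (mul_ne_zero hz0 hQ)
  · rw [h, ← neg_mul, ← map_neg]
    exact irreducible_cornerPolynomial (neg_ne_zero.2 (mul_ne_zero hz0 hQ))

theorem IsPfaffian.irreducible [IsAlgClosed K] [CharZero K] (hP : IsPfaffian P)
    (hk : 1 ≤ k) (σ : Fin (k + 1) ⊕ Fin (k + 1) ≃ Fin n) : Irreducible P :=
  irreducible_of_irreducible_pullback (hP.isHomogeneous σ)
    (irreducible_pullback_cornerFamily (Q := 1) hP hk σ (by simp))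

end Irreducibility

/-! ### Irreducible hypersurfaces: tangent spaces, Gauss map, and the hessian -/

section Hypersurfaces

variable {K : Type*} [Field K] {ι κ : Type*}

theorem IsHomogeneous.gradient_zero {f : MvPolynomial ι K} {d : ℕ} (hf : f.IsHomogeneous d)
    (hd : 2 ≤ d) : gradient f 0 = 0 := by
  funext i
  have h1 := IsHomogeneous.eval_smul (hf.pderiv (i := i)) 0 0
  rw [zero_smul, zero_pow (by omega), zero_mul] at h1
  exact h1

variable [Fintype ι]

theorem exists_eq_smul_of_dotProduct {w z : ι → K} (hw : w ≠ 0)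
    (h : ∀ v, w ⬝ᵥ v = 0 → z ⬝ᵥ v = 0) : ∃ c : K, z = c • w := by
  classical
  obtain ⟨i, hi⟩ := Function.ne_iff.1 hw
  refine ⟨z i / w i, funext fun j => ?_⟩
  have h1 := h (w i • Pi.single j 1 - w j • Pi.single i 1) (by
    simp [dotProduct_sub, dotProduct_smul]
    ring)
  simp only [dotProduct_sub, dotProduct_smul, dotProduct_single_one, smul_eq_mul] at h1
  rw [Pi.smul_apply, smul_eq_mul]
  rw [Pi.zero_apply] at hi
  field_simp
  linear_combination h1

theorem mk_eq_of_dotProduct {w : ι → K} (hw : w ≠ 0) {x : ℙ K (ι → K)}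
    (h : ∀ v, w ⬝ᵥ v = 0 → x.rep ⬝ᵥ v = 0) : x = Projectivization.mk K w hw := by
  obtain ⟨c, hc⟩ := exists_eq_smul_of_dotProduct hw h
  conv_lhs => rw [← x.mk_rep]
  rw [Projectivization.mk_eq_mk_iff']
  exact ⟨c, hc.symm⟩

theorem gradient_dotProduct_of_eval [Infinite K] {f : MvPolynomial ι K} {a t : ι → K} {A B D : K}
    (h : ∀ s : K, eval (a + s • t) f = A + s * B + s ^ 2 * D) : gradient f a ⬝ᵥ t = B := by
  have h1 : lineRestrict f a t =
      Polynomial.C A + Polynomial.X * Polynomial.C B + Polynomial.X ^ 2 * Polynomial.C D := by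
    refine Polynomial.funext fun s => ?_
    rw [eval_lineRestrict, h]
    simp
    ring
  have h2 := eval_derivative_lineRestrict f a t 0
  rw [zero_smul, add_zero, h1] at h2
  rw [← h2]
  simp

theorem gradient_pullback_dotProduct [Infinite K] [Fintype κ] (f : MvPolynomial ι K)
    (L : (κ → K) →ₗ[K] (ι → K)) (v t : κ → K) :
    gradient (pullback f L) v ⬝ᵥ t = gradient f (L v) ⬝ᵥ L t := by
  have h : lineRestrict (pullback f L) v t = lineRestrict f (L v) (L t) := by
    refine Polynomial.funext fun s => ?_
    simp
  have h1 := eval_derivative_lineRestrict (pullback f L) v t 0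
  have h2 := eval_derivative_lineRestrict f (L v) (L t) 0
  rw [zero_smul, add_zero] at h1 h2
  rw [← h1, ← h2, h]

theorem eval_eq_zero_of_zeroLocus_subset {f g : MvPolynomial ι K} {d e : ℕ}
    (hf : f.IsHomogeneous d) (hg : g.IsHomogeneous e) (hne : (zeroLocus f).Nonempty)
    (h : zeroLocus f ⊆ zeroLocus g) {v : ι → K} (hv : eval v f = 0) : eval v g = 0 := by
  by_cases hv0 : v = 0
  · obtain ⟨x, hx⟩ := hne
    rw [hv0, ← zero_smul K x.rep, IsHomogeneous.eval_smul hg, show eval x.rep g = 0 from h hx,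
      mul_zero]
  · exact (mk_mem_zeroLocus hg hv0).1 (h ((mk_mem_zeroLocus hf hv0).2 hv))

/-- An irreducible hypersurface has a smooth point. -/
theorem exists_gradient_ne_zero [IsAlgClosed K] [CharZero K] {f : MvPolynomial ι K} {d : ℕ}
    (hf : f.IsHomogeneous d) (hirr : Irreducible f) (hd : 2 ≤ d) :
    ∃ v, v ≠ 0 ∧ eval v f = 0 ∧ gradient f v ≠ 0 := by
  by_contra! hcon
  have hz : ∀ i v, eval v f = 0 → eval v (pderiv i f) = 0 := by
    intro i v hv
    by_cases hv0 : v = 0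
    · rw [hv0]
      exact congrFun (IsHomogeneous.gradient_zero hf hd) i
    · exact congrFun (hcon v hv0 hv) i
  -- By the Nullstellensatz `f` divides its own partial derivatives, which have smaller degree, so
  -- these vanish. Euler's formula in characteristic zero then gives the contradiction.
  have hpd : ∀ i, pderiv i f = 0 := by
    intro i
    by_contra h0
    obtain ⟨g, hg⟩ := dvd_of_eval_eq_zero hirr (hz i)
    have h1 := (hf.pderiv (i := i)).totalDegree h0
    have hg0 : g ≠ 0 := by
      rintro rfl
      rw [mul_zero] at hg
      exact h0 hg
    rw [hg, totalDegree_mul_of_isDomain hirr.ne_zero hg0, hf.totalDegree hirr.ne_zero] at h1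
    omega
  have h2 := hf.sum_X_mul_pderiv
  simp only [hpd, mul_zero, Finset.sum_const_zero] at h2
  have h3 : (d : MvPolynomial ι K) * f = 0 := by
    rw [← nsmul_eq_mul]
    exact h2.symm
  rcases mul_eq_zero.1 h3 with h | h
  · have : (d : ℕ) = 0 := by exact_mod_cast h
    omega
  · exact hirr.ne_zero h

/-- Every form vanishing on the hypersurface is a multiple of `f`, so at a point of the hypersurface
its differential is a multiple of that of `f`. -/
theorem mem_tangentSubspace_zeroLocus [IsAlgClosed K] {f : MvPolynomial ι K} {d : ℕ}
    (hf : f.IsHomogeneous d) (hirr : Irreducible f) {x : ℙ K (ι → K)} (hx : x ∈ zeroLocus f)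
    (v : ι → K) : v ∈ tangentSubspace (zeroLocus f) x ↔ gradient f x.rep ⬝ᵥ v = 0 := by
  constructor
  · intro h
    exact h d f hf subset_rfl
  · intro h e g hg hsub
    obtain ⟨r, rfl⟩ := dvd_of_eval_eq_zero hirr fun v hv =>
      eval_eq_zero_of_zeroLocus_subset hf hg ⟨x, hx⟩ hsub hv
    have h1 : gradient (f * r) x.rep = eval x.rep r • gradient f x.rep := by
      funext i
      have h2 : eval x.rep f = 0 := hx
      simp [gradient, h2]
    rw [h1, smul_dotProduct, h, smul_zero]

/-- The dual variety of an irreducible hypersurface is the closure of the image of the Gauss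
map. -/
theorem dualVariety_zeroLocus [IsAlgClosed K] [CharZero K] {f : MvPolynomial ι K} {d : ℕ}
    (hf : f.IsHomogeneous d) (hirr : Irreducible f) (hd : 2 ≤ d) :
    dualVariety (zeroLocus f) = closure {y | ∃ x ∈ zeroLocus f, ∃ h : gradient f x.rep ≠ 0,
      y = Projectivization.mk K (gradient f x.rep) h} := by
  have htan : ∀ x ∈ zeroLocus f, tangentSubspace (zeroLocus f) x =
      LinearMap.ker (dotProductBilin K K (gradient f x.rep)) := by
    intro x hx
    ext v
    rw [mem_tangentSubspace_zeroLocus hf hirr hx]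
    rfl
  have hfin : ∀ x, gradient f x ≠ 0 →
      Module.finrank K (LinearMap.ker (dotProductBilin K K (gradient f x))) + 1 =
        Module.finrank K (ι → K) := by
    intro x hx
    refine Module.Dual.finrank_ker_add_one_of_ne_zero (f := dotProductBilin K K (gradient f x)) ?_
    intro h
    exact hx (dotProduct_eq_zero _ fun w => LinearMap.congr_fun h w)
  obtain ⟨v₀, hv₀, hfv₀, hgv₀⟩ := exists_gradient_ne_zero hf hirr hd
  -- The tangent space is a hyperplane where the gradient is nonzero and the whole space elsewhere.
  -- The minimal dimension singles out the first kind of point because there is at least one.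
  have hreg : ∀ x, x ∈ regularPoints (zeroLocus f) ↔ x ∈ zeroLocus f ∧ gradient f x.rep ≠ 0 := by
    intro x
    refine and_congr_right fun hx => ⟨fun h h0 => ?_, fun h y hy => ?_⟩
    · have hx₀ : Projectivization.mk K v₀ hv₀ ∈ zeroLocus f := (mk_mem_zeroLocus hf hv₀).2 hfv₀
      have h1 := h _ hx₀
      rw [htan x hx, htan _ hx₀] at h1
      have hgr : gradient f (Projectivization.mk K v₀ hv₀).rep ≠ 0 := by
        obtain ⟨a, ha⟩ := Projectivization.exists_smul_eq_mk_rep K v₀ hv₀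
        obtain ⟨i, hi⟩ := Function.ne_iff.1 hgv₀
        refine Function.ne_iff.2 ⟨i, ?_⟩
        rw [← ha, show a • v₀ = (a : K) • v₀ from rfl]
        simp only [gradient]
        rw [IsHomogeneous.eval_smul (hf.pderiv (i := i))]
        exact mul_ne_zero (pow_ne_zero _ a.ne_zero) hi
      have h2 := hfin _ hgr
      have h3 : LinearMap.ker (dotProductBilin K K (gradient f x.rep)) = ⊤ := by
        rw [h0, map_zero, LinearMap.ker_zero]
      rw [h3, finrank_top] at h1
      omega
    · rw [htan x hx, htan y hy]
      have h1 := hfin _ h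
      by_cases hy0 : gradient f y.rep = 0
      · exact (Submodule.finrank_le _).trans (by rw [hy0, map_zero, LinearMap.ker_zero, finrank_top])
      · have h2 := hfin _ hy0
        omega
  rw [dualVariety]
  congr 1
  ext y
  constructor
  · rintro ⟨x, hx, h⟩
    obtain ⟨hxf, hxg⟩ := (hreg x).1 hx
    exact ⟨x, hxf, hxg, mk_eq_of_dotProduct hxg fun v hv =>
      h v ((mem_tangentSubspace_zeroLocus hf hirr hxf v).2 hv)⟩
  · rintro ⟨x, hx, hxg, rfl⟩
    refine ⟨x, (hreg x).2 ⟨hx, hxg⟩, fun v hv => ?_⟩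
    obtain ⟨a, ha⟩ := Projectivization.exists_smul_eq_mk_rep K _ hxg
    rw [← ha, show a • gradient f x.rep = (a : K) • gradient f x.rep from rfl, smul_dotProduct,
      (mem_tangentSubspace_zeroLocus hf hirr hx v).1 hv, smul_zero]

/-- The hessian vanishes if the polar image is a hypersurface. -/
theorem hessian_eq_zero_of_polarImage [IsAlgClosed K] [CharZero K] [DecidableEq ι]
    {f g : MvPolynomial ι K} {d : ℕ} (hg : g.IsHomogeneous d) (hirr : Irreducible g)
    (hd : 2 ≤ d) (h0 : ∀ x, eval (gradient f x) g = 0) (hpol : polarImage f = zeroLocus g) :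
    hessian f = 0 := by
  by_contra hne
  -- Differentiating g(∇f) = 0 puts the vector ∇g(∇f) into the kernel of the Hessian matrix. If the
  -- hessian is a nonzero polynomial, this vector vanishes on a dense open set, hence everywhere.
  have hz : ∀ j x, eval (gradient f x) (pderiv j g) = 0 := by
    intro j
    have hmul : ∀ x, eval x (hessian f) * eval (gradient f x) (pderiv j g) = 0 := by
      intro x
      by_contra hx
      have h1 := left_ne_zero_of_mul hx
      have h2 := right_ne_zero_of_mul hx
      apply h1
      rw [hessian, RingHom.map_det]
      refine Matrix.exists_mulVec_eq_zero_iff.1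
        ⟨fun j => eval (gradient f x) (pderiv j g), fun h => h2 (congrFun h j), funext fun i => ?_⟩
      have h3 : aeval (fun j => pderiv j f) g = 0 := by
        refine MvPolynomial.funext fun y => ?_
        rw [eval_aeval, map_zero]
        exact h0 y
      have h4 := congrArg (fun p => eval x (pderiv i p)) h3
      simp only [Derivation.map_mvPolynomial_aeval, map_sum, map_mul, eval_aeval, map_zero] at h4
      simp only [Matrix.mulVec, dotProduct, Pi.zero_apply, RingHom.mapMatrix_apply,
        Matrix.map_apply, Matrix.of_apply]
      rw [← h4]
      exact Finset.sum_congr rfl fun l _ => mul_comm _ _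
    rcases (IsPolyFun.eval _).eq_zero_or_eq_zero
      ((IsPolyFun.eval (pderiv j g)).comp fun i => IsPolyFun.eval (pderiv i f)) hmul with h | h
    · exact absurd (MvPolynomial.funext fun x => by rw [h x, map_zero]) hne
    · exact h
  -- A smooth point of V(g) belongs to the polar image, where all partial derivatives of `g` vanish.
  obtain ⟨v, hv, hgv, hgr⟩ := exists_gradient_ne_zero hg hirr hd
  apply hgr
  funext j
  have h1 : Projectivization.mk K v hv ∈ polarImage f := by
    rw [hpol, mk_mem_zeroLocus hg]
    exact hgv
  have hsub : polarImage f ⊆ zeroLocus (pderiv j g) := by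
    refine closure_minimal ?_ (isClosed_zeroLocus (hg.pderiv (i := j)))
    rintro _ ⟨x, h, rfl⟩
    rw [mk_mem_zeroLocus (hg.pderiv (i := j))]
    exact hz j _
  exact (mk_mem_zeroLocus (hg.pderiv (i := j)) hv).1 (hsub h1)

end Hypersurfaces

/-! ### The dual variety of the Grassmannian of lines -/

section DualGrassmannian

variable {K : Type*} [Field K] {n k : ℕ}

theorem wedge_smul_left (c : K) (u v : Fin n → K) : wedge (c • u) v = c • wedge u v := by
  funext q
  simp [wedge]
  ring

theorem wedge_add_right (u v w : Fin n → K) : wedge u (v + w) = wedge u v + wedge u w := by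
  funext q
  simp [wedge]
  ring

theorem wedge_smul_right (c : K) (u v : Fin n → K) : wedge u (c • v) = c • wedge u v := by
  funext q
  simp [wedge]
  ring

theorem wedge_swap (u v : Fin n → K) : wedge u v = -wedge v u := by
  funext q
  simp [wedge]
  ring

theorem wedge_ne_zero [CharZero K] {u v : Fin n → K} (h : LinearIndependent K ![u, v]) :
    wedge u v ≠ 0 := by
  intro h0
  obtain ⟨i, hi⟩ := Function.ne_iff.1 (h.ne_zero 0)
  have h1 := LinearIndependent.pair_iff.1 h (v i) (-u i) (by
    funext j
    have h2 := congrFun (congrFun (skewMatrix_wedge u v) i) j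
    rw [h0, show (0 : Pairs n → K) = (0 : K) • 0 by simp, skewMatrix_smul, zero_smul] at h2
    simp only [Matrix.zero_apply, Matrix.sub_apply, Matrix.vecMulVec_apply] at h2
    simp only [Pi.add_apply, Pi.smul_apply, smul_eq_mul, Pi.zero_apply]
    linear_combination h2)
  exact hi (by simpa using h1.2)

theorem mk_wedge_mem_grassmannianLines {u v : Fin n → K} (h : wedge u v ≠ 0) :
    Projectivization.mk K (wedge u v) h ∈ grassmannianLines K n := by
  obtain ⟨c, hc⟩ := Projectivization.exists_smul_eq_mk_rep K (wedge u v) h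
  exact ⟨(c : K) • u, v, by rw [← hc]; exact (wedge_smul_left _ _ _).symm⟩

theorem eval_wedge_eq_zero [CharZero K] {g : MvPolynomial (Pairs n) K} {d : ℕ}
    (hg : g.IsHomogeneous d) (hX : grassmannianLines K n ⊆ zeroLocus g) {u₀ v₀ : Fin n → K}
    (h₀ : wedge u₀ v₀ ≠ 0) (u v : Fin n → K) : eval (wedge u v) g = 0 := by
  by_cases h : wedge u v = 0
  · rw [h, ← zero_smul K (wedge u₀ v₀), IsHomogeneous.eval_smul hg,
      (mk_mem_zeroLocus hg h₀).1 (hX (mk_wedge_mem_grassmannianLines h₀)), mul_zero]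
  · exact (mk_mem_zeroLocus hg h).1 (hX (mk_wedge_mem_grassmannianLines h))

/-- The line of points u ∧ (v + s w) stays on the Grassmannian. -/
theorem wedge_mem_tangentSubspace [CharZero K] {x : ℙ K (Pairs n → K)} {u v : Fin n → K}
    (hx : x.rep = wedge u v) (w : Fin n → K) :
    wedge u w ∈ tangentSubspace (grassmannianLines K n) x := by
  intro d g hg hX
  refine gradient_dotProduct_of_eval (A := 0) (D := 0) fun s => ?_
  rw [hx, ← wedge_smul_right, ← wedge_add_right,
    eval_wedge_eq_zero hg hX (hx ▸ x.rep_nonzero)]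
  ring

/-- The general linear group acts transitively on lines, and an invertible matrix carrying one line
to another carries tangent space injectively into tangent space. All points are therefore regular.
-/
theorem finrank_tangentSubspace_grassmannianLines_le [CharZero K] {x y : ℙ K (Pairs n → K)}
    (hx : x ∈ grassmannianLines K n) (hy : y ∈ grassmannianLines K n) :
    Module.finrank K (tangentSubspace (grassmannianLines K n) x) ≤
      Module.finrank K (tangentSubspace (grassmannianLines K n) y) := by
  obtain ⟨u, v, hx : x.rep = wedge u v⟩ := hx
  obtain ⟨u', v', hy : y.rep = wedge u' v'⟩ := hy
  obtain ⟨Q, R, -, hRQ, hu, hv⟩ := exists_matrix_mulVec_eq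
    (linearIndependent_of_wedge_ne_zero (hx ▸ x.rep_nonzero))
    (linearIndependent_of_wedge_ne_zero (hy ▸ y.rep_nonzero))
  have hmap : ∀ t ∈ tangentSubspace (grassmannianLines K n) x,
      congruence Q t ∈ tangentSubspace (grassmannianLines K n) y := by
    intro t ht d g hg hX
    have h1 := ht d (pullback g (congruence Q)) (IsHomogeneous.pullback hg _) (by
      rintro z ⟨a, b, hz : z.rep = wedge a b⟩
      show eval z.rep _ = 0
      rw [eval_pullback, hz, congruence_wedge]
      exact eval_wedge_eq_zero hg hX (hx ▸ x.rep_nonzero) _ _)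
    rw [gradient_pullback_dotProduct, hx, congruence_wedge, hu, hv, ← hy] at h1
    exact h1
  refine LinearMap.finrank_le_finrank_of_injective (f := (congruence Q).restrict hmap) ?_
  intro s t hst
  have h1 : congruence Q s.1 = congruence Q t.1 := congrArg Subtype.val hst
  have h2 := congrArg (congruence R) h1
  rw [← congruence_mul, ← congruence_mul, hRQ, congruence_one, congruence_one] at h2
  exact Subtype.ext h2

theorem regularPoints_grassmannianLines [CharZero K] :
    regularPoints (grassmannianLines K n) = grassmannianLines K n :=
  Set.Subset.antisymm (fun _ hx => hx.1) fun _ hx =>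
    ⟨hx, fun _ hy => finrank_tangentSubspace_grassmannianLines_le hx hy⟩

theorem isHomogeneous_skewMatrix_X (i j : Fin n) :
    (skewMatrix (fun q => (X q : MvPolynomial (Pairs n) K)) i j).IsHomogeneous 1 := by
  rcases lt_trichotomy i j with h | rfl | h
  · rw [skewMatrix_apply_of_lt _ h]
    exact isHomogeneous_X _ _
  · rw [skewMatrix_apply_self]
    exact isHomogeneous_zero _ _ _
  · rw [skewMatrix_apply_swap, skewMatrix_apply_of_lt _ h]
    exact (isHomogeneous_X _ _).neg

/-- The quadratic Plücker relations. -/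
noncomputable def plucker (K : Type*) [Field K] {n : ℕ} (i j k l : Fin n) :
    MvPolynomial (Pairs n) K :=
  let S := skewMatrix fun q => (X q : MvPolynomial (Pairs n) K)
  S i j * S k l - S i k * S j l + S i l * S j k

theorem eval_plucker (i j k l : Fin n) (a : Pairs n → K) :
    eval a (plucker K i j k l) = skewMatrix a i j * skewMatrix a k l -
      skewMatrix a i k * skewMatrix a j l + skewMatrix a i l * skewMatrix a j k := by
  simp only [plucker, map_add, map_sub, map_mul, eval_skewMatrix, eval_X]

theorem isHomogeneous_plucker (i j k l : Fin n) : (plucker K i j k l).IsHomogeneous 2 :=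
  (((isHomogeneous_skewMatrix_X i j).mul (isHomogeneous_skewMatrix_X k l)).sub
    ((isHomogeneous_skewMatrix_X i k).mul (isHomogeneous_skewMatrix_X j l))).add
    ((isHomogeneous_skewMatrix_X i l).mul (isHomogeneous_skewMatrix_X j k))

theorem skewMatrix_wedge_apply (u v : Fin n → K) (i j : Fin n) :
    skewMatrix (wedge u v) i j = u i * v j - v i * u j := by
  rw [skewMatrix_wedge]
  rfl

/-- The linearized Plücker relations write a nonzero multiple of the matrix of a tangent vector as a
sum of rank-one matrices, each with `u` or `v` as a factor. An alternating form with `u` and `v` in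
its kernel pairs to zero with such a sum. -/
theorem dotProduct_eq_zero_of_mem_tangentSubspace [CharZero K] {x : ℙ K (Pairs n → K)}
    {u v : Fin n → K} (hx : x.rep = wedge u v) {a : Pairs n → K}
    (hu : (skewMatrix a).mulVec u = 0) (hv : (skewMatrix a).mulVec v = 0) {t : Pairs n → K}
    (ht : t ∈ tangentSubspace (grassmannianLines K n) x) : a ⬝ᵥ t = 0 := by
  obtain ⟨q, hq⟩ := Function.ne_iff.1 (hx ▸ x.rep_nonzero : wedge u v ≠ 0)
  set i := q.1.1
  set j := q.1.2
  set M := skewMatrix t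
  -- The coefficient of s in the Plücker relation evaluated at u ∧ v + s t.
  have hrel : ∀ k l : Fin n, (u i * v j - v i * u j) * M k l + M i j * (u k * v l - v k * u l)
      - (u i * v k - v i * u k) * M j l - M i k * (u j * v l - v j * u l)
      + (u i * v l - v i * u l) * M j k + M i l * (u j * v k - v j * u k) = 0 := by
    intro k l
    rw [← ht 2 (plucker K i j k l) (isHomogeneous_plucker i j k l) (by
      rintro z ⟨a, b, hz : z.rep = wedge a b⟩
      show eval z.rep _ = 0
      rw [eval_plucker, hz]
      simp only [skewMatrix_wedge_apply]
      ring)]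
    symm
    refine gradient_dotProduct_of_eval (A := 0)
      (D := M i j * M k l - M i k * M j l + M i l * M j k) fun s => ?_
    rw [hx, eval_plucker, skewMatrix_add, skewMatrix_smul]
    simp only [Matrix.add_apply, Matrix.smul_apply, smul_eq_mul, skewMatrix_wedge_apply]
    ring
  have hM : (u i * v j - v i * u j) • M =
      Matrix.vecMulVec (fun k => M i j * v k - M i k * v j + v i * M j k) u +
      Matrix.vecMulVec (fun k => -M i j * u k + M i k * u j - u i * M j k) v +
      Matrix.vecMulVec u (fun l => v j * M i l - v i * M j l) +
      Matrix.vecMulVec v (fun l => u i * M j l - u j * M i l) := by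
    ext k l
    simp only [Matrix.add_apply, Matrix.smul_apply, smul_eq_mul, Matrix.vecMulVec_apply]
    linear_combination hrel k l
  have hu' : Matrix.vecMul u (skewMatrix a) = 0 := by
    rw [← Matrix.mulVec_transpose, transpose_skewMatrix, Matrix.neg_mulVec, hu, neg_zero]
  have hv' : Matrix.vecMul v (skewMatrix a) = 0 := by
    rw [← Matrix.mulVec_transpose, transpose_skewMatrix, Matrix.neg_mulVec, hv, neg_zero]
  -- The trace of A · xyᵀ is the pairing of y with Ax, which is zero if either x or y is one of `u`,
  -- `v`.
  have htr : (skewMatrix a * ((u i * v j - v i * u j) • M)).trace = 0 := by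
    rw [hM]
    simp only [mul_add, Matrix.mul_vecMulVec, Matrix.trace_add, Matrix.trace_vecMulVec, hu, hv,
      zero_dotProduct, add_zero]
    rw [dotProduct_comm, Matrix.dotProduct_mulVec, hu', zero_dotProduct, zero_add,
      dotProduct_comm, Matrix.dotProduct_mulVec, hv', zero_dotProduct]
  rw [Matrix.mul_smul, Matrix.trace_smul, trace_mul_skewMatrix _ (transpose_skewMatrix a),
    upper_skewMatrix, smul_eq_mul] at htr
  have hq' : u i * v j - v i * u j ≠ 0 := fun h => hq (by
    show u i * v j - u j * v i = 0
    linear_combination h)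
  simpa [hq'] using htr

/-- The dual variety of the Grassmann variety of lines in an odd-dimensional projective space is
the Pfaffian hypersurface. -/
theorem dualVariety_grassmannianLines [CharZero K] {P : MvPolynomial (Pairs n) K}
    (hP : IsPfaffian P) (σ : Fin k ⊕ Fin k ≃ Fin n) :
    dualVariety (grassmannianLines K n) = zeroLocus P := by
  refine Set.Subset.antisymm (closure_minimal ?_ (isClosed_zeroLocus (hP.isHomogeneous σ))) ?_
  · rintro h ⟨x, hx, hT⟩
    obtain ⟨u, v, hx : x.rep = wedge u v⟩ := hx.1
    have hu : u ≠ 0 := by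
      rintro rfl
      exact x.rep_nonzero (hx.trans (by funext q; simp [wedge]))
    refine eval_eq_zero_of_mulVec_eq_zero hP hu ?_
    have h1 : ∀ w, u ⬝ᵥ (skewMatrix h.rep).mulVec w = 0 := fun w => by
      rw [← dotProduct_wedge]
      exact hT _ (wedge_mem_tangentSubspace hx w)
    have h2 : Matrix.vecMul u (skewMatrix h.rep) = 0 := by
      refine dotProduct_eq_zero _ fun w => ?_
      rw [← Matrix.dotProduct_mulVec]
      exact h1 w
    rwa [← Matrix.mulVec_transpose, transpose_skewMatrix, Matrix.neg_mulVec, neg_eq_zero] at h2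
  · intro h hh
    obtain ⟨u, v, huv, hu, hv⟩ := exists_kernel_pair hP σ hh
    have hw := wedge_ne_zero huv
    refine subset_closure ⟨Projectivization.mk K _ hw, ?_, fun t ht => ?_⟩
    · rw [regularPoints_grassmannianLines]
      exact mk_wedge_mem_grassmannianLines hw
    · obtain ⟨c, hc⟩ := Projectivization.exists_smul_eq_mk_rep K _ hw
      refine dotProduct_eq_zero_of_mem_tangentSubspace (u := (c : K) • u) (v := v) ?_ ?_ hv ht
      · rw [← hc, wedge_smul_left]
        rfl
      · rw [Matrix.mulVec_smul, hu, smul_zero]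

end DualGrassmannian

/-! ### The hyperplane p^⊥ and projection from p -/

section Hyperplane

variable {K : Type*} [Field K] {n : ℕ} {p : ℙ K (Pairs n → K)} {ι : Type*}

theorem restrictForms_apply (b : Module.Basis ι K (perp p)) (y : Pairs n → K) (i : ι) :
    restrictForms b y i = (b i : Pairs n → K) ⬝ᵥ y := rfl

theorem mem_perp {a : Pairs n → K} : a ∈ perp p ↔ a ⬝ᵥ p.rep = 0 := Iff.rfl

theorem mem_perp_iff {u v : Fin n → K} (hp : p.rep = wedge u v) {a : Pairs n → K} :
    a ∈ perp p ↔ u ⬝ᵥ (skewMatrix a).mulVec v = 0 := by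
  rw [mem_perp, hp, dotProduct_wedge]

variable [Fintype ι] (b : Module.Basis ι K (perp p))

theorem coordMap_apply (x : ι → K) : coordMap b x = ∑ i, x i • (b i : Pairs n → K) := by
  simp [coordMap, Module.Basis.equivFun_symm_apply]

theorem coordMap_mem (x : ι → K) : coordMap b x ∈ perp p := Subtype.property _

theorem exists_coordMap_eq {a : Pairs n → K} (ha : a ∈ perp p) : ∃ x, coordMap b x = a :=
  ⟨b.equivFun ⟨a, ha⟩, by simp [coordMap]⟩

theorem dotProduct_restrictForms (x : ι → K) (y : Pairs n → K) :
    x ⬝ᵥ restrictForms b y = coordMap b x ⬝ᵥ y := by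
  rw [coordMap_apply, sum_dotProduct]
  simp only [smul_dotProduct]
  rfl

theorem restrictForms_eq_zero_iff {y : Pairs n → K} :
    restrictForms b y = 0 ↔ ∃ c : K, y = c • p.rep := by
  constructor
  · intro h
    refine exists_eq_smul_of_dotProduct p.rep_nonzero fun a ha => ?_
    obtain ⟨x, rfl⟩ := exists_coordMap_eq b (mem_perp.2 (by rwa [dotProduct_comm]))
    rw [dotProduct_comm, ← dotProduct_restrictForms, h, dotProduct_zero]
  · rintro ⟨c, rfl⟩
    funext i
    rw [restrictForms_apply, dotProduct_smul, mem_perp.1 (b i).2, smul_zero, Pi.zero_apply]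

theorem card_add_one_eq (b : Module.Basis ι K (perp p)) : Fintype.card ι + 1 = Fintype.card (Pairs n) := by
  have h1 : perp p = LinearMap.ker ((dotProductBilin K K).flip p.rep : (Pairs n → K) →ₗ[K] K) := by
    ext a
    exact Iff.rfl
  have h2 : LinearMap.range ((dotProductBilin K K).flip p.rep : (Pairs n → K) →ₗ[K] K) = ⊤ := by
    rw [LinearMap.range_eq_top]
    refine LinearMap.surjective (fun h => p.rep_nonzero (dotProduct_eq_zero _ fun w => ?_))
    rw [dotProduct_comm]
    exact LinearMap.congr_fun h w
  have h3 := LinearMap.finrank_range_add_finrank_ker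
    ((dotProductBilin K K).flip p.rep : (Pairs n → K) →ₗ[K] K)
  rw [h2, ← h1, finrank_top, Module.finrank_self, Module.finrank_fintype_fun_eq_card,
    Module.finrank_eq_card_basis b] at h3
  omega

theorem restrictForms_surjective : Function.Surjective (restrictForms b) := by
  have h1 : LinearMap.ker (restrictForms b) = Submodule.span K {p.rep} := by
    ext y
    rw [LinearMap.mem_ker, restrictForms_eq_zero_iff, Submodule.mem_span_singleton]
    exact exists_congr fun c => eq_comm
  have h3 := LinearMap.finrank_range_add_finrank_ker (restrictForms b)
  rw [h1, finrank_span_singleton p.rep_nonzero, Module.finrank_fintype_fun_eq_card,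
    ← card_add_one_eq b] at h3
  rw [← LinearMap.range_eq_top]
  refine Submodule.eq_top_of_finrank_eq ?_
  rw [Module.finrank_fintype_fun_eq_card]
  omega

/-- The polar map of the hyperplane section is the polar map of the whole hypersurface followed by
the projection from p. -/
theorem gradient_pullback_coordMap [DecidableEq ι] (P : MvPolynomial (Pairs n) K) (x : ι → K) :
    gradient (pullback P (coordMap b)) x = restrictForms b (gradient P (coordMap b x)) := by
  funext i
  rw [gradient_pullback, restrictForms_apply, coordMap_apply b (Pi.single i 1), dotProduct_comm]
  congr 1
  rw [Finset.sum_eq_single i (fun j _ hj => by rw [Pi.single_eq_of_ne hj, zero_smul]) (by simp),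
    Pi.single_eq_same, one_smul]

theorem eval_det_genericSkew (x : ι → K) :
    eval x (genericSkew b).det = (skewMatrix (coordMap b x)).det := by
  rw [RingHom.map_det, RingHom.mapMatrix_apply, genericSkew, map_skewMatrix]
  congr 2
  funext q
  rw [coordMap_apply]
  simp [Finset.sum_apply, mul_comm]

theorem pullback_coordMap_sq [Infinite K] {P : MvPolynomial (Pairs n) K} (hP : IsPfaffian P) :
    pullback P (coordMap b) ^ 2 = (genericSkew b).det := by
  refine MvPolynomial.funext fun x => ?_
  rw [eval_det_genericSkew, map_pow, eval_pullback, hP.eval_sq]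

theorem exists_rep_smul_eq {ι' : Type*} {v : ι' → K} (hv : v ≠ 0) :
    ∃ c : K, c ≠ 0 ∧ (Projectivization.mk K v hv).rep = c • v := by
  obtain ⟨c, hc⟩ := Projectivization.exists_smul_eq_mk_rep K v hv
  exact ⟨c, c.ne_zero, hc.symm⟩

theorem hyperplaneSection_skewRankLocus [CharZero K] {k r : ℕ} {P : MvPolynomial (Pairs n) K}
    (hP : IsPfaffian P) (σ : Fin k ⊕ Fin k ≃ Fin n) (hr : n = r + 2) :
    hyperplaneSection b (skewRankLocus K n r) = zeroLocus (pullback P (coordMap b)) := by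
  ext x
  have h0 : coordMap b x.rep ≠ 0 := fun h => x.rep_nonzero
    (coordMap_injective b (h.trans (map_zero _).symm))
  have h1 : Projectivization.map (coordMap b) (coordMap_injective b) x =
      Projectivization.mk K (coordMap b x.rep) h0 := by
    conv_lhs => rw [← x.mk_rep]
    rw [Projectivization.map_mk]
  show Projectivization.map (coordMap b) (coordMap_injective b) x ∈ skewRankLocus K n r ↔ _
  rw [h1]
  refine (rank_skewMatrix_le_iff hP σ hr _).trans
    (Iff.trans (mk_mem_zeroLocus (hP.isHomogeneous σ) h0) ?_)
  rw [← eval_pullback]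
  rfl

end Hyperplane

/-! ### The polar image of the tangent hyperplane section -/

section Section

variable {K : Type*} [Field K] {n n' k : ℕ} {u v : Fin n → K}

theorem IsHomogeneous.gradient_smul {ι : Type*} {f : MvPolynomial ι K} {d : ℕ}
    (hf : f.IsHomogeneous d) (t : K) (x : ι → K) :
    gradient f (t • x) = t ^ (d - 1) • gradient f x :=
  funext fun _ => IsHomogeneous.eval_smul hf.pderiv t x

theorem pullback_pullback [Infinite K] {ι₁ ι₂ ι₃ : Type*} [Fintype ι₁] [Fintype ι₂]
    (f : MvPolynomial ι₃ K) (L : (ι₂ → K) →ₗ[K] (ι₃ → K)) (M : (ι₁ → K) →ₗ[K] (ι₂ → K)) :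
    pullback (pullback f L) M = pullback f (L ∘ₗ M) :=
  MvPolynomial.funext fun x => by simp

theorem pullback_id [Infinite K] {ι : Type*} [Fintype ι] (f : MvPolynomial ι K) :
    pullback f LinearMap.id = f :=
  MvPolynomial.funext fun x => by simp

/-- If a linear map has a section, pulling back along it preserves irreducibility. -/
theorem irreducible_pullback_of_section [Infinite K] {ι κ : Type*} [Fintype ι] [Fintype κ]
    {f : MvPolynomial κ K} {d : ℕ} (hf : f.IsHomogeneous d) (hirr : Irreducible f)
    {L : (ι → K) →ₗ[K] (κ → K)} {J : (κ → K) →ₗ[K] (ι → K)} (h : L ∘ₗ J = LinearMap.id) :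
    Irreducible (pullback f L) := by
  refine irreducible_of_irreducible_pullback (L := J) (IsHomogeneous.pullback hf L) ?_
  rwa [pullback_pullback, h, pullback_id]

theorem zero_dotProduct_skewMatrix [CharZero K] (a : Pairs n → K) (x : Fin n → K) :
    x ⬝ᵥ (skewMatrix a).mulVec x = 0 := by
  rw [← dotProduct_wedge, show wedge x x = 0 by funext q; simp [wedge]; ring, dotProduct_zero]

theorem dotProduct_skewMatrix_comm (a : Pairs n → K) (x y : Fin n → K) :
    x ⬝ᵥ (skewMatrix a).mulVec y = -(y ⬝ᵥ (skewMatrix a).mulVec x) := by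
  rw [← dotProduct_wedge, ← dotProduct_wedge, wedge_swap, dotProduct_neg]

theorem Splitting.proj_transpose_injective (s : Splitting n' u v) {c : Fin n' → K}
    (h : s.proj.transpose.mulVec c = 0) : c = 0 := by
  have h1 := congrArg (s.sect.transpose.mulVec ·) h
  simpa only [Matrix.mulVec_mulVec, ← Matrix.transpose_mul, s.proj_mul_sect,
    Matrix.transpose_one, Matrix.one_mulVec, Matrix.mulVec_zero] using h1

theorem Splitting.left_dotProduct (s : Splitting n' u v) (c : Fin n' → K) :
    u ⬝ᵥ s.proj.transpose.mulVec c = 0 := by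
  rw [Matrix.dotProduct_mulVec, Matrix.vecMul_transpose, s.proj_mulVec_left, zero_dotProduct]

theorem Splitting.right_dotProduct (s : Splitting n' u v) (c : Fin n' → K) :
    v ⬝ᵥ s.proj.transpose.mulVec c = 0 := by
  rw [Matrix.dotProduct_mulVec, Matrix.vecMul_transpose, s.proj_mulVec_right, zero_dotProduct]

variable {p : ℙ K (Pairs n → K)} {ι : Type*} (b : Module.Basis ι K (perp p))

theorem congruence_proj_sect [CharZero K] (s : Splitting n' u v) (y : Pairs n' → K) :
    congruence s.proj (congruence s.sect y) = y := by
  rw [← congruence_mul, s.proj_mul_sect, congruence_one]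

/-- This splitting is what transfers irreducibility, the cone structure and the dimension from the
smaller Pfaffian to its pullback. -/
theorem quotientMap_comp_section [CharZero K] (s : Splitting n' u v)
    {ρ : (ι → K) →ₗ[K] (Pairs n' → K)}
    (hρ : ∀ y, ρ (restrictForms b y) = congruence s.proj y) :
    ρ ∘ₗ (restrictForms b ∘ₗ congruence s.sect) = LinearMap.id :=
  LinearMap.ext fun y => (hρ _).trans (congruence_proj_sect s y)

variable [Fintype ι]

/-- `restrictForms b` is surjective with kernel spanned by p, so a linear map killing p descends. -/
theorem exists_comp_restrictForms_eq {V : Type*} [AddCommGroup V] [Module K V]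
    (ψ : (Pairs n → K) →ₗ[K] V) (hψ : ψ p.rep = 0) :
    ∃ ρ : (ι → K) →ₗ[K] V, ∀ y, ρ (restrictForms b y) = ψ y := by
  obtain ⟨J, hJ⟩ := (restrictForms b).exists_rightInverse_of_surjective
    (LinearMap.range_eq_top.2 (restrictForms_surjective b))
  refine ⟨ψ ∘ₗ J, fun y => ?_⟩
  have h1 : restrictForms b (J (restrictForms b y) - y) = 0 := by
    rw [map_sub, sub_eq_zero]
    exact LinearMap.congr_fun hJ _
  obtain ⟨c, hc⟩ := (restrictForms_eq_zero_iff b).1 h1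
  rw [LinearMap.comp_apply, ← sub_eq_zero, ← map_sub, hc, map_smul, hψ, smul_zero]

/-- The map from the quotient of the space of forms on `p^⊥` to the skew-symmetric matrices in the
quotient by the line `p`. -/
theorem exists_quotientMap [CharZero K] (hp : p.rep = wedge u v) (s : Splitting n' u v) :
    ∃ ρ : (ι → K) →ₗ[K] (Pairs n' → K), ∀ y, ρ (restrictForms b y) = congruence s.proj y := by
  refine exists_comp_restrictForms_eq b (congruence s.proj) ?_
  rw [hp, congruence_wedge, s.proj_mulVec_left, s.proj_mulVec_right]
  funext q
  simp [wedge]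

variable {P : MvPolynomial (Pairs n) K} {P' : MvPolynomial (Pairs n') K}

/-- The restriction of the Pfaffian to `p^⊥` is irreducible when `p` is decomposable. -/
theorem irreducible_pullback_coordMap [IsAlgClosed K] [CharZero K] (hP : IsPfaffian P)
    (hk : 1 ≤ k) (σ : Fin (k + 1) ⊕ Fin (k + 1) ≃ Fin n) (hp : p.rep = wedge u v) :
    Irreducible (pullback P (coordMap b)) := by
  -- Both positions lie in the same isotropic half of the block matrices. Moving `u` and `v` there
  -- makes every member of the corner family pair to zero with p.
  have h01 : σ (Sum.inl 0) ≠ σ (Sum.inl (Fin.last k)) := fun h => by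
    have := congrArg Fin.val (Sum.inl_injective (σ.injective h))
    simp at this
    omega
  obtain ⟨Q, R, hQR, hRQ, hu, hv⟩ := exists_matrix_mulVec_eq
    (linearIndependent_of_wedge_ne_zero (hp ▸ p.rep_nonzero)) (linearIndependent_single h01)
  have hQ : Q.det ≠ 0 := fun h => by
    have := congrArg Matrix.det hQR
    rw [Matrix.det_mul, h, zero_mul, Matrix.det_one] at this
    exact zero_ne_one this
  have hmem : ∀ t, cornerFamily σ Q t ∈ perp p := by
    intro t
    rw [mem_perp_iff hp, skewMatrix_cornerFamily, ← Matrix.mulVec_mulVec, ← Matrix.mulVec_mulVec,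
      hv, Matrix.dotProduct_mulVec, Matrix.vecMul_transpose, hu]
    simp [blockSkew]
  refine irreducible_of_irreducible_pullback (IsHomogeneous.pullback (hP.isHomogeneous σ) _)
    (L := b.equivFun.toLinearMap ∘ₗ (cornerFamily σ Q).codRestrict (perp p) hmem) ?_
  rw [pullback_pullback]
  convert irreducible_pullback_cornerFamily hP hk σ hQ using 2
  refine LinearMap.ext fun t => ?_
  simp [coordMap]

/-- The covector Au annihilates u since A is alternating, and v since A ∈ p^⊥, so it comes from some
nonzero `c` on the quotient. As ∇Pf(A) · A is scalar, the compressed gradient sends `c` to a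
multiple of the image of u in the quotient, which is zero. -/
theorem eval_congruence_gradient [CharZero K] (hP : IsPfaffian P) (hP' : IsPfaffian P')
    (σ : Fin k ⊕ Fin k ≃ Fin n) (hp : p.rep = wedge u v) (s : Splitting n' u v)
    {a : Pairs n → K} (ha : a ∈ perp p) (h0 : eval a P ≠ 0) :
    eval (congruence s.proj (gradient P a)) P' = 0 := by
  obtain ⟨c, hc⟩ := s.exists_eq_transpose_proj_mulVec (x := (skewMatrix a).mulVec u)
    (zero_dotProduct_skewMatrix a u)
    (by rw [dotProduct_skewMatrix_comm, (mem_perp_iff hp).1 ha, neg_zero])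
  have hc0 : c ≠ 0 := by
    rintro rfl
    rw [Matrix.mulVec_zero] at hc
    exact h0 (eval_eq_zero_of_mulVec_eq_zero hP s.left_ne_zero hc)
  refine eval_eq_zero_of_mulVec_eq_zero hP' hc0 ?_
  rw [skewMatrix_congruence, ← Matrix.mulVec_mulVec, ← hc, ← Matrix.mulVec_mulVec,
    Matrix.mulVec_mulVec (M := skewMatrix (gradient P a)), hP.gradient_mul_skewMatrix σ, Matrix.smul_mulVec, Matrix.one_mulVec,
    Matrix.mulVec_smul, s.proj_mulVec_left, smul_zero]

/-- `eval_congruence_gradient` covers the points where f is not zero; these are dense. -/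
theorem eval_gradient_eq_zero [CharZero K] (hP : IsPfaffian P) (hP' : IsPfaffian P')
    (σ : Fin k ⊕ Fin k ≃ Fin n) (hp : p.rep = wedge u v) (s : Splitting n' u v)
    {ρ : (ι → K) →ₗ[K] (Pairs n' → K)}
    (hρ : ∀ y, ρ (restrictForms b y) = congruence s.proj y)
    (hf0 : pullback P (coordMap b) ≠ 0) (x : ι → K) :
    eval (gradient (pullback P (coordMap b)) x) (pullback P' ρ) = 0 := by
  classical
  rcases IsPolyFun.eq_zero_or_eq_zero (IsPolyFun.eval (pullback P (coordMap b)))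
    ((IsPolyFun.eval (pullback P' ρ)).comp (ψ := gradient (pullback P (coordMap b)))
      fun i => IsPolyFun.eval _) (fun t => by
      rw [mul_eq_zero, or_iff_not_imp_left]
      intro h
      rw [eval_pullback, gradient_pullback_coordMap, hρ]
      exact eval_congruence_gradient hP hP' σ hp s (coordMap_mem b t) (by rwa [eval_pullback] at h))
    with h | h
  · exact absurd (MvPolynomial.funext fun x => (h x).trans (map_zero _).symm) hf0
  · exact h x

/-- The matrices whose block complementary to the line `p` is singular are, up to a scalar, polar
images of points of `p^⊥`, if they are invertible. -/
theorem exists_gradient_eq_smul [CharZero K] (hP : IsPfaffian P) (hP' : IsPfaffian P')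
    (hp : p.rep = wedge u v) (s : Splitting n' u v)
    {y : Pairs n → K} (hy : (skewMatrix y).det ≠ 0) (h : eval (congruence s.proj y) P' = 0) :
    ∃ a ∈ perp p, a ≠ 0 ∧ ∃ c : K, c ≠ 0 ∧ gradient P a = c • y ∧ restrictForms b y ≠ 0 := by
  obtain ⟨w, hw0, hw⟩ := Matrix.exists_mulVec_eq_zero_iff.2 (hP'.eval_eq_zero_iff.1 h)
  rw [skewMatrix_congruence, ← Matrix.mulVec_mulVec, ← Matrix.mulVec_mulVec] at hw
  -- The covector z = projᵀ w annihilates u and v, and Yz lies in their span; with A = Y⁻¹ this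
  -- reads z = αAu + βAv.
  obtain ⟨α, β, hαβ⟩ := s.exists_eq_of_proj_mulVec hw
  set z := s.proj.transpose.mulVec w
  have hz0 : z ≠ 0 := fun h => hw0 (s.proj_transpose_injective h)
  have huz : u ⬝ᵥ z = 0 := s.left_dotProduct w
  have hvz : v ⬝ᵥ z = 0 := s.right_dotProduct w
  have hunit : IsUnit (skewMatrix y).det := isUnit_iff_ne_zero.2 hy
  set a := upper (skewMatrix y)⁻¹
  have ha : skewMatrix a = (skewMatrix y)⁻¹ := skewMatrix_upper (transpose_inv_skewMatrix y)
  have hz : z = α • (skewMatrix a).mulVec u + β • (skewMatrix a).mulVec v := by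
    rw [← Matrix.mulVec_smul, ← Matrix.mulVec_smul, ← Matrix.mulVec_add, ← hαβ, ha,
      Matrix.mulVec_mulVec, Matrix.nonsing_inv_mul _ hunit, Matrix.one_mulVec]
  -- Pairing z with u leaves β(uᵀAv), and pairing it with v leaves -α(uᵀAv). Both are zero, so uᵀAv
  -- ≠ 0 would force z = 0.
  have hperp : u ⬝ᵥ (skewMatrix a).mulVec v = 0 := by
    have h1 := huz
    have h2 := hvz
    rw [hz, dotProduct_add, dotProduct_smul, dotProduct_smul, zero_dotProduct_skewMatrix,
      smul_zero] at h1 h2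
    rw [dotProduct_skewMatrix_comm a v u, smul_eq_mul, add_zero] at h2
    rw [smul_eq_mul, zero_add] at h1
    by_contra hne
    have hα : α = 0 := by simpa [hne] using h2
    have hβ : β = 0 := by simpa [hne] using h1
    exact hz0 (by rw [hz, hα, hβ, zero_smul, zero_smul, add_zero])
  have hadet : (skewMatrix a).det ≠ 0 := by
    rw [ha]
    exact (Matrix.isUnit_nonsing_inv_det _ hunit).ne_zero
  refine ⟨a, (mem_perp_iff hp).2 hperp, fun h => ?_, -(eval a P),
    neg_ne_zero.2 fun h => hadet (hP.eval_eq_zero_iff.1 h), ?_, ?_⟩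
  · rw [h, ← zero_smul K (0 : Pairs n → K), skewMatrix_smul] at hz
    exact hz0 (by simpa using hz)
  · rw [hP.gradient_of_det_ne_zero hadet, ha, Matrix.nonsing_inv_nonsing_inv _ hunit,
      upper_skewMatrix]
  · intro h0
    obtain ⟨c, hc⟩ := (restrictForms_eq_zero_iff b).1 h0
    refine hz0 (Matrix.eq_zero_of_mulVec_eq_zero hy ?_)
    rw [hc, hp, skewMatrix_smul, skewMatrix_wedge, Matrix.smul_mulVec, Matrix.sub_mulVec,
      Matrix.vecMulVec_mulVec, Matrix.vecMulVec_mulVec, huz, hvz]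
    simp

/-- The polar image of a tangent hyperplane section of the Pfaffian hypersurface. -/
theorem polarImage_pullback_coordMap [IsAlgClosed K] [CharZero K] [DecidableEq ι]
    (hP : IsPfaffian P) (hP' : IsPfaffian P') {k' : ℕ}
    (σ : Fin k ⊕ Fin k ≃ Fin n) (σ' : Fin k' ⊕ Fin k' ≃ Fin n') (hirr' : Irreducible P')
    (hp : p.rep = wedge u v) (s : Splitting n' u v) {ρ : (ι → K) →ₗ[K] (Pairs n' → K)}
    (hρ : ∀ y, ρ (restrictForms b y) = congruence s.proj y)
    (hf0 : pullback P (coordMap b) ≠ 0) :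
    polarImage (pullback P (coordMap b)) = zeroLocus (pullback P' ρ) := by
  have hg := IsHomogeneous.pullback (hP'.isHomogeneous σ') ρ
  have hf := IsHomogeneous.pullback (hP.isHomogeneous σ) (coordMap b)
  refine Set.Subset.antisymm (closure_minimal ?_ (isClosed_zeroLocus hg)) fun y hy => ?_
  · rintro _ ⟨x, h, rfl⟩
    exact (mk_mem_zeroLocus hg h).2 (eval_gradient_eq_zero b hP hP' σ hp s hρ hf0 _)
  · refine mem_closure_iff_zeroLocus.2 fun d h hh hS => ?_
    have hq : Irreducible (pullback P' (congruence s.proj)) :=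
      irreducible_pullback_of_section (J := congruence s.sect) (hP'.isHomogeneous σ') hirr'
        (LinearMap.ext fun y => congruence_proj_sect s y)
    -- A form vanishing on the polar image vanishes at the invertible matrices with singular
    -- compression; the factor `P` takes care of the matrices that are not invertible.
    have hdvd : pullback P' (congruence s.proj) ∣ P * pullback h (restrictForms b) := by
      refine dvd_of_eval_eq_zero hq fun y hy => ?_
      rw [map_mul, mul_eq_zero, or_iff_not_imp_left]
      intro hy0
      rw [eval_pullback] at hy ⊢
      obtain ⟨a, ha, ha0, c, hc, hgrad, hT⟩ := exists_gradient_eq_smul b hP hP' hp s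
        (fun h => hy0 (hP.eval_eq_zero_iff.2 h)) hy
      obtain ⟨x, rfl⟩ := exists_coordMap_eq b ha
      have hx0 : x ≠ 0 := fun h => ha0 (by rw [h, map_zero])
      obtain ⟨t, ht, hrep⟩ := exists_rep_smul_eq hx0
      have hgr : gradient (pullback P (coordMap b)) (Projectivization.mk K x hx0).rep =
          (t ^ (k - 1) * c) • restrictForms b y := by
        rw [hrep, IsHomogeneous.gradient_smul hf, gradient_pullback_coordMap, hgrad, map_smul,
          smul_smul]
      have hne : (t ^ (k - 1) * c) • restrictForms b y ≠ 0 :=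
        smul_ne_zero (mul_ne_zero (pow_ne_zero _ ht) hc) hT
      have h2 := (mk_mem_zeroLocus hh (hgr ▸ hne)).1 (hS ⟨_, hgr ▸ hne, rfl⟩)
      rw [hgr, IsHomogeneous.eval_smul hh] at h2
      exact (mul_eq_zero.1 h2).resolve_left
        (pow_ne_zero _ (mul_ne_zero (pow_ne_zero _ ht) hc))
    -- The first case is impossible: at an A in p^⊥ with Pf(A) ≠ 0 the gradient has singular
    -- compression, so it would be singular itself, whereas A · ∇Pf(A) is a nonzero scalar matrix.
    rcases hq.prime.dvd_or_dvd hdvd with h1 | h1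
    · obtain ⟨x, hx⟩ : ∃ x, eval x (pullback P (coordMap b)) ≠ 0 := by
        by_contra! hx
        exact hf0 (MvPolynomial.funext fun x => (hx x).trans (map_zero _).symm)
      rw [eval_pullback] at hx
      obtain ⟨r, hr⟩ := h1
      have h2 : eval (gradient P (coordMap b x)) P = 0 := by
        rw [congrArg (eval (gradient P (coordMap b x))) hr, map_mul, eval_pullback,
          eval_congruence_gradient hP hP' σ hp s (coordMap_mem b x) hx, zero_mul]
      have h3 := congrArg Matrix.det (hP.skewMatrix_mul_gradient σ (coordMap b x))
      rw [Matrix.det_mul, hP.eval_eq_zero_iff.1 h2, mul_zero, Matrix.det_smul, Matrix.det_one,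
        mul_one] at h3
      exact absurd (eq_zero_of_pow_eq_zero h3.symm) (neg_ne_zero.2 hx)
    · obtain ⟨r, hr⟩ := h1
      obtain ⟨z, hz⟩ := restrictForms_surjective b y.rep
      show eval y.rep h = 0
      have hy' : eval y.rep (pullback P' ρ) = 0 := hy
      rw [eval_pullback, ← hz, hρ] at hy'
      rw [← hz, ← eval_pullback, hr, map_mul, eval_pullback, hy', zero_mul]

end Section

/-! ### Cones and their vertices -/

section Cones

variable {K : Type*} [Field K] {ι κ : Type*}

/-- If no nonzero vector is a vertex of the cone `P = 0`, the vertex of its inverse image under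
a linear map is the kernel. -/
theorem isConeOver_zeroLocus_pullback [Fintype ι] {P : MvPolynomial κ K} {d : ℕ}
    (hP : P.IsHomogeneous d) (hd : d ≠ 0) (hne : (zeroLocus P).Nonempty)
    (hvert : ∀ a : κ → K, a ≠ 0 → ∃ c, eval c P = 0 ∧ eval (a + c) P ≠ 0)
    {ρ : (ι → K) →ₗ[K] (κ → K)} {j : (κ → K) →ₗ[K] (ι → K)} (h : ρ ∘ₗ j = LinearMap.id) :
    IsConeOver (zeroLocus (pullback P ρ)) (LinearMap.ker ρ) (zeroLocus P) := by
  have hg := IsHomogeneous.pullback hP ρ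
  have hj : ∀ y, ρ (j y) = y := LinearMap.congr_fun h
  have h0 : eval 0 P = 0 := by
    have := IsHomogeneous.eval_smul hP 0 0
    rwa [zero_smul, zero_pow hd, zero_mul] at this
  have hmem : ∀ x : ℙ K (ι → K), x ∈ zeroLocus (pullback P ρ) ↔ eval (ρ x.rep) P = 0 := by
    intro x
    rw [← eval_pullback]
    rfl
  refine ⟨Set.Subset.antisymm ?_ ?_, j, Function.LeftInverse.injective hj, ⟨?_, ?_⟩,
    Set.Subset.antisymm ?_ ?_⟩
  · rintro x ⟨hx, hxy⟩
    by_contra hρ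
    obtain ⟨c, hc, hac⟩ := hvert (ρ x.rep) hρ
    have hc0 : c ≠ 0 := by
      rintro rfl
      exact hac (by rw [add_zero]; exact (hmem x).1 hx)
    have hjc : j c ≠ 0 := fun h => hc0 (by rw [← hj c, h, map_zero])
    obtain ⟨t, ht, hrep⟩ := exists_rep_smul_eq hjc
    have hsum : (1 : K) • x.rep + t⁻¹ • (Projectivization.mk K (j c) hjc).rep = x.rep + j c := by
      rw [hrep, one_smul, smul_smul, inv_mul_cancel₀ ht, one_smul]
    have hsum0 : (1 : K) • x.rep + t⁻¹ • (Projectivization.mk K (j c) hjc).rep ≠ 0 := by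
      rw [hsum]
      intro h
      have := congrArg ρ h
      rw [map_add, hj, map_zero] at this
      exact hac (by rw [this, h0])
    have h1 := (mk_mem_zeroLocus hg hsum0).1 (hxy _ ((mk_mem_zeroLocus hg hjc).2 (by
      rw [eval_pullback, hj, hc])) _ _ hsum0)
    rw [hsum, eval_pullback, map_add, hj] at h1
    exact hac h1
  · intro x hx
    have hx' : ρ x.rep = 0 := hx
    refine ⟨(hmem x).2 (by rw [hx', h0]), fun y hy α β hne => (mk_mem_zeroLocus hg hne).2 ?_⟩
    rw [eval_pullback, map_add, map_smul, map_smul, hx', smul_zero, zero_add,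
      IsHomogeneous.eval_smul hP, (hmem y).1 hy, mul_zero]
  · rw [Submodule.disjoint_def]
    rintro _ hx ⟨y, rfl⟩
    rw [LinearMap.mem_ker, hj] at hx
    rw [hx, map_zero]
  · rw [codisjoint_iff, eq_top_iff]
    intro x _
    refine Submodule.mem_sup.2 ⟨x - j (ρ x), ?_, j (ρ x), ⟨_, rfl⟩, sub_add_cancel _ _⟩
    rw [LinearMap.mem_ker, map_sub, hj, sub_self]
  · intro x hx
    have hmemsup : ∀ (y : κ → K) (c : K), ρ x.rep = c • y →
        x.rep ∈ LinearMap.ker ρ ⊔ Submodule.span K {j y} := by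
      intro y c hy
      refine Submodule.mem_sup.2 ⟨x.rep - c • j y, ?_, c • j y,
        Submodule.smul_mem _ _ (Submodule.mem_span_singleton_self _), sub_add_cancel _ _⟩
      rw [LinearMap.mem_ker, map_sub, map_smul, hj, hy, sub_self]
    by_cases hρ : ρ x.rep = 0
    · obtain ⟨y, hy⟩ := hne
      exact ⟨y, hy, hmemsup _ 0 (by rw [hρ, zero_smul])⟩
    · refine ⟨Projectivization.mk K _ hρ, (mk_mem_zeroLocus hP hρ).2 ((hmem x).1 hx), ?_⟩
      obtain ⟨t, ht, hrep⟩ := exists_rep_smul_eq hρ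
      exact hmemsup _ t⁻¹ (by rw [hrep, smul_smul, inv_mul_cancel₀ ht, one_smul])
  · rintro x ⟨y, hy, hx⟩
    obtain ⟨l, hl, z, hz, hlz⟩ := Submodule.mem_sup.1 hx
    obtain ⟨c, rfl⟩ := Submodule.mem_span_singleton.1 hz
    rw [hmem, ← hlz, map_add, LinearMap.mem_ker.1 hl, map_smul, hj, zero_add,
      IsHomogeneous.eval_smul hP, show eval y.rep P = 0 from hy, mul_zero]

theorem finrank_ker_of_section [Fintype ι] [Fintype κ] {ρ : (ι → K) →ₗ[K] (κ → K)}
    {j : (κ → K) →ₗ[K] (ι → K)} (h : ρ ∘ₗ j = LinearMap.id) :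
    Module.finrank K (LinearMap.ker ρ) + Fintype.card κ = Fintype.card ι := by
  have h1 := LinearMap.finrank_range_add_finrank_ker ρ
  rw [LinearMap.range_eq_top.2 (Function.RightInverse.surjective (f := ρ) (g := j) (LinearMap.congr_fun h)),
    finrank_top, Module.finrank_fintype_fun_eq_card, Module.finrank_fintype_fun_eq_card] at h1
  omega

end Cones

/-! ### The dual variety of the hyperplane section -/

section DualVariety

variable {K : Type*} [Field K] {n n' k : ℕ} {u v : Fin n → K}

/-- A matrix with one entry above the diagonal has rank at most two, and a third standard basis
vector lies in its kernel. -/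
theorem eval_smul_single_eq_zero {P : MvPolynomial (Pairs n) K} (hP : IsPfaffian P) (hn : 3 ≤ n)
    (c : K) (q : Pairs n) : eval (c • Pi.single q 1) P = 0 := by
  obtain ⟨r, hr1, hr2⟩ := Fin.exists_ne_and_ne_of_two_lt q.1.1 q.1.2 hn
  refine eval_eq_zero_of_mulVec_eq_zero hP (u := Pi.single r 1) (by simp) ?_
  rw [single_eq_wedge, skewMatrix_smul, skewMatrix_wedge, Matrix.smul_mulVec, Matrix.sub_mulVec,
    Matrix.vecMulVec_mulVec, Matrix.vecMulVec_mulVec]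
  simp [hr1, hr2]

theorem zeroLocus_pfaffian_nonempty [CharZero K] {P : MvPolynomial (Pairs n) K}
    (hP : IsPfaffian P) (σ : Fin k ⊕ Fin k ≃ Fin n) (hn : 3 ≤ n) : (zeroLocus P).Nonempty := by
  let q : Pairs n := ⟨(⟨0, by omega⟩, ⟨1, by omega⟩), by simp [Fin.lt_def]⟩
  have h0 : (Pi.single q 1 : Pairs n → K) ≠ 0 := by simp
  refine ⟨Projectivization.mk K _ h0, (mk_mem_zeroLocus (hP.isHomogeneous σ) h0).2 ?_⟩
  rw [← one_smul K (Pi.single q 1 : Pairs n → K)]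
  exact eval_smul_single_eq_zero hP hn 1 q

/-- Independent vectors can be moved to two positions in the same isotropic half of the standard
form, and `2 ≤ k` provides two such positions. -/
theorem exists_det_ne_zero_of_dotProduct_eq_zero [CharZero K] (hk : 2 ≤ k)
    (σ : Fin k ⊕ Fin k ≃ Fin n) (x y : Fin n → K) :
    ∃ a : Pairs n → K, (skewMatrix a).det ≠ 0 ∧ x ⬝ᵥ (skewMatrix a).mulVec y = 0 := by
  by_cases h : wedge x y = 0
  · obtain ⟨a, ha⟩ := exists_det_skewMatrix_ne_zero (K := K) σ
    exact ⟨a, ha, by rw [← dotProduct_wedge, h, dotProduct_zero]⟩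
  · have h01 : σ (Sum.inl ⟨0, by omega⟩) ≠ σ (Sum.inl ⟨1, by omega⟩) := fun h => by
      simpa using Sum.inl_injective (σ.injective h)
    obtain ⟨Q, R, hQR, hRQ, hx, hy⟩ := exists_matrix_mulVec_eq
      (linearIndependent_of_wedge_ne_zero h) (linearIndependent_single h01)
    have hskew : (Q.transpose * blockSkew σ 1 * Q).transpose =
        -(Q.transpose * blockSkew σ 1 * Q) := by
      rw [Matrix.transpose_mul, Matrix.transpose_mul, transpose_blockSkew,
        Matrix.transpose_transpose, Matrix.neg_mul, Matrix.mul_neg, Matrix.mul_assoc]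
    refine ⟨upper (Q.transpose * blockSkew σ 1 * Q), ?_, ?_⟩
    · obtain ⟨ε, hε, hdet⟩ := exists_det_blockSkew k K σ
      have hQ : Q.det * R.det = 1 := by rw [← Matrix.det_mul, hQR, Matrix.det_one]
      rw [skewMatrix_upper hskew, Matrix.det_mul, Matrix.det_mul, Matrix.det_transpose, hdet,
        Matrix.det_one, one_pow, mul_one]
      have hQ0 := left_ne_zero_of_mul_eq_one hQ
      exact mul_ne_zero (mul_ne_zero hQ0 (left_ne_zero_of_mul_eq_one hε)) hQ0
    · rw [skewMatrix_upper hskew, ← Matrix.mulVec_mulVec, ← Matrix.mulVec_mulVec, hy,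
        Matrix.dotProduct_mulVec, Matrix.vecMul_transpose, hx]
      simp [blockSkew]

variable {p : ℙ K (Pairs n → K)} {ι : Type*} [Fintype ι] (b : Module.Basis ι K (perp p))
variable {P : MvPolynomial (Pairs n) K}

/-- The dual variety of a tangent hyperplane section of the Pfaffian hypersurface is the
projection of the Grassmann variety of lines. -/
theorem dualVariety_zeroLocus_pullback_coordMap [IsAlgClosed K] [CharZero K]
    (hP : IsPfaffian P) (σ : Fin k ⊕ Fin k ≃ Fin n) {k' : ℕ} (hk' : 2 ≤ k')
    (σ' : Fin k' ⊕ Fin k' ≃ Fin n') (hn : n = n' + 2) (hk : 2 ≤ k) (hp : p.rep = wedge u v)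
    (hirr : Irreducible (pullback P (coordMap b))) :
    dualVariety (zeroLocus (pullback P (coordMap b))) =
      linearProjection (restrictForms b) (grassmannianLines K n) := by
  classical
  have hf := IsHomogeneous.pullback (hP.isHomogeneous σ) (coordMap b)
  have hmem : ∀ x : ℙ K (ι → K), x ∈ zeroLocus (pullback P (coordMap b)) ↔
      eval (coordMap b x.rep) P = 0 := by
    intro x
    rw [← eval_pullback]
    rfl
  rw [dualVariety_zeroLocus hf hirr hk, linearProjection]
  congr 1
  ext y
  constructor
  · rintro ⟨x, hx, h, rfl⟩
    have hT := gradient_pullback_coordMap b P x.rep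
    have hgrad : gradient P (coordMap b x.rep) ≠ 0 := by
      intro h'
      rw [h', map_zero] at hT
      exact h hT
    obtain ⟨w₁, w₂, -, -, hw⟩ := hP.exists_gradient_eq_wedge σ ((hmem x).1 hx) hgrad
    have hw0 : wedge w₁ w₂ ≠ 0 := hw ▸ hgrad
    obtain ⟨t, ht, hrep⟩ := exists_rep_smul_eq hw0
    have hTrep : restrictForms b (Projectivization.mk K _ hw0).rep =
        t • gradient (pullback P (coordMap b)) x.rep := by
      rw [hrep, map_smul, hT, hw]
    have hne : restrictForms b (Projectivization.mk K _ hw0).rep ≠ 0 := by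
      rw [hTrep]
      exact smul_ne_zero ht h
    refine ⟨_, mk_wedge_mem_grassmannianLines hw0, hne, ?_⟩
    rw [Projectivization.mk_eq_mk_iff']
    exact ⟨t⁻¹, by rw [hTrep, smul_smul, inv_mul_cancel₀ ht, one_smul]⟩
  · rintro ⟨y, ⟨w₁, w₂, hy : y.rep = wedge w₁ w₂⟩, hT, rfl⟩
    -- A point of the section with kernel spanned by `w₁`, `w₂` is the pullback of a nondegenerate
    -- form on the quotient by them; it lies in p^⊥ when the images of `u` and `v` are orthogonal
    -- for that form.
    obtain ⟨s⟩ := exists_splitting hn (linearIndependent_of_wedge_ne_zero (hy ▸ y.rep_nonzero))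
    obtain ⟨S, hS, hS0⟩ := exists_det_ne_zero_of_dotProduct_eq_zero hk' σ' (s.proj.mulVec u)
      (s.proj.mulVec v)
    have hperp : congruence s.proj.transpose S ∈ perp p := by
      rw [mem_perp_iff hp, skewMatrix_congruence, Matrix.transpose_transpose,
        ← Matrix.mulVec_mulVec, ← Matrix.mulVec_mulVec, Matrix.dotProduct_mulVec,
        Matrix.vecMul_transpose, hS0]
    obtain ⟨x, hx⟩ := exists_coordMap_eq b hperp
    have hx0 : x ≠ 0 := by
      rintro rfl
      obtain ⟨c, hc, hgr⟩ := s.gradient_congruence hP σ hS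
      rw [← hx, map_zero, IsHomogeneous.gradient_zero (hP.isHomogeneous σ) hk, ← hy] at hgr
      exact smul_ne_zero hc y.rep_nonzero hgr.symm
    obtain ⟨t, ht, hrep⟩ := exists_rep_smul_eq hx0
    have hcoord : coordMap b (Projectivization.mk K x hx0).rep =
        congruence s.proj.transpose (t • S) := by rw [hrep, map_smul, map_smul, hx]
    have htS : (skewMatrix (t • S)).det ≠ 0 := by
      rw [skewMatrix_smul, Matrix.det_smul]
      exact mul_ne_zero (pow_ne_zero _ ht) hS
    obtain ⟨c, hc, hgr⟩ := s.gradient_congruence hP σ htS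
    have hgr' : gradient (pullback P (coordMap b)) (Projectivization.mk K x hx0).rep =
        c • restrictForms b y.rep := by
      rw [gradient_pullback_coordMap, hcoord, hgr, map_smul, hy]
    refine ⟨_, (hmem _).2 ?_, hgr' ▸ smul_ne_zero hc hT, ?_⟩
    · refine eval_eq_zero_of_mulVec_eq_zero hP s.left_ne_zero ?_
      rw [hcoord, skewMatrix_congruence, Matrix.transpose_transpose, ← Matrix.mulVec_mulVec,
        s.proj_mulVec_left, Matrix.mulVec_zero]
    · rw [Projectivization.mk_eq_mk_iff']
      exact ⟨c⁻¹, by rw [hgr', smul_smul, inv_mul_cancel₀ hc, one_smul]⟩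

end DualVariety

/-! ### Coordinates of affine charts -/

section Charts

variable {n n' : ℕ}

/-- The vector whose coordinates at the positions given by `τ` are `x` and `y`. -/
def chartVector {A : Type*} (τ : Fin n' ⊕ Fin 2 ≃ Fin n) (x : Fin n' → A) (y : Fin 2 → A) : Fin n → A :=
  Sum.elim x y ∘ τ.symm

theorem chartVector_inl {A : Type*} (τ : Fin n' ⊕ Fin 2 ≃ Fin n) (x : Fin n' → A) (y : Fin 2 → A)
    (i : Fin n') : chartVector τ x y (τ (Sum.inl i)) = x i := by simp [chartVector]

theorem chartVector_inr {A : Type*} (τ : Fin n' ⊕ Fin 2 ≃ Fin n) (x : Fin n' → A) (y : Fin 2 → A)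
    (i : Fin 2) : chartVector τ x y (τ (Sum.inr i)) = y i := by simp [chartVector]

theorem chartVector_eq {A : Type*} (τ : Fin n' ⊕ Fin 2 ≃ Fin n) (z : Fin n → A) :
    z = chartVector τ (fun i => z (τ (Sum.inl i))) ![z (τ (Sum.inr 0)), z (τ (Sum.inr 1))] := by
  funext r
  obtain ⟨j, rfl⟩ := τ.surjective r
  rcases j with j | j
  · rw [chartVector_inl]
  · rw [chartVector_inr]
    fin_cases j <;> rfl

end Charts

/-! ### The dimension of the projected Grassmannian -/

section DimensionProjection

variable {K : Type*} [Field K] {n n' : ℕ} {u v : Fin n → K}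
  {p : ℙ K (Pairs n → K)} {ι : Type*} (b : Module.Basis ι K (perp p))

theorem mk_restrictForms_mem_linearProjection {x y : Fin n → K}
    (h : restrictForms b (wedge x y) ≠ 0) :
    Projectivization.mk K _ h ∈ linearProjection (restrictForms b) (grassmannianLines K n) := by
  have h0 : wedge x y ≠ 0 := fun h' => h (by rw [h', map_zero])
  obtain ⟨c, hc, hrep⟩ := exists_rep_smul_eq h0
  refine subset_closure ⟨_, mk_wedge_mem_grassmannianLines h0, ?_, ?_⟩
  · rw [hrep, map_smul]
    exact smul_ne_zero hc h
  · rw [Projectivization.mk_eq_mk_iff']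
    exact ⟨c⁻¹, by rw [hrep, map_smul, smul_smul, inv_mul_cancel₀ hc, one_smul]⟩

/-- Cramer's rule. With `e` the inverse of αδ - γβ, the new pair has an identity block in the two
chart positions, and its wedge is a multiple of the old one. -/
theorem wedge_smul_sub (e α β γ δ : K) (a c : Fin n → K) :
    wedge (e • (δ • a - β • c)) (e • (α • c - γ • a)) = (e * (e * (α * δ - γ * β))) • wedge a c := by
  funext q
  simp only [wedge, Pi.smul_apply, Pi.sub_apply, smul_eq_mul]
  ring

/-- An entry of the matrix in new coordinates. -/
def entryForm (Q : Matrix (Fin n) (Fin n) K) (i j : Fin n) : (Pairs n → K) →ₗ[K] K where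
  toFun y := skewMatrix (congruence Q y) i j
  map_add' y z := by rw [map_add, skewMatrix_add, Matrix.add_apply]
  map_smul' c y := by
    rw [map_smul, skewMatrix_smul, Matrix.smul_apply]
    rfl

theorem entryForm_wedge [CharZero K] (Q : Matrix (Fin n) (Fin n) K) (i j : Fin n)
    (x y : Fin n → K) : entryForm Q i j (wedge x y) =
      Q.mulVec x i * Q.mulVec y j - Q.mulVec y i * Q.mulVec x j := by
  change skewMatrix (congruence Q (wedge x y)) i j = _
  rw [congruence_wedge, skewMatrix_wedge_apply]

/-- The affine chart of the Grassmann variety of lines, projected from a point. -/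
noncomputable def projectedChart {d : ℕ} (τ : Fin n' ⊕ Fin 2 ≃ Fin n) (E : Fin n' ⊕ Fin n' ≃ Fin d)
    (R : Matrix (Fin n) (Fin n) K) (t : Fin d → K) : ι → K :=
  restrictForms b (wedge (R.mulVec (chartVector τ (fun i => t (E (Sum.inl i))) ![1, 0]))
    (R.mulVec (chartVector τ (fun i => t (E (Sum.inr i))) ![0, 1])))

theorem isPolyFun_projectedChart {d : ℕ} (τ : Fin n' ⊕ Fin 2 ≃ Fin n)
    (E : Fin n' ⊕ Fin n' ≃ Fin d) (R : Matrix (Fin n) (Fin n) K) (i : ι) :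
    IsPolyFun fun t => projectedChart b τ E R t i := by
  have hc : ∀ (F : Fin n' → Fin d) (y : Fin 2 → K) (r : Fin n),
      IsPolyFun fun t : Fin d → K => chartVector τ (fun i => t (F i)) y r := by
    intro F y r
    obtain ⟨j, rfl⟩ := τ.surjective r
    rcases j with j | j
    · simp only [chartVector_inl]
      exact IsPolyFun.coord _
    · simp only [chartVector_inr]
      exact IsPolyFun.const _
  have hR : ∀ (F : Fin n' → Fin d) (y : Fin 2 → K) (r : Fin n),
      IsPolyFun fun t : Fin d → K => R.mulVec (chartVector τ (fun i => t (F i)) y) r :=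
    fun F y r => IsPolyFun.sum Finset.univ fun j => (IsPolyFun.const (R r j)).mul (hc F y j)
  exact IsPolyFun.sum _ fun q => (IsPolyFun.const _).mul
    (((hR _ _ _).mul (hR _ _ _)).sub ((hR _ _ _).mul (hR _ _ _)))

variable [Fintype ι]

/-- The projection of the Grassmann variety of lines from one of its points has the same
dimension. -/
theorem topologicalKrullDim_linearProjection_grassmannianLines [CharZero K]
    (hn : n = n' + 2) (hn' : 2 ≤ n') (hp : p.rep = wedge u v) :
    topologicalKrullDim (linearProjection (restrictForms b) (grassmannianLines K n)) =
      (2 * n' : ℕ) := by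
  let τ : Fin n' ⊕ Fin 2 ≃ Fin n := Fintype.equivOfCardEq (by simp [hn])
  let E : Fin n' ⊕ Fin n' ≃ Fin (2 * n') := Fintype.equivOfCardEq (by simp; omega)
  -- In these coordinates the line p avoids the two positions `Sum.inr`. Matrix entries in those
  -- rows vanish at p, hence descend to linear forms on the projection.
  have h01 : τ (Sum.inl ⟨0, by omega⟩) ≠ τ (Sum.inl ⟨1, by omega⟩) := by simp
  obtain ⟨Q, R, hQR, hRQ, hu, hv⟩ := exists_matrix_mulVec_eq
    (linearIndependent_of_wedge_ne_zero (hp ▸ p.rep_nonzero)) (linearIndependent_single h01)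
  have hform : ∀ i : Fin 2, ∀ j : Fin n, entryForm Q (τ (Sum.inr i)) j p.rep = 0 := by
    intro i j
    rw [hp, entryForm_wedge, hu, hv]
    simp
  choose ℓ hℓ using fun i j => exists_comp_restrictForms_eq b _ (hform i j)
  have hval : ∀ t i j, ℓ i j (projectedChart b τ E R t) =
      chartVector τ (fun i => t (E (Sum.inl i))) ![1, 0] (τ (Sum.inr i)) *
        chartVector τ (fun i => t (E (Sum.inr i))) ![0, 1] j -
      chartVector τ (fun i => t (E (Sum.inr i))) ![0, 1] (τ (Sum.inr i)) *
        chartVector τ (fun i => t (E (Sum.inl i))) ![1, 0] j := by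
    intro t i j
    rw [projectedChart, hℓ, entryForm_wedge, Matrix.mulVec_mulVec, Matrix.mulVec_mulVec, hQR,
      Matrix.one_mulVec, Matrix.one_mulVec]
  have hℓ₀ : ∀ t, ℓ 0 (τ (Sum.inr 1)) (projectedChart b τ E R t) = 1 := by
    intro t
    rw [hval]
    simp [chartVector_inr]
  refine le_antisymm ?_ ?_
  · refine topologicalKrullDim_closure_le (isPolyFun_projectedChart b τ E R) ?_
    refine closure_minimal ?_ isClosed_closure
    rintro _ ⟨y, ⟨x₁, x₂, hy : y.rep = wedge x₁ x₂⟩, hT, rfl⟩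
    refine mem_closure_iff_zeroLocus.2 fun d h hh hS => (mk_mem_zeroLocus hh hT).2 ?_
    rw [hy]
    have hchart : ∀ t, eval (projectedChart b τ E R t) h = 0 := by
      intro t
      have h0 : projectedChart b τ E R t ≠ 0 := fun h => by
        have := hℓ₀ t
        rw [h, map_zero] at this
        exact zero_ne_one this
      exact (mk_mem_zeroLocus hh h0).1 (hS ⟨t, h0, rfl⟩)
    have hnorm : ∀ a c : Fin n → K, Q.mulVec a (τ (Sum.inr 0)) = 1 →
        Q.mulVec a (τ (Sum.inr 1)) = 0 → Q.mulVec c (τ (Sum.inr 0)) = 0 →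
        Q.mulVec c (τ (Sum.inr 1)) = 1 → eval (restrictForms b (wedge a c)) h = 0 := by
      intro a c h1 h2 h3 h4
      rw [← hchart fun r => Sum.elim (fun i => Q.mulVec a (τ (Sum.inl i)))
        (fun i => Q.mulVec c (τ (Sum.inl i))) (E.symm r), projectedChart]
      simp only [Equiv.symm_apply_apply, Sum.elim_inl, Sum.elim_inr]
      have ha := chartVector_eq τ (Q.mulVec a)
      have hc := chartVector_eq τ (Q.mulVec c)
      rw [h1, h2] at ha
      rw [h3, h4] at hc
      rw [← ha, ← hc, Matrix.mulVec_mulVec, Matrix.mulVec_mulVec, hRQ, Matrix.one_mulVec,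
        Matrix.one_mulVec]
    -- `D` is the minor that has to be nonzero for a line to lie in the chart. Multiplying by it
    -- extends the vanishing of `h` from the chart to all lines.
    set D : (Fin n → K) → (Fin n → K) → K := fun a c =>
      Q.mulVec a (τ (Sum.inr 0)) * Q.mulVec c (τ (Sum.inr 1)) -
        Q.mulVec c (τ (Sum.inr 0)) * Q.mulVec a (τ (Sum.inr 1))
    have hmul : ∀ t : Fin n ⊕ Fin n → K, D (fun i => t (Sum.inl i)) (fun i => t (Sum.inr i)) *
        eval (restrictForms b (wedge (fun i => t (Sum.inl i)) (fun i => t (Sum.inr i)))) h = 0 := by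
      intro t
      set a : Fin n → K := fun i => t (Sum.inl i)
      set c : Fin n → K := fun i => t (Sum.inr i)
      by_cases hD0 : D a c = 0
      · rw [hD0, zero_mul]
      · have hDac : D a c = Q.mulVec a (τ (Sum.inr 0)) * Q.mulVec c (τ (Sum.inr 1)) -
          Q.mulVec c (τ (Sum.inr 0)) * Q.mulVec a (τ (Sum.inr 1)) := rfl
        have h1 := hnorm
          ((D a c)⁻¹ • (Q.mulVec c (τ (Sum.inr 1)) • a - Q.mulVec a (τ (Sum.inr 1)) • c))
          ((D a c)⁻¹ • (Q.mulVec a (τ (Sum.inr 0)) • c - Q.mulVec c (τ (Sum.inr 0)) • a))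
          (by
            simp only [Matrix.mulVec_smul, Matrix.mulVec_sub, Pi.smul_apply, Pi.sub_apply,
              smul_eq_mul]
            rw [inv_mul_eq_one₀ hD0]
            linear_combination hDac)
          (by
            simp only [Matrix.mulVec_smul, Matrix.mulVec_sub, Pi.smul_apply, Pi.sub_apply,
              smul_eq_mul]
            ring)
          (by
            simp only [Matrix.mulVec_smul, Matrix.mulVec_sub, Pi.smul_apply, Pi.sub_apply,
              smul_eq_mul]
            ring)
          (by
            simp only [Matrix.mulVec_smul, Matrix.mulVec_sub, Pi.smul_apply, Pi.sub_apply,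
              smul_eq_mul]
            rw [inv_mul_eq_one₀ hD0])
        rw [wedge_smul_sub, ← hDac, inv_mul_cancel₀ hD0, mul_one, map_smul,
          IsHomogeneous.eval_smul hh] at h1
        rw [(mul_eq_zero.1 h1).resolve_left (pow_ne_zero _ (inv_ne_zero hD0)), mul_zero]
    have hcl : ∀ i, IsPolyFun fun t : Fin n ⊕ Fin n → K => t (Sum.inl i) := fun i =>
      IsPolyFun.coord _
    have hcr : ∀ i, IsPolyFun fun t : Fin n ⊕ Fin n → K => t (Sum.inr i) := fun i =>
      IsPolyFun.coord _
    have hQl : ∀ i, IsPolyFun fun t : Fin n ⊕ Fin n → K => Q.mulVec (fun i => t (Sum.inl i)) i :=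
      fun i => IsPolyFun.sum Finset.univ fun j => (IsPolyFun.const (Q i j)).mul (hcl j)
    have hQr : ∀ i, IsPolyFun fun t : Fin n ⊕ Fin n → K => Q.mulVec (fun i => t (Sum.inr i)) i :=
      fun i => IsPolyFun.sum Finset.univ fun j => (IsPolyFun.const (Q i j)).mul (hcr j)
    rcases IsPolyFun.eq_zero_or_eq_zero
      (((hQl (τ (Sum.inr 0))).mul (hQr (τ (Sum.inr 1)))).sub
        ((hQr (τ (Sum.inr 0))).mul (hQl (τ (Sum.inr 1)))))
      ((IsPolyFun.eval h).comp (ψ := fun t : Fin n ⊕ Fin n → K =>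
        restrictForms b (wedge (fun i => t (Sum.inl i)) (fun i => t (Sum.inr i))))
        fun i => IsPolyFun.sum _ fun q => (IsPolyFun.const _).mul
          (((hcl _).mul (hcr _)).sub ((hcl _).mul (hcr _)))) hmul with h0 | h0
    · have h1 := h0 (Sum.elim (R.mulVec (Pi.single (τ (Sum.inr 0)) 1))
        (R.mulVec (Pi.single (τ (Sum.inr 1)) 1)))
      simp only [Sum.elim_inl, Sum.elim_inr] at h1
      rw [show (fun i => R.mulVec (Pi.single (τ (Sum.inr 0)) 1) i) =
          R.mulVec (Pi.single (τ (Sum.inr 0)) 1) from rfl,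
        show (fun i => R.mulVec (Pi.single (τ (Sum.inr 1)) 1) i) =
          R.mulVec (Pi.single (τ (Sum.inr 1)) 1) from rfl,
        Matrix.mulVec_mulVec, Matrix.mulVec_mulVec, hQR, Matrix.one_mulVec,
        Matrix.one_mulVec] at h1
      simp at h1
    · exact h0 (Sum.elim x₁ x₂)
  -- For the rows (x | 1, 0) and (y | 0, 1) the minors with one column in the chart positions are
  -- y_i and -x_i, whence the sign.
  · refine le_topologicalKrullDim (isPolyFun_projectedChart b τ E R) (IsPolyFun.const 1)
      (ℓ 0 (τ (Sum.inr 1)))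
      (fun k => Sum.elim (fun i => -ℓ 1 (τ (Sum.inl i))) (fun i => ℓ 0 (τ (Sum.inl i)))
        (E.symm k)) hℓ₀ (fun t k => ?_) one_ne_zero
      fun t h => mk_restrictForms_mem_linearProjection b h
    obtain ⟨j, rfl⟩ := E.surjective k
    rw [Equiv.symm_apply_apply]
    rcases j with j | j
    · rw [Sum.elim_inl, LinearMap.neg_apply, hval]
      simp [chartVector_inr, chartVector_inl]
    · rw [Sum.elim_inr, hval]
      simp [chartVector_inr, chartVector_inl]

end DimensionProjection

/-! ### The dimension of the polar image -/

section DimensionPolar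

variable {K : Type*} [Field K] {n k : ℕ} {ι : Type*} [Fintype ι]

theorem exists_basis_inr_eq {e : ℕ} (he : Fintype.card ι = e + 2) {x y : ι → K}
    (h : LinearIndependent K ![x, y]) :
    ∃ B : Module.Basis (Fin e ⊕ Fin 2) K (ι → K), B (Sum.inr 0) = x ∧ B (Sum.inr 1) = y := by
  let B₀ : Module.Basis (Fin e ⊕ Fin 2) K (ι → K) :=
    (Pi.basisFun K ι).reindex (Fintype.equivOfCardEq (by simp [he]))
  obtain ⟨g, hg⟩ := exists_linearEquiv_apply_eq
    (B₀.linearIndependent.comp (Sum.inr : Fin 2 → _) Sum.inr_injective) h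
  exact ⟨B₀.map g, hg 0, hg 1⟩

/-- The Pfaffian is linear in every coordinate, so the cone over the Pfaffian hypersurface is a
rational variety of codimension one. -/
theorem topologicalKrullDim_zeroLocus_pullback [IsAlgClosed K] [CharZero K]
    {P : MvPolynomial (Pairs n) K} (hP : IsPfaffian P) (σ : Fin k ⊕ Fin k ≃ Fin n) (hn : 3 ≤ n)
    (hk : 2 ≤ k) (hirr : Irreducible P) {ρ : (ι → K) →ₗ[K] (Pairs n → K)}
    {j : (Pairs n → K) →ₗ[K] (ι → K)} (h : ρ ∘ₗ j = LinearMap.id) {e : ℕ}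
    (he : Fintype.card ι = e + 2) :
    topologicalKrullDim (zeroLocus (pullback P ρ)) = e := by
  have hj : ∀ y, ρ (j y) = y := LinearMap.congr_fun h
  have hg := IsHomogeneous.pullback (hP.isHomogeneous σ) ρ
  have hg0 := (irreducible_pullback_of_section (hP.isHomogeneous σ) hirr h).ne_zero
  refine le_antisymm (topologicalKrullDim_hypersurface_le hg hg0 le_rfl he) ?_
  obtain ⟨a, -, -, ha⟩ := exists_gradient_ne_zero (hP.isHomogeneous σ) hirr hk
  obtain ⟨q, hq⟩ := Function.ne_iff.1 ha
  -- If `a` were a multiple of the entry vector, Pf would vanish along the line through `a` in that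
  -- direction, contrary to its nonzero derivative there.
  have hind : LinearIndependent K ![j (Pi.single q 1), j a] := by
    rw [LinearIndependent.pair_iff]
    intro s t hst
    have h1 : s • Pi.single q 1 + t • a = 0 := by
      have := congrArg ρ hst
      rwa [map_add, map_smul, map_smul, hj, hj, map_zero] at this
    have ht : t = 0 := by
      by_contra ht
      have h2 : a = (-(t⁻¹ * s)) • Pi.single q 1 := by
        rw [neg_smul, eq_neg_iff_add_eq_zero, mul_smul, add_comm,
          ← smul_right_injective _ ht |>.eq_iff, smul_add, smul_smul, mul_inv_cancel₀ ht, one_smul,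
          smul_zero, h1]
      have h3 := hP.eval_add_smul_single σ a q 1
      rw [h2, ← add_smul, eval_smul_single_eq_zero hP hn, eval_smul_single_eq_zero hP hn,
        zero_add, one_mul, ← h2] at h3
      exact hq h3.symm
    refine ⟨?_, ht⟩
    have h2 := congrFun h1 q
    simpa [ht] using h2
  obtain ⟨B, hB0, hB1⟩ := exists_basis_inr_eq he hind
  set y : (Fin e → K) → ι → K := fun t => j a + ∑ l, t l • B (Sum.inl l)
  set α : (Fin e → K) → K := fun t => gradient P (ρ (y t)) q
  set β : (Fin e → K) → K := fun t => eval (ρ (y t)) P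
  -- Along the entry `q` the Pfaffian is β + sα, with zero s = -β/α; clearing the denominator gives
  -- the point αy - βj(e_q). The additional factor α makes φ vanish wherever α does, so all nonzero
  -- values of φ are on the hypersurface.
  set φ : (Fin e → K) → ι → K := fun t => α t • (α t • y t - β t • j (Pi.single q 1))
  have hy : ∀ i, IsPolyFun fun t => y t i := by
    intro i
    have h1 : ∀ t, y t i = j a i + ∑ l, t l * B (Sum.inl l) i := fun t => by
      simp [y, Finset.sum_apply]
    simp only [h1]
    exact (IsPolyFun.const _).add (IsPolyFun.sum _ fun l =>
      (IsPolyFun.coord l).mul (IsPolyFun.const _))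
  have hρy : ∀ r, IsPolyFun fun t => ρ (y t) r := fun r =>
    (IsPolyFun.linear ((LinearMap.proj r) ∘ₗ ρ)).comp hy
  have hα : IsPolyFun α := (IsPolyFun.eval (pderiv q P)).comp hρy
  have hβ : IsPolyFun β := (IsPolyFun.eval P).comp hρy
  have hcoord : ∀ t x, B.repr (φ t) x = α t * (α t * (B.repr (B (Sum.inr 1)) x +
      ∑ l, t l * B.repr (B (Sum.inl l)) x) - β t * B.repr (B (Sum.inr 0)) x) := by
    intro t x
    simp only [φ, y, map_smul, map_sub, map_add, map_sum, Finsupp.smul_apply, Finsupp.sub_apply,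
      Finsupp.add_apply, Finsupp.finsetSum_apply, smul_eq_mul, hB0, hB1]
  refine le_topologicalKrullDim (φ := φ) (q := fun t => α t * α t) (fun i => ?_) (hα.mul hα)
    (B.coord (Sum.inr 1)) (fun l => B.coord (Sum.inl l)) (fun t => ?_) (fun t l => ?_) ?_
    fun t ht => (mk_mem_zeroLocus hg ht).2 ?_
  · exact hα.mul ((hα.mul (hy i)).sub (hβ.mul (IsPolyFun.const _)))
  · rw [Module.Basis.coord_apply, hcoord]
    simp
  · rw [Module.Basis.coord_apply, hcoord]
    simp [Finsupp.single_apply, mul_assoc]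
  · have h0 : α 0 = gradient P a q := by simp [α, y, hj]
    exact mul_ne_zero (h0 ▸ hq) (h0 ▸ hq)
  · have h0 : α t ≠ 0 := fun h => ht (by simp only [φ, h, zero_smul])
    have h1 : ρ (φ t) = (α t * α t) • (ρ (y t) + (-(β t / α t)) • Pi.single q 1) := by
      simp only [φ, map_smul, map_sub, hj]
      rw [smul_add, smul_smul, smul_sub, smul_smul, smul_smul, sub_eq_add_neg, ← neg_smul]
      congr 2
      field_simp
    rw [eval_pullback, h1, IsHomogeneous.eval_smul (hP.isHomogeneous σ),
      hP.eval_add_smul_single σ]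
    change _ * (β t + -(β t / α t) * α t) = 0
    rw [neg_mul, div_mul_cancel₀ _ h0, add_neg_cancel, mul_zero]

end DimensionPolar

end HessianScorza

/-! ### The theorem -/

theorem corollary4p8 {K : Type*} [Field K] [IsAlgClosed K] [CharZero K] (m : ℕ) (hm : 2 ≤ m)
    (p : ℙ K (HessianScorza.Pairs (2 * m + 2) → K))
    (hp : p ∈ HessianScorza.grassmannianLines K (2 * m + 2))
    {ι : Type*} [Fintype ι] [DecidableEq ι]
    (b : Module.Basis ι K (HessianScorza.perp p))
    (F G : Set (ℙ K (ι → K)))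
    (hF : F = HessianScorza.hyperplaneSection b
      (HessianScorza.skewRankLocus K (2 * m + 2) (2 * m)))
    (hG : G = HessianScorza.linearProjection (HessianScorza.restrictForms b)
      (HessianScorza.grassmannianLines K (2 * m + 2))) :
    Fintype.card ι = 2 * m ^ 2 + 3 * m ∧
    ∃ f : MvPolynomial ι K,
      -- the equation of `F` is the Pfaffian of the generic skew-symmetric matrix in `p^⊥`
      f ^ 2 = (HessianScorza.genericSkew b).det ∧
      F = HessianScorza.zeroLocus f ∧
      -- (i)
      Irreducible f ∧ f.IsHomogeneous (m + 1) ∧ HessianScorza.hessian f = 0 ∧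
      HessianScorza.dualVariety F = G ∧
      -- (ii)
      (∃ g : MvPolynomial ι K, Irreducible g ∧ g.IsHomogeneous m ∧
        HessianScorza.polarImage f = HessianScorza.zeroLocus g) ∧
      (∃ L : Submodule K (ι → K), Module.finrank K L = 4 * m ∧
        HessianScorza.IsConeOver (HessianScorza.polarImage f) L
          (HessianScorza.dualVariety (HessianScorza.grassmannianLines K (2 * m)))) ∧
      -- (iii)
      HessianScorza.dualVariety F ⊆ HessianScorza.polarImage f ∧
      ∃ d e : ℕ,
        topologicalKrullDim (HessianScorza.dualVariety F) = d ∧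
        topologicalKrullDim (HessianScorza.polarImage f) = e ∧
        (e : ℤ) - d = 2 * (m : ℤ) ^ 2 - m - 2 := by
  obtain ⟨u, v, hp' : p.rep = HessianScorza.wedge u v⟩ := hp
  let σ : Fin (m + 1) ⊕ Fin (m + 1) ≃ Fin (2 * m + 2) :=
    Fintype.equivOfCardEq (by simp; omega)
  -- The irreducibility of a Pfaffian is stated for half-size `k + 1` with `1 ≤ k`; for the smaller
  -- Pfaffian, of half-size m, this is m ≥ 2.
  obtain ⟨k, rfl⟩ : ∃ k, m = k + 1 := ⟨m - 1, by omega⟩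
  let σ' : Fin (k + 1) ⊕ Fin (k + 1) ≃ Fin (2 * (k + 1)) :=
    Fintype.equivOfCardEq (by simp; omega)
  obtain ⟨P, hP⟩ := HessianScorza.exists_isPfaffian (K := K) σ
  obtain ⟨P', hP'⟩ := HessianScorza.exists_isPfaffian (K := K) σ'
  obtain ⟨s⟩ := HessianScorza.exists_splitting (n' := 2 * (k + 1)) rfl
    (HessianScorza.linearIndependent_of_wedge_ne_zero (hp' ▸ p.rep_nonzero))
  obtain ⟨ρ, hρ⟩ := HessianScorza.exists_quotientMap b hp' s
  have hsec := HessianScorza.quotientMap_comp_section b s hρ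
  have hcard : Fintype.card ι = 2 * (k + 1) ^ 2 + 3 * (k + 1) := by
    have h1 := HessianScorza.card_add_one_eq b
    have h2 := HessianScorza.card_pairs (2 * (k + 1) + 2)
    rw [← h1, show 2 * (k + 1) + 2 - 1 = 2 * k + 3 by omega] at h2
    nlinarith
  have hirr' : Irreducible P' := hP'.irreducible (by omega) σ'
  have hirr := HessianScorza.irreducible_pullback_coordMap b hP (by omega) σ hp'
  have hF' := hF.trans (HessianScorza.hyperplaneSection_skewRankLocus b hP σ rfl)
  have hg := HessianScorza.irreducible_pullback_of_section (hP'.isHomogeneous σ') hirr' hsec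
  have hghom := HessianScorza.IsHomogeneous.pullback (hP'.isHomogeneous σ') ρ
  have hpol := HessianScorza.polarImage_pullback_coordMap b hP hP' σ σ' hirr' hp' s hρ
    hirr.ne_zero
  have hdual := HessianScorza.dualVariety_zeroLocus_pullback_coordMap b hP σ hm σ' rfl
    (by omega) hp' hirr
  rw [← hF', ← hG] at hdual
  refine ⟨hcard, HessianScorza.pullback P (HessianScorza.coordMap b),
    HessianScorza.pullback_coordMap_sq b hP, hF', hirr,
    HessianScorza.IsHomogeneous.pullback (hP.isHomogeneous σ) _,
    HessianScorza.hessian_eq_zero_of_polarImage hghom hg hm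
      (HessianScorza.eval_gradient_eq_zero b hP hP' σ hp' s hρ hirr.ne_zero) hpol,
    hdual, ⟨_, hg, hghom, hpol⟩, ⟨LinearMap.ker ρ, ?_, ?_⟩, ?_,
    -- The dimension 4m of the Grassmannian of lines in P^(2m+1), which the projection preserves,
    -- and that of a hypersurface in a projective space with `Fintype.card ι` coordinates.
    2 * (2 * (k + 1)), 2 * (k + 1) ^ 2 + 3 * (k + 1) - 2, ?_, ?_, ?_⟩
  -- The kernel of ρ has dimension (2m² + 3m) - m(2m - 1) = 4m.
  · have h1 := HessianScorza.finrank_ker_of_section hsec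
    have h2 := HessianScorza.card_pairs (2 * (k + 1))
    rw [show 2 * (k + 1) - 1 = 2 * k + 1 by omega] at h2
    rw [hcard] at h1
    nlinarith
  · rw [hpol, HessianScorza.dualVariety_grassmannianLines hP' σ']
    exact HessianScorza.isConeOver_zeroLocus_pullback (hP'.isHomogeneous σ') (by omega)
      (HessianScorza.zeroLocus_pfaffian_nonempty hP' σ' (by omega))
      (fun a ha => HessianScorza.exists_eval_add_ne_zero hP' σ' ha) hsec
  · rw [hF', HessianScorza.dualVariety_zeroLocus
      (HessianScorza.IsHomogeneous.pullback (hP.isHomogeneous σ) _) hirr (by omega)]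
    refine closure_mono ?_
    rintro _ ⟨x, -, h, rfl⟩
    exact ⟨x, h, rfl⟩
  · rw [hdual, hG]
    exact HessianScorza.topologicalKrullDim_linearProjection_grassmannianLines b rfl (by omega) hp'
  · rw [hpol]
    refine HessianScorza.topologicalKrullDim_zeroLocus_pullback hP' σ' (by omega) hm hirr' hsec ?_
    rw [hcard]
    have : 0 < (k + 1) ^ 2 := by positivity
    omega
  · have : 1 ≤ (k + 1) ^ 2 := Nat.one_le_pow _ _ (by omega)
    push_cast [Nat.cast_sub (show 2 ≤ 2 * (k + 1) ^ 2 + 3 * (k + 1) by omega)]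
    ring
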